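/- **Setting.** A *dartboard sketch* has an at most countable set $\mathscr C$ of cells whose areas sum to $1$. Its state is the set of occupied cells. Each new element throws a dart, independently, that lands in a cell $c$ with probability equal to the area of $c$; the next state is a function of the current state and of $c$. On reachable states, every cell that has been hit is occupied, a dart in an occupied cell does not change the state, and occupied cells stay occupied. Let $S_k$ be the state after $k$ distinct elements, $P_k=\Pr(S_k\ne S_{k-1}\mid S_{k-1})$, and let $E_n=\sum_{k=1}^{n}\mathbf 1[S_k\neq S_{k-1}]/P_k$ be the Martingale estimator of the cardinality $n$. The sketch is *linearizable* if for some linear order of the cells there is a monotone $\{0,1\}$-valued function $\phi$ with $Y_c=Z_c\vee\phi\big((Y_d)_{d<c}\big)$ for all cells $c$, where $Y_c,Z_c\in\{0,1\}$ indicate that $c$ is occupied, respectively has been hit by a dart, and if $Y_c$ does not depend on the darts that hit cells later than $c$ (this is automatic for finitely many cells). Here $\phi$ may depend on $c$. A *scheme* is a family of sketches $(X_m)_{m\ge 1}$ with all the darts defined on one probability space (with any joint law across different $m$). Write $P_{m,k}$, $E_{m,k}$, $S_{m,k}$ for the quantities of $X_m$. It is *scale-invariant with constant $\kappa$* if for every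 real $\lambda>0$ there is a constant $\kappa_\lambda$ such that $\lambda P_{m,\lfloor\lambda m\rfloor}\to\kappa_\lambda$ almost surely as $m\to\infty$, and $\kappa_\lambda\to\kappa$ as $\lambda\to\infty$. The memory of $X_m$, compressed to its entropy, is $\bar H_m=\sup_n H(S_{m,n})$ bits, where $H$ is the Shannon entropy. Its memory-variance product after $\lambda m$ insertions is $$\mathrm{MVP}(m,\lambda)=\bar H_m\cdot\frac{\operatorname{Var}(E_{m,\lfloor\lambda m\rfloor})}{\lfloor\lambda m\rfloor^2},$$ and the limiting MVP is $\lim_{\lambda\to\infty}\lim_{m\to\infty}\mathrm{MVP}(m,\lambda)$. *Fishmonger* with $m$ columns is the entropy-compressed smoothed base-$e$ PCSA sketch: column $i\in\{0,\dots,m-1\}$ has width $1/m$ and consists of an always occupied cell covering the heights $[e^{-i/m},1)$ and of the cells covering $[e^{-(j+1)-i/m},e^{-j-i/m})$, $j=0,1,2,\dots$; among the latter cells the occupied ones are exactly those that have been hit. Let $H_0=\frac1{\ln 2}+\sum_{k=1}^\infty\frac1k\log_2\!\left(1+\frac1k\right)$ (so that $H_0/2\approx1.63$). **Statement.** 1.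 Every scheme of linearizable sketches that is scale-invariant with a constant $\kappa>0$ satisfies $$\liminf_{\lambda\to\infty}\ \liminf_{m\to\infty}\ \mathrm{MVP}(m,\lambda)\ \ge\ \frac{H_0}{2};$$ in particular its limiting MVP, if it exists, is at least $H_0/2$. 2. Fishmonger is linearizable and scale-invariant with $\kappa=1$, and its limiting MVP exists and equals $H_0/2$. So Martingale Fishmonger has the least limiting MVP among all Martingale $X$ with $X$ linearizable and scale-invariant. -/

import Mathlib

open MeasureTheory ProbabilityTheory Filter Topology
open scoped ENNReal

/-- A sketch in the dartboard model. The dartboard is partitioned into the cells `c : C`; a dart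
thrown uniformly at random lands in the cell `c` with probability `area c`. The state is the set of
occupied cells; `step s c` is the state that follows `s` when a dart lands in the cell `c`.
The rules are imposed on the reachable states, i.e. on the states `l.foldl step init` that follow
a finite sequence `l` of darts. -/
structure DartboardSketch (C : Type*) where
  /-- the areas of the cells (nonnegative, of total area one) -/
  area : PMF C
  /-- the state before any dart is thrown -/
  init : Set C
  /-- the transition function -/
  step : Set C → C → Set C
  /-- every cell with at least one dart is occupied -/
  occupied_of_hit : ∀ (l : List C), ∀ c ∈ l, c ∈ l.foldl step init
  /-- a dart that lands in an occupied cell does not change the state -/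
  step_eq_of_occupied : ∀ (l : List C), ∀ c ∈ l.foldl step init,
    step (l.foldl step init) c = l.foldl step init
  /-- occupied cells never become unoccupied -/
  occupied_mono : ∀ (l : List C) (c : C), l.foldl step init ⊆ step (l.foldl step init) c

namespace DartboardSketch

section Basic

variable {C : Type*} (X : DartboardSketch C)

/-- The state after the darts `l` have been thrown, in this order. -/
def run (l : List C) : Set C := l.foldl X.step X.init

/-- Linearizability: for some linear order of the cells, `Y_c = Z_c ∨ φ (Y_d : d < c)` with `φ`
monotone, where `Y_c`, `Z_c` tell whether `c` is occupied, resp. has been hit. (The function `φ` on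
bit strings is given here by its restrictions `φ c` to the strings of statuses of the predecessors
of `c`, a string being encoded by the set of its ones.)
The last clause says that the status of `c` does not depend on the darts that hit later cells. It
follows from the recursion when there are finitely many cells, or when the order is a well-order;
it is spelled out so that the definition also has its intended meaning for infinitely many cells
in other orders (e.g. when every column is read from its smallest cell to its largest). -/
def IsLinearizable : Prop :=
  ∃ (_ : LinearOrder C) (φ : C → Set C → Prop),
    (∀ c, Monotone (φ c)) ∧
    (∀ (l : List C) (c : C), c ∈ X.run l ↔ c ∈ l ∨ φ c (X.run l ∩ Set.Iio c)) ∧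
    (∀ (l l' : List C) (c : C), (∀ d ≤ c, d ∈ l ↔ d ∈ l') → (c ∈ X.run l ↔ c ∈ X.run l'))

/-- The probability that the next dart changes the state `s`. -/
noncomputable def changeProb (s : Set C) : ℝ :=
  (∑' c, Set.indicator {c | X.step s c ≠ s} X.area c).toReal

end Basic

section Evolution

variable {C Ω : Type*} (X : DartboardSketch C)

/-- `D 0, D 1, …` are the cells hit by independent, uniformly random darts, one for each new
element of the stream. -/
structure IsDartSequence [MeasurableSpace C] [MeasurableSpace Ω] (μ : Measure Ω)
    (D : ℕ → Ω → C) : Prop where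
  measurable : ∀ k, Measurable (D k)
  indep : iIndepFun D μ
  law : ∀ k, μ.map (D k) = X.area.toMeasure

/-- `S_k`, the state after `k` distinct elements. -/
def state (D : ℕ → Ω → C) (k : ℕ) (ω : Ω) : Set C :=
  X.run ((List.range k).map fun i => D i ω)

/-- `P_k` (for `k ≥ 1`), the conditional probability given `S_{k-1}` that `S_k ≠ S_{k-1}`. -/
noncomputable def stateChangeProb (D : ℕ → Ω → C) (k : ℕ) (ω : Ω) : ℝ :=
  X.changeProb (X.state D (k - 1) ω)

open Classical in
/-- The martingale estimator `E_n = ∑_{k=1}^n 1[S_k ≠ S_{k-1}] / P_k`. -/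
noncomputable def martingaleEstimator (D : ℕ → Ω → C) (n : ℕ) (ω : Ω) : ℝ :=
  ∑ k ∈ Finset.Icc 1 n,
    if X.state D k ω ≠ X.state D (k - 1) ω then 1 / X.stateChangeProb D k ω else 0

/-- The Shannon entropy, in bits, of a random variable with countably many values. -/
noncomputable def entropy [MeasurableSpace Ω] {α : Type*} (S : Ω → α) (μ : Measure Ω) : ℝ≥0∞ :=
  ∑' s : α, ENNReal.ofReal (Real.negMulLog (μ.real (S ⁻¹' {s})) / Real.log 2)

/-- The memory, in bits, of the sketch compressed to its entropy: the least upper bound, over all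
cardinalities `n`, of the entropy of the state. -/
noncomputable def memory [MeasurableSpace Ω] (μ : Measure Ω) (D : ℕ → Ω → C) : ℝ≥0∞ :=
  ⨆ n : ℕ, entropy (X.state D n) μ

/-- The relative variance `Var(E_n) / n²` of the martingale estimator at cardinality `n`. -/
noncomputable def relVariance [MeasurableSpace Ω] (μ : Measure Ω) (D : ℕ → Ω → C) (n : ℕ) :
    ℝ≥0∞ :=
  evariance (X.martingaleEstimator D n) μ / (n : ℝ≥0∞) ^ 2

end Evolution

section Scheme

/-! A sketching scheme is a family of sketches `X m`, where `m` is the number of subsketches. The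
darts of all the `X m` live on one probability space, with an arbitrary joint law across
different `m`. The real number `r` is the number of insertions per subsketch. -/

variable {C : ℕ → Type*} {Ω : Type*} [MeasurableSpace Ω]

/-- Scale-invariance with constant `κ`: for each `r > 0`, `r * P_{m, r m}` converges almost surely
to a constant `κ_r` as `m → ∞`, and `κ_r → κ` as `r → ∞`. -/
def IsScaleInvariant (X : ∀ m, DartboardSketch (C m)) (μ : Measure Ω) (D : ∀ m, ℕ → Ω → C m)
    (κ : ℝ) : Prop :=
  ∃ κ' : ℝ → ℝ,
    (∀ r : ℝ, 0 < r → ∀ᵐ ω ∂μ,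
      Tendsto (fun m : ℕ => r * (X m).stateChangeProb (D m) ⌊r * m⌋₊ ω) atTop (𝓝 (κ' r))) ∧
    Tendsto κ' atTop (𝓝 κ)

/-- The memory-variance product of the sketch `X m` under the martingale estimator, after
`r m` insertions. -/
noncomputable def mvp (X : ∀ m, DartboardSketch (C m)) (μ : Measure Ω) (D : ∀ m, ℕ → Ω → C m)
    (r : ℝ) (m : ℕ) : ℝ≥0∞ :=
  (X m).memory μ (D m) * (X m).relVariance μ (D m) ⌊r * m⌋₊

/-- The limiting memory-variance product, `lim_{r → ∞} lim_{m → ∞}`, with lower limits, so that it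
is defined for every scheme. -/
noncomputable def lowerLimitingMVP (X : ∀ m, DartboardSketch (C m)) (μ : Measure Ω)
    (D : ∀ m, ℕ → Ω → C m) : ℝ≥0∞ :=
  liminf (fun r : ℝ => liminf (fun m : ℕ => mvp X μ D r m) atTop) atTop

/-- The limiting memory-variance product `lim_{r → ∞} lim_{m → ∞}` exists and equals `v`. -/
def HasLimitingMVP (X : ∀ m, DartboardSketch (C m)) (μ : Measure Ω)
    (D : ∀ m, ℕ → Ω → C m) (v : ℝ≥0∞) : Prop :=
  ∃ w : ℝ → ℝ≥0∞,
    (∀ r : ℝ, 0 < r → Tendsto (fun m : ℕ => mvp X μ D r m) atTop (𝓝 (w r))) ∧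
    Tendsto w atTop (𝓝 v)

end Scheme

end DartboardSketch

/-- The constant `H₀ = 1 / ln 2 + ∑_{k ≥ 1} (1 / k) log₂ (1 + 1 / k)`. -/
noncomputable def fishmongerH0 : ℝ :=
  (Real.log 2)⁻¹ + ∑' k : ℕ, (1 / ((k : ℝ) + 1)) * Real.logb 2 (1 + 1 / ((k : ℝ) + 1))

/-! The Fishmonger sketch: the entropy-compressed, smoothed base-`e` PCSA sketch. Each of the `n`
columns has width `1 / n`. Column `i` is scaled down by the factor `e ^ (-i / n)`: it consists of an
always occupied dummy cell `(i, 0)`, which covers the heights in `[e ^ (-i / n), 1)`, and of cells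
`(i, j + 1)`, `j = 0, 1, …`, which cover
`[e ^ (-(j + 1)) * e ^ (-i / n), e ^ (-j) * e ^ (-i / n))`. -/

/-- Vertical extent of the cell `(i, j)` of the smoothed base-`e` partition with `n` columns. -/
noncomputable def fishmongerHeight (n : ℕ) (i : Fin n) : ℕ → ℝ
  | 0 => 1 - Real.exp (-((i : ℝ) / n))
  | j + 1 => (Real.exp (-(j : ℝ)) - Real.exp (-((j : ℝ) + 1))) * Real.exp (-((i : ℝ) / n))

theorem fishmongerHeight_nonneg (n : ℕ) (i : Fin n) (j : ℕ) : 0 ≤ fishmongerHeight n i j := by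
  cases j with
  | zero =>
    have : Real.exp (-((i : ℝ) / n)) ≤ 1 := Real.exp_le_one_iff.2 (by
      have : (0 : ℝ) ≤ (i : ℝ) / n := by positivity
      linarith)
    simp only [fishmongerHeight]
    linarith
  | succ j =>
    refine mul_nonneg ?_ (Real.exp_pos _).le
    have : Real.exp (-((j : ℝ) + 1)) ≤ Real.exp (-(j : ℝ)) := Real.exp_le_exp.2 (by linarith)
    linarith

theorem hasSum_fishmongerHeight (n : ℕ) (i : Fin n) : HasSum (fishmongerHeight n i) 1 := by
  have h1 : HasSum (fun j : ℕ => Real.exp (-(1 : ℝ)) ^ j) (1 - Real.exp (-1))⁻¹ :=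
    hasSum_geometric_of_lt_one (Real.exp_pos _).le (Real.exp_lt_one_iff.2 (by norm_num))
  have hne : (1 - Real.exp (-1 : ℝ)) ≠ 0 := by
    have : Real.exp (-1 : ℝ) < 1 := Real.exp_lt_one_iff.2 (by norm_num)
    linarith
  have h2 : HasSum (fun j : ℕ => fishmongerHeight n i (j + 1)) (Real.exp (-((i : ℝ) / n))) := by
    have h3 := h1.mul_right ((1 - Real.exp (-1)) * Real.exp (-((i : ℝ) / n)))
    rw [← mul_assoc, inv_mul_cancel₀ hne, one_mul] at h3
    suffices hfun : (fun j : ℕ => fishmongerHeight n i (j + 1)) = fun j : ℕ =>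
        Real.exp (-(1 : ℝ)) ^ j * ((1 - Real.exp (-1)) * Real.exp (-((i : ℝ) / n))) by
      rw [hfun]
      exact h3
    funext j
    have e1 : Real.exp (-(j : ℝ)) = Real.exp (-(1 : ℝ)) ^ j := by
      rw [← Real.exp_nat_mul]
      ring_nf
    have e2 : Real.exp (-((j : ℝ) + 1)) = Real.exp (-(1 : ℝ)) ^ j * Real.exp (-1) := by
      rw [← e1, ← Real.exp_add]
      ring_nf
    simp only [fishmongerHeight, e1, e2]
    ring
  have h4 := (hasSum_nat_add_iff (f := fishmongerHeight n i) 1).1 h2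
  simpa [fishmongerHeight] using h4

/-- The areas of the cells of the smoothed base-`e` partition with `n ≥ 1` columns. -/
noncomputable def fishmongerArea (n : ℕ) (hn : 0 < n) : PMF (Fin n × ℕ) :=
  ⟨fun c => ENNReal.ofReal (fishmongerHeight n c.1 c.2 / n), by
    have h : ∀ i : Fin n, ∑' j : ℕ, ENNReal.ofReal (fishmongerHeight n i j / n)
        = ENNReal.ofReal (1 / n) := by
      intro i
      have hs := (hasSum_fishmongerHeight n i).div_const (n : ℝ)
      rw [← ENNReal.ofReal_tsum_of_nonneg _ hs.summable, hs.tsum_eq]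
      intro j
      exact div_nonneg (fishmongerHeight_nonneg n i j) (Nat.cast_nonneg n)
    have hn' : (n : ℝ) ≠ 0 := by positivity
    have : ∑' c : Fin n × ℕ, ENNReal.ofReal (fishmongerHeight n c.1 c.2 / n) = 1 := by
      rw [ENNReal.tsum_prod (f := fun i j => ENNReal.ofReal (fishmongerHeight n i j / n))]
      simp_rw [h]
      rw [tsum_fintype, Finset.sum_const, Finset.card_univ, Fintype.card_fin, nsmul_eq_mul,
        ← ENNReal.ofReal_natCast, ← ENNReal.ofReal_mul (by positivity), mul_one_div_cancel hn',
        ENNReal.ofReal_one]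
    rw [← this]
    exact ENNReal.summable.hasSum⟩

theorem mem_foldl_insert {C : Type*} (l : List C) (s : Set C) (c : C) :
    c ∈ l.foldl (fun s c => insert c s) s ↔ c ∈ l ∨ c ∈ s := by
  induction l generalizing s with
  | nil => simp
  | cons a l ih =>
    simp only [List.foldl_cons, ih, Set.mem_insert_iff, List.mem_cons]
    tauto

/-- The Fishmonger sketch with `m` columns (with one column for the irrelevant value `m = 0`). The
occupied cells are the dummy cells and those that have been hit. -/
noncomputable def fishmonger (m : ℕ) : DartboardSketch (Fin (max m 1) × ℕ) where
  area := fishmongerArea (max m 1) (by positivity)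
  init := {c | c.2 = 0}
  step s c := insert c s
  occupied_of_hit l c hc := (mem_foldl_insert l _ c).2 (Or.inl hc)
  step_eq_of_occupied _ _ hc := Set.insert_eq_of_mem hc
  occupied_mono _ _ := Set.subset_insert _ _

/-! The memory-variance product splits into a variance bound and a memory bound, and the constant
`κ` cancels between them.

Variance. `E_n - n` is a martingale whose increments have conditional variance `1 / P_k - 1`. By
scale-invariance `P_k` is close to `κ / s` at `k = s m` for large `s`, so the variance after `r m`
insertions is about `m ∫ s / κ ds = m r² / (2κ)`, and the relative variance about `1 / (2κm)`.
Fatou's lemma yields the lower bound. For an arbitrary scheme the increments are unbounded, so the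
estimator is compared with its version stopped at a small free area; a fourth-moment estimate
(`integral_dartMart_four_le`) shows that the unlikely event where the two differ costs little
(`le_evariance_of_eq_dartMart`).

Memory. If the number of darts is Poisson with mean `t`, the event that `c` is hit is independent of
the hits elsewhere (`poissonExp_notMem`). Let `p` be the area of `c` and `g_c(t)` the probability
that the predecessors of `c` have not made it occupied. The chain rule along the linear order bounds
the entropy at time `t` below by `∑ g_c(t) h(e^{-pt})`, with `h` the binary entropy
(`sum_freeProb_le_natEntropy`), while the expected free area is `∑ g_c(t) p e^{-pt}`. For one cell,
`∫ h(e^{-pt}) dt/t` over `(0, ∞)` is `H₀` in nats, that is, `H₀ ∫ p e^{-pt} dt`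
(`lintegral_binEntropy_div`). The quotient of these two integrands is decreasing
(`antitoneOn_entropy_ratio`), and so is `g_c` because `φ` is monotone; a decreasing weight therefore
favours the entropy side (`lintegral_weighted_binEntropy`). Summed over cells and integrated over
`[a m, b m]`, the entropy against `dt/t` is at least `H₀` times the integrated free area, about `H₀
κ m log(b/a)`, up to boundary terms that do not grow with `b/a`. For large `b/a` some entropy must
be nearly `κ H₀ m`. Returning to a deterministic number of darts costs only the entropy of a Poisson
variable, which is sublinear in `t`.

Fishmonger. Its nontrivial areas form a geometric progression with ratio `e^{-1/m}`. By
subadditivity its entropy is at most a sum of binary entropies, a Riemann sum for `m H₀`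
(`tsum_binEntropy_exp_neg_le`); the general memory bound with `κ = 1` is the matching lower bound.
The free area concentrates around an explicit mean, by the fourth-moment estimate again, and is
bounded below deterministically on bounded scales, so the variance limit follows by dominated
convergence. -/

/-! ### Shannon entropy of discrete random variables -/

/-- The summand `-x log x` of the entropy, with extended nonnegative values. -/
noncomputable def enegMulLog (x : ℝ≥0∞) : ℝ≥0∞ := ENNReal.ofReal (Real.negMulLog x.toReal)

theorem enegMulLog_eq {x : ℝ≥0∞} (hx : x ≤ 1) :
    enegMulLog x = ENNReal.ofReal (-Real.log x.toReal) * x := by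
  have hx' : x ≠ ∞ := ne_top_of_le_ne_top ENNReal.one_ne_top hx
  have h1 : x.toReal ≤ 1 := by simpa using ENNReal.toReal_mono ENNReal.one_ne_top hx
  have h2 : 0 ≤ -Real.log x.toReal := by
    have := Real.log_nonpos ENNReal.toReal_nonneg h1
    linarith
  nth_rewrite 3 [← ENNReal.ofReal_toReal hx']
  rw [← ENNReal.ofReal_mul h2, enegMulLog, Real.negMulLog]
  congr 1
  ring

/-- Each term is at most the total, so its `-log` is at least that of the total; then average with
the weights `v a`. -/
theorem enegMulLog_tsum_le {α : Type*} (v : α → ℝ≥0∞) (hv : ∑' a, v a ≤ 1) :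
    enegMulLog (∑' a, v a) ≤ ∑' a, enegMulLog (v a) := by
  rw [enegMulLog_eq hv, ← ENNReal.tsum_mul_left]
  refine ENNReal.tsum_le_tsum fun a => ?_
  have ha : v a ≤ ∑' a, v a := ENNReal.le_tsum a
  rw [enegMulLog_eq (ha.trans hv)]
  rcases eq_or_ne (v a) 0 with h0 | h0
  · simp [h0]
  gcongr
  · have hne : v a ≠ ∞ := ne_top_of_le_ne_top ENNReal.one_ne_top (ha.trans hv)
    exact ENNReal.toReal_pos h0 hne
  · exact ne_top_of_le_ne_top ENNReal.one_ne_top hv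

theorem enegMulLog_mul {x y : ℝ≥0∞} (hx : x ≤ 1) (hy : y ≤ 1) :
    enegMulLog (x * y) = y * enegMulLog x + x * enegMulLog y := by
  have hx' : x ≠ ∞ := ne_top_of_le_ne_top ENNReal.one_ne_top hx
  have hy' : y ≠ ∞ := ne_top_of_le_ne_top ENNReal.one_ne_top hy
  have h1 : x.toReal ≤ 1 := by simpa using ENNReal.toReal_mono ENNReal.one_ne_top hx
  have h2 : y.toReal ≤ 1 := by simpa using ENNReal.toReal_mono ENNReal.one_ne_top hy
  have e1 := Real.negMulLog_nonneg ENNReal.toReal_nonneg h1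
  have e2 := Real.negMulLog_nonneg ENNReal.toReal_nonneg h2
  simp only [enegMulLog]
  rw [ENNReal.toReal_mul, Real.negMulLog_mul,
    ENNReal.ofReal_add (mul_nonneg ENNReal.toReal_nonneg e1)
      (mul_nonneg ENNReal.toReal_nonneg e2),
    ENNReal.ofReal_mul ENNReal.toReal_nonneg, ENNReal.ofReal_mul ENNReal.toReal_nonneg,
    ENNReal.ofReal_toReal hx', ENNReal.ofReal_toReal hy']

theorem enegMulLog_add_le {x y : ℝ≥0∞} (h : x + y ≤ 1) :
    enegMulLog (x + y) ≤ enegMulLog x + enegMulLog y := by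
  have := enegMulLog_tsum_le (fun b : Bool => cond b x y) (by
    rw [tsum_fintype]; simpa using h)
  simpa [tsum_fintype] using this

section Discrete

variable {Ω α β : Type*} [MeasurableSpace Ω]

/-- A random variable with countably many values and measurable level sets. -/
structure IsDiscreteRV (S : Ω → α) : Prop where
  countable : (Set.range S).Countable
  measurable : ∀ s, MeasurableSet (S ⁻¹' {s})

/-- Every preimage is a countable union of level sets, so states, which are subsets of `C`, need no
σ-algebra on their value space. -/
theorem IsDiscreteRV.measurableSet_preimage {S : Ω → α} (hS : IsDiscreteRV S) (A : Set α) :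
    MeasurableSet (S ⁻¹' A) := by
  have : S ⁻¹' A = ⋃ s ∈ A ∩ Set.range S, S ⁻¹' {s} := by
    ext ω
    simp
  rw [this]
  exact MeasurableSet.biUnion (hS.countable.mono Set.inter_subset_right) fun s _ => hS.measurable s

theorem IsDiscreteRV.comp {S : Ω → α} (hS : IsDiscreteRV S) (f : α → β) :
    IsDiscreteRV (fun ω => f (S ω)) where
  countable := by
    have : Set.range (fun ω => f (S ω)) = f '' Set.range S := by
      rw [← Set.range_comp]; rfl
    rw [this]
    exact hS.countable.image f
  measurable s := hS.measurableSet_preimage (f ⁻¹' {s})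

theorem IsDiscreteRV.prodMk {S : Ω → α} {T : Ω → β} (hS : IsDiscreteRV S) (hT : IsDiscreteRV T) :
    IsDiscreteRV (fun ω => (S ω, T ω)) where
  countable := (hS.countable.prod hT.countable).mono (by
    rintro _ ⟨ω, rfl⟩
    exact ⟨⟨ω, rfl⟩, ⟨ω, rfl⟩⟩)
  measurable s := by
    have : (fun ω => (S ω, T ω)) ⁻¹' {s} = S ⁻¹' {s.1} ∩ T ⁻¹' {s.2} := by
      ext ω
      simp [Prod.ext_iff]
    rw [this]
    exact (hS.measurable _).inter (hT.measurable _)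

theorem IsDiscreteRV.measurable_comp [MeasurableSpace β] {S : Ω → α} (hS : IsDiscreteRV S)
    (f : α → β) : Measurable (fun ω => f (S ω)) :=
  fun A _ => hS.measurableSet_preimage (f ⁻¹' A)

open Classical in
theorem IsDiscreteRV.measure_inter_preimage {S : Ω → α} (hS : IsDiscreteRV S) (μ : Measure Ω)
    (E : Set Ω) (A : Set α) :
    μ (E ∩ S ⁻¹' A) = ∑' s, if s ∈ A then μ (E ∩ S ⁻¹' {s}) else 0 := by
  have hcount : (A ∩ Set.range S).Countable := hS.countable.mono Set.inter_subset_right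
  have key : μ.restrict E (S ⁻¹' A) = ∑' s : ↥(A ∩ Set.range S), μ.restrict E (S ⁻¹' {s.1}) := by
    have h2 : S ⁻¹' A = ⋃ s ∈ A ∩ Set.range S, S ⁻¹' {s} := by
      ext ω
      simp
    rw [h2, measure_biUnion hcount]
    · intro x _ y _ hxy
      exact (Set.disjoint_singleton.2 hxy).preimage S
    · exact fun s _ => hS.measurable s
  rw [Measure.restrict_apply (hS.measurableSet_preimage A), Set.inter_comm] at key
  rw [key, tsum_subtype (A ∩ Set.range S) (fun s => μ.restrict E (S ⁻¹' {s}))]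
  refine tsum_congr fun s => ?_
  rw [Set.indicator_apply, Measure.restrict_apply (hS.measurable s), Set.inter_comm _ E]
  by_cases hA : s ∈ A
  · by_cases hr : s ∈ Set.range S
    · simp [hA, hr]
    · have : S ⁻¹' {s} = ∅ := by
        ext ω
        simp only [Set.mem_preimage, Set.mem_singleton_iff, Set.mem_empty_iff_false, iff_false]
        exact fun h => hr ⟨ω, h⟩
      simp [hA, this]
  · simp [hA]

open Classical in
theorem IsDiscreteRV.measure_preimage {S : Ω → α} (hS : IsDiscreteRV S) (μ : Measure Ω)
    (A : Set α) : μ (S ⁻¹' A) = ∑' s, if s ∈ A then μ (S ⁻¹' {s}) else 0 := by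
  simpa using hS.measure_inter_preimage μ Set.univ A

theorem IsDiscreteRV.tsum_measure {S : Ω → α} (hS : IsDiscreteRV S) (μ : Measure Ω)
    [IsProbabilityMeasure μ] : ∑' s, μ (S ⁻¹' {s}) = 1 := by
  simpa using (hS.measure_preimage μ Set.univ).symm

theorem IsDiscreteRV.lintegral {S : Ω → α} (hS : IsDiscreteRV S) (μ : Measure Ω)
    (f : α → ℝ≥0∞) : ∫⁻ ω, f (S ω) ∂μ = ∑' s, f s * μ (S ⁻¹' {s}) := by
  classical
  have h1 : ∀ ω, f (S ω) = ∑' s : Set.range S, Set.indicator (S ⁻¹' {s.1}) (fun _ => f s) ω := by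
    intro ω
    rw [tsum_eq_single ⟨S ω, ω, rfl⟩]
    · simp
    · rintro ⟨s, hs⟩ hne
      rw [Set.indicator_of_notMem]
      intro hm
      exact hne (Subtype.ext hm.symm)
  have : Countable (Set.range S) := hS.countable
  simp_rw [h1]
  rw [lintegral_tsum fun s => (measurable_const.indicator (hS.measurable _)).aemeasurable]
  simp_rw [lintegral_indicator (hS.measurable _), setLIntegral_const]
  rw [tsum_subtype (Set.range S) (fun s => f s * μ (S ⁻¹' {s}))]
  refine tsum_congr fun s => ?_
  by_cases hr : s ∈ Set.range S
  · simp [hr]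
  · have : S ⁻¹' {s} = ∅ := by
      ext ω
      simp only [Set.mem_preimage, Set.mem_singleton_iff, Set.mem_empty_iff_false, iff_false]
      exact fun h => hr ⟨ω, h⟩
    simp [hr, this]

/-- The Shannon entropy in nats. -/
noncomputable def natEntropy (S : Ω → α) (μ : Measure Ω) : ℝ≥0∞ :=
  ∑' s : α, enegMulLog (μ (S ⁻¹' {s}))

theorem entropy_eq_natEntropy (S : Ω → α) (μ : Measure Ω) :
    DartboardSketch.entropy S μ = ENNReal.ofReal (Real.log 2)⁻¹ * natEntropy S μ := by
  have h2 : 0 < Real.log 2 := Real.log_pos (by norm_num)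
  rw [DartboardSketch.entropy, natEntropy, ← ENNReal.tsum_mul_left]
  refine tsum_congr fun s => ?_
  rw [enegMulLog, ← ENNReal.ofReal_mul (inv_nonneg.2 h2.le), div_eq_inv_mul]
  rfl

variable {μ : Measure Ω} [IsProbabilityMeasure μ]

/-- Applying a function merges atoms; subadditivity of `-x log x` on each fibre gives the bound. -/
theorem natEntropy_comp_le {S : Ω → α} (hS : IsDiscreteRV S) (f : α → β) :
    natEntropy (fun ω => f (S ω)) μ ≤ natEntropy S μ := by
  classical
  calc natEntropy (fun ω => f (S ω)) μ
      ≤ ∑' b, ∑' s, if f s = b then enegMulLog (μ (S ⁻¹' {s})) else 0 := by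
        refine ENNReal.tsum_le_tsum fun b => ?_
        have h1 : μ ((fun ω => f (S ω)) ⁻¹' {b}) = ∑' s, if f s = b then μ (S ⁻¹' {s}) else 0 :=
          hS.measure_preimage μ (f ⁻¹' {b})
        have h2 : (∑' s, if f s = b then μ (S ⁻¹' {s}) else 0) ≤ 1 := h1 ▸ prob_le_one
        rw [h1]
        refine (enegMulLog_tsum_le _ h2).trans (ENNReal.tsum_le_tsum fun s => ?_)
        split_ifs
        · exact le_rfl
        · simp [enegMulLog]
    _ = ∑' s, ∑' b, if f s = b then enegMulLog (μ (S ⁻¹' {s})) else 0 := ENNReal.tsum_comm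
    _ = natEntropy S μ := by
        refine tsum_congr fun s => ?_
        rw [tsum_eq_single (f s)]
        · simp
        · intro b hb
          simp [hb.symm]

/-- The chain rule for a single atom: mass `w` split in the proportion `θ : 1 - θ`. -/
theorem enegMulLog_split {w : ℝ≥0∞} (hw : w ≤ 1) {θ : ℝ} (h0 : 0 ≤ θ) (h1 : θ ≤ 1) :
    enegMulLog (ENNReal.ofReal θ * w) + enegMulLog (ENNReal.ofReal (1 - θ) * w)
      = enegMulLog w + ENNReal.ofReal (Real.binEntropy θ) * w := by
  have e1 : ENNReal.ofReal θ ≤ 1 := by simpa using h1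
  have e2 : ENNReal.ofReal (1 - θ) ≤ 1 := by simpa using h0
  have h1' : 0 ≤ 1 - θ := by linarith
  have e3 : ENNReal.ofReal θ + ENNReal.ofReal (1 - θ) = 1 := by
    rw [← ENNReal.ofReal_add h0 h1']; simp
  have e4 : enegMulLog (ENNReal.ofReal θ) + enegMulLog (ENNReal.ofReal (1 - θ))
      = ENNReal.ofReal (Real.binEntropy θ) := by
    rw [enegMulLog, enegMulLog, ENNReal.toReal_ofReal h0, ENNReal.toReal_ofReal h1',
      ← ENNReal.ofReal_add (Real.negMulLog_nonneg h0 h1)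
        (Real.negMulLog_nonneg h1' (by linarith)),
      Real.binEntropy_eq_negMulLog_add_negMulLog_one_sub]
  rw [enegMulLog_mul e1 hw, enegMulLog_mul e2 hw, ← e4]
  calc _ = (ENNReal.ofReal θ + ENNReal.ofReal (1 - θ)) * enegMulLog w
        + (enegMulLog (ENNReal.ofReal θ) + enegMulLog (ENNReal.ofReal (1 - θ))) * w := by ring
    _ = _ := by rw [e3, one_mul]

/-- Conditioning: an event `E` that has conditional probability `θ` given each value in `G` of `S`
adds at least `P(S ∈ G) h(θ)` to the entropy of `S`. -/
theorem natEntropy_add_le_of_condProb {S : Ω → α} (hS : IsDiscreteRV S) {E : Set Ω}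
    (hE : MeasurableSet E) (G : Set α) {θ : ℝ} (h0 : 0 ≤ θ) (h1 : θ ≤ 1)
    (hG : ∀ s ∈ G, μ (E ∩ S ⁻¹' {s}) = ENNReal.ofReal θ * μ (S ⁻¹' {s})) :
    natEntropy S μ + ENNReal.ofReal (Real.binEntropy θ) * μ (S ⁻¹' G)
      ≤ natEntropy (fun ω => (S ω, ω ∈ E)) μ := by
  classical
  have hsplit : ∀ s, μ (S ⁻¹' {s}) = μ (E ∩ S ⁻¹' {s}) + μ (Eᶜ ∩ S ⁻¹' {s}) := by
    intro s
    rw [← measure_inter_add_sdiff (S ⁻¹' {s}) hE, Set.inter_comm, Set.sdiff_eq,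
      Set.inter_comm _ Eᶜ]
  have hpre : ∀ s (P : Prop), (fun ω => (S ω, ω ∈ E)) ⁻¹' {(s, P)}
      = if P then E ∩ S ⁻¹' {s} else Eᶜ ∩ S ⁻¹' {s} := by
    intro s P
    ext ω
    by_cases hP : P <;> simp [hP, and_comm]
  have hR : natEntropy (fun ω => (S ω, ω ∈ E)) μ
      = ∑' s, (enegMulLog (μ (E ∩ S ⁻¹' {s})) + enegMulLog (μ (Eᶜ ∩ S ⁻¹' {s}))) := by
    rw [natEntropy, ENNReal.tsum_prod
      (f := fun s P => enegMulLog (μ ((fun ω => (S ω, ω ∈ E)) ⁻¹' {(s, P)})))]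
    refine tsum_congr fun s => ?_
    rw [tsum_fintype]
    simp_rw [hpre]
    simp
  rw [hR, hS.measure_preimage μ G, natEntropy, ← ENNReal.tsum_mul_left, ← ENNReal.tsum_add]
  refine ENNReal.tsum_le_tsum fun s => ?_
  have hle : μ (S ⁻¹' {s}) ≤ 1 := prob_le_one
  by_cases hs : s ∈ G
  · have hc : μ (Eᶜ ∩ S ⁻¹' {s}) = ENNReal.ofReal (1 - θ) * μ (S ⁻¹' {s}) := by
      have hfin : μ (E ∩ S ⁻¹' {s}) ≠ ∞ := measure_ne_top _ _
      have hone : ENNReal.ofReal θ + ENNReal.ofReal (1 - θ) = 1 := by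
        rw [← ENNReal.ofReal_add h0 (by linarith)]; simp
      refine (ENNReal.add_right_inj hfin).1 ?_
      rw [← hsplit, hG s hs, ← add_mul, hone, one_mul]
    rw [if_pos hs, hG s hs, hc, enegMulLog_split hle h0 h1]
  -- Off `G` nothing is known about the split, but splitting an atom never decreases the entropy.
  · rw [if_neg hs, mul_zero, add_zero, hsplit]
    exact enegMulLog_add_le (by rw [← hsplit]; exact hle)

end Discrete

/-! ### The entropy of a Poisson hit indicator -/

/-- The constant `H₀`, in nats. -/
noncomputable def natH0 : ℝ := 1 + ∑' k : ℕ, 1 / ((k : ℝ) + 1) * Real.log (1 + 1 / ((k : ℝ) + 1))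

theorem fishmongerH0_eq : fishmongerH0 = (Real.log 2)⁻¹ * natH0 := by
  rw [fishmongerH0, natH0, mul_add, mul_one, ← tsum_mul_left]
  congr 1
  refine tsum_congr fun k => ?_
  rw [Real.logb]
  ring

theorem natH0_term_nonneg (k : ℕ) :
    0 ≤ 1 / ((k : ℝ) + 1) * Real.log (1 + 1 / ((k : ℝ) + 1)) := by
  have h : (0 : ℝ) ≤ 1 / ((k : ℝ) + 1) := by positivity
  exact mul_nonneg h (Real.log_nonneg (by linarith))

theorem summable_natH0_term :
    Summable fun k : ℕ => 1 / ((k : ℝ) + 1) * Real.log (1 + 1 / ((k : ℝ) + 1)) := by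
  have hs : Summable fun k : ℕ => 1 / ((k : ℝ) + 1) ^ 2 := by
    have := (summable_nat_add_iff (f := fun k : ℕ => 1 / (k : ℝ) ^ 2) 1).2
      (Real.summable_one_div_nat_pow.2 (by norm_num))
    simpa using this
  refine Summable.of_nonneg_of_le natH0_term_nonneg (fun k => ?_) hs
  have h : (0 : ℝ) < 1 / ((k : ℝ) + 1) := by positivity
  have h1 := Real.log_le_sub_one_of_pos (show 0 < 1 + 1 / ((k : ℝ) + 1) by linarith)
  calc 1 / ((k : ℝ) + 1) * Real.log (1 + 1 / ((k : ℝ) + 1))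
      ≤ 1 / ((k : ℝ) + 1) * (1 / ((k : ℝ) + 1)) := by
        gcongr
        linarith
    _ = 1 / ((k : ℝ) + 1) ^ 2 := by field_simp

theorem one_le_natH0 : 1 ≤ natH0 := by
  have h : 0 ≤ ∑' k : ℕ, 1 / ((k : ℝ) + 1) * Real.log (1 + 1 / ((k : ℝ) + 1)) :=
    tsum_nonneg natH0_term_nonneg
  rw [natH0]
  linarith

theorem natH0_pos : 0 < natH0 := lt_of_lt_of_le one_pos one_le_natH0

section PoissonBit

variable {t : ℝ}

theorem exp_neg_lt_one (ht : 0 < t) : Real.exp (-t) < 1 := Real.exp_lt_one_iff.2 (by linarith)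

theorem binEntropy_exp_neg (t : ℝ) : Real.binEntropy (Real.exp (-t))
    = t * Real.exp (-t) + (1 - Real.exp (-t)) * -Real.log (1 - Real.exp (-t)) := by
  rw [Real.binEntropy_eq_negMulLog_add_negMulLog_one_sub, Real.negMulLog, Real.negMulLog,
    Real.log_exp]
  ring

theorem binEntropy_exp_neg_nonneg (ht : 0 ≤ t) : 0 ≤ Real.binEntropy (Real.exp (-t)) :=
  Real.binEntropy_nonneg (Real.exp_pos _).le (Real.exp_le_one_iff.2 (by linarith))

theorem hasSum_neg_log_one_sub_exp_neg (ht : 0 < t) :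
    HasSum (fun k : ℕ => Real.exp (-t) ^ (k + 1) / ((k : ℝ) + 1))
      (-Real.log (1 - Real.exp (-t))) :=
  Real.hasSum_pow_div_log_of_abs_lt_one (by
    rw [abs_of_pos (Real.exp_pos _)]
    exact exp_neg_lt_one ht)

theorem hasSum_one_div_mul_succ :
    HasSum (fun k : ℕ => 1 / (((k : ℝ) + 1) * ((k : ℝ) + 2))) 1 := by
  rw [hasSum_iff_tendsto_nat_of_nonneg (fun k => by positivity)]
  have h : ∀ n : ℕ, ∑ k ∈ Finset.range n, 1 / (((k : ℝ) + 1) * ((k : ℝ) + 2))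
      = 1 - 1 / ((n : ℝ) + 1) := by
    intro n
    induction n with
    | zero => simp
    | succ n ih =>
      rw [Finset.sum_range_succ, ih]
      push_cast
      field_simp
      ring
  simp_rw [h]
  simpa using tendsto_const_nhds.sub (tendsto_one_div_add_atTop_nhds_zero_nat (𝕜 := ℝ))

/-- Comes from `1/((k+1)(k+2)) = 1/(k+1) - 1/(k+2)`, the logarithm series and its shift. The point
is the form of the terms: nonnegative multiples of `1 - e^{-(k+1)t}`, each of which is nonincreasing
after division by `t`. -/
theorem hasSum_entropy_ratio (ht : 0 < t) :
    HasSum (fun k : ℕ => (1 - Real.exp (-(((k : ℝ) + 1) * t))) / (((k : ℝ) + 1) * ((k : ℝ) + 2)))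
      (((1 - Real.exp (-t)) * -Real.log (1 - Real.exp (-t))) / Real.exp (-t)) := by
  have hx := Real.exp_pos (-t)
  have hpow : ∀ k : ℕ, Real.exp (-(((k : ℝ) + 1) * t)) = Real.exp (-t) ^ (k + 1) := by
    intro k
    rw [← Real.exp_nat_mul]
    push_cast
    ring_nf
  simp_rw [hpow]
  set x := Real.exp (-t) with hxdef
  set L := -Real.log (1 - x) with hL
  have h1 : HasSum (fun k : ℕ => x ^ (k + 1) / ((k : ℝ) + 1)) L := hasSum_neg_log_one_sub_exp_neg ht
  have h2 : HasSum (fun k : ℕ => x ^ (k + 1) / ((k : ℝ) + 2)) ((L - x) / x) := by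
    have h3 := (hasSum_nat_add_iff' (f := fun k : ℕ => x ^ (k + 1) / ((k : ℝ) + 1)) 1).2 h1
    have h4 := h3.div_const x
    simp only [Finset.sum_range_one, zero_add, pow_one, Nat.cast_zero, div_one] at h4
    have e : (fun k : ℕ => x ^ (k + 1) / ((k : ℝ) + 2))
        = fun k : ℕ => x ^ (k + 1 + 1) / (((k + 1 : ℕ) : ℝ) + 1) / x := by
      funext k
      have : ((k : ℝ) + 1 + 1) = k + 2 := by ring
      push_cast
      rw [this]
      field_simp
      ring
    rw [e]
    exact h4
  have h5 := (hasSum_one_div_mul_succ.sub h1).add h2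
  have e1 : (fun k : ℕ => (1 - x ^ (k + 1)) / (((k : ℝ) + 1) * ((k : ℝ) + 2)))
      = fun k : ℕ => 1 / (((k : ℝ) + 1) * ((k : ℝ) + 2)) - x ^ (k + 1) / ((k : ℝ) + 1)
        + x ^ (k + 1) / ((k : ℝ) + 2) := by
    funext k
    field_simp
    ring
  have e2 : (1 - x) * L / x = 1 - L + (L - x) / x := by
    rw [eq_comm, sub_div, div_self hx.ne']
    field_simp
    ring
  rw [e1, e2]
  exact h5

/-- Convexity of `exp` on the segment from `0` to `-at`, evaluated at `-as`. -/
theorem one_sub_exp_mul_le {s t a : ℝ} (hs : 0 < s) (hst : s ≤ t) :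
    (1 - Real.exp (-(a * t))) * s ≤ (1 - Real.exp (-(a * s))) * t := by
  have ht : 0 < t := hs.trans_le hst
  have h := convexOn_exp.2 (Set.mem_univ 0) (Set.mem_univ (-(a * t)))
    (show 0 ≤ 1 - s / t by rw [sub_nonneg, div_le_one ht]; exact hst)
    (show 0 ≤ s / t by positivity) (by ring)
  simp only [smul_eq_mul, mul_zero, zero_add, Real.exp_zero, mul_one] at h
  have e : s / t * -(a * t) = -(a * s) := by field_simp
  rw [e] at h
  have h2 := mul_le_mul_of_nonneg_right h ht.le
  have e2 : (1 - s / t + s / t * Real.exp (-(a * t))) * t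
      = t - s + s * Real.exp (-(a * t)) := by field_simp
  rw [e2] at h2
  linarith

/-- The quotient is `1` plus the series of `hasSum_entropy_ratio` divided by `t`, which decreases
term by term. It makes the entropy density and the first-hit density of a cell cross at most once.
-/
theorem antitoneOn_entropy_ratio : AntitoneOn
    (fun t => Real.binEntropy (Real.exp (-t)) / (t * Real.exp (-t))) (Set.Ioi 0) := by
  have key : ∀ t : ℝ, 0 < t → Real.binEntropy (Real.exp (-t)) / (t * Real.exp (-t))
      = 1 + (((1 - Real.exp (-t)) * -Real.log (1 - Real.exp (-t))) / Real.exp (-t)) / t := by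
    intro t ht
    have hx := Real.exp_pos (-t)
    rw [binEntropy_exp_neg]
    field_simp
  intro s hs t ht hst
  simp only [Set.mem_Ioi] at hs ht
  simp only [key s hs, key t ht]
  gcongr 1 + ?_
  rw [div_le_div_iff₀ ht hs]
  refine hasSum_le (fun k => ?_) ((hasSum_entropy_ratio ht).mul_right s)
    ((hasSum_entropy_ratio hs).mul_right t)
  rw [div_mul_eq_mul_div, div_mul_eq_mul_div]
  exact div_le_div_of_nonneg_right (one_sub_exp_mul_le hs hst) (by positivity)

theorem lintegral_exp_neg_mul {s : ℝ} (hs : 0 < s) :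
    ∫⁻ t in Set.Ioi (0 : ℝ), ENNReal.ofReal (Real.exp (-(s * t))) = ENNReal.ofReal (1 / s) := by
  have h1 := integrableOn_exp_mul_Ioi (a := -s) (by linarith) 0
  have h2 := integral_exp_mul_Ioi (a := -s) (by linarith) 0
  simp only [neg_mul, mul_zero, Real.exp_zero] at h1 h2
  rw [← ofReal_integral_eq_lintegral_ofReal h1 (ae_of_all _ fun _ => (Real.exp_pos _).le), h2]
  congr 1
  field_simp

/-- A Frullani integral: the integrand is `∫ e^{-st} ds` over `(a, b]`, and Tonelli swaps the
integrals. -/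
theorem lintegral_exp_sub_exp_div {a b : ℝ} (ha : 0 < a) (hab : a ≤ b) :
    ∫⁻ t in Set.Ioi (0 : ℝ), ENNReal.ofReal ((Real.exp (-(a * t)) - Real.exp (-(b * t))) / t)
      = ENNReal.ofReal (Real.log (b / a)) := by
  have hb : 0 < b := ha.trans_le hab
  have h1 : ∀ t ∈ Set.Ioi (0 : ℝ),
      ENNReal.ofReal ((Real.exp (-(a * t)) - Real.exp (-(b * t))) / t)
        = ∫⁻ s in Set.Ioc a b, ENNReal.ofReal (Real.exp (-(s * t))) := by
    intro t ht
    have ht' : t ≠ 0 := ne_of_gt ht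
    have hd : ∀ s ∈ Set.uIcc a b,
        HasDerivAt (fun s => -(Real.exp (-(s * t)) / t)) (Real.exp (-(s * t))) s := by
      intro s _
      have h := (((hasDerivAt_id s).mul_const t).neg.exp.div_const t).neg
      have e : -(Real.exp (-(s * t)) * -(1 * t) / t) = Real.exp (-(s * t)) := by
        field_simp
      exact e ▸ h
    have hc : Continuous fun s => Real.exp (-(s * t)) := by fun_prop
    have hI := intervalIntegral.integral_eq_sub_of_hasDerivAt hd (hc.intervalIntegrable a b)
    rw [← ofReal_integral_eq_lintegral_ofReal (hc.integrableOn_Ioc)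
      (ae_of_all _ fun _ => (Real.exp_pos _).le), ← intervalIntegral.integral_of_le hab, hI]
    congr 1
    ring
  rw [setLIntegral_congr_fun measurableSet_Ioi h1, lintegral_lintegral_swap]
  · have h2 : ∀ s ∈ Set.Ioc a b, ∫⁻ t in Set.Ioi (0 : ℝ), ENNReal.ofReal (Real.exp (-(s * t)))
        = ENNReal.ofReal s⁻¹ := by
      intro s hs
      rw [lintegral_exp_neg_mul (ha.trans hs.1), one_div]
    rw [setLIntegral_congr_fun measurableSet_Ioc h2]
    have hcont : ContinuousOn (fun s : ℝ => s⁻¹) (Set.Icc a b) :=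
      continuousOn_inv₀.mono fun s hs => ne_of_gt (ha.trans_le hs.1)
    rw [← ofReal_integral_eq_lintegral_ofReal
      (hcont.integrableOn_Icc.mono_set Set.Ioc_subset_Icc_self), ← intervalIntegral.integral_of_le
        hab, integral_inv_of_pos ha hb]
    filter_upwards [ae_restrict_mem measurableSet_Ioc] with s hs
    exact inv_nonneg.2 (ha.trans hs.1).le
  · exact Measurable.aemeasurable (by fun_prop)

/-- With `x = e^{-pt}`, expanding `-log(1 - x)` and using `(1 - x) x^{k+1} = x^{k+1} - x^{k+2}`
leaves Frullani integrals with ratios `(k+2)/(k+1)`; the remaining term `p e^{-pt}` contributes the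
leading `1` of `natH0`. The value is free of `p` because `dt/t` is scale-invariant. -/
theorem lintegral_binEntropy_div {p : ℝ} (hp : 0 < p) :
    ∫⁻ t in Set.Ioi (0 : ℝ), ENNReal.ofReal (Real.binEntropy (Real.exp (-(p * t))) / t)
      = ENNReal.ofReal natH0 := by
  have h1 : ∀ t ∈ Set.Ioi (0 : ℝ), ENNReal.ofReal (Real.binEntropy (Real.exp (-(p * t))) / t)
      = ENNReal.ofReal p * ENNReal.ofReal (Real.exp (-(p * t)))
        + ∑' k : ℕ, ENNReal.ofReal (1 / ((k : ℝ) + 1)) * ENNReal.ofReal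
          ((Real.exp (-((((k : ℝ) + 1) * p) * t)) - Real.exp (-((((k : ℝ) + 2) * p) * t))) / t) := by
    intro t ht
    have ht : 0 < t := ht
    have hpt : 0 < p * t := mul_pos hp ht
    have hx := Real.exp_pos (-(p * t))
    have hx1 := exp_neg_lt_one hpt
    have hs := ((hasSum_neg_log_one_sub_exp_neg hpt).mul_left (1 - Real.exp (-(p * t)))).div_const t
    have hterm : ∀ k : ℕ, 0 ≤ (1 - Real.exp (-(p * t)))
        * (Real.exp (-(p * t)) ^ (k + 1) / ((k : ℝ) + 1)) / t := by
      intro k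
      have : 0 ≤ 1 - Real.exp (-(p * t)) := by linarith
      positivity
    rw [binEntropy_exp_neg, add_div, ENNReal.ofReal_add (by positivity)
      (hs.nonneg hterm), ← hs.tsum_eq, ENNReal.ofReal_tsum_of_nonneg hterm hs.summable,
      ← ENNReal.ofReal_mul hp.le]
    congr 1
    · congr 1
      field_simp
    · refine tsum_congr fun k => ?_
      rw [← ENNReal.ofReal_mul (by positivity)]
      congr 1
      have e1 : Real.exp (-((((k : ℝ) + 1) * p) * t)) = Real.exp (-(p * t)) ^ (k + 1) := by
        rw [← Real.exp_nat_mul]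
        push_cast
        ring_nf
      have e2 : Real.exp (-((((k : ℝ) + 2) * p) * t)) = Real.exp (-(p * t)) ^ (k + 2) := by
        rw [← Real.exp_nat_mul]
        push_cast
        ring_nf
      rw [e1, e2]
      field_simp
      ring
  rw [setLIntegral_congr_fun measurableSet_Ioi h1, lintegral_add_left (by fun_prop),
    lintegral_const_mul _ (by fun_prop), lintegral_exp_neg_mul hp, lintegral_tsum (by fun_prop)]
  have h2 : ∀ k : ℕ, ∫⁻ t in Set.Ioi (0 : ℝ), ENNReal.ofReal (1 / ((k : ℝ) + 1)) * ENNReal.ofReal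
          ((Real.exp (-((((k : ℝ) + 1) * p) * t)) - Real.exp (-((((k : ℝ) + 2) * p) * t))) / t)
      = ENNReal.ofReal (1 / ((k : ℝ) + 1) * Real.log (1 + 1 / ((k : ℝ) + 1))) := by
    intro k
    rw [lintegral_const_mul _ (by fun_prop), lintegral_exp_sub_exp_div (by positivity)
      (by nlinarith), ← ENNReal.ofReal_mul (by positivity)]
    congr 3
    field_simp
    ring
  simp_rw [h2]
  rw [← ENNReal.ofReal_mul hp.le, mul_one_div_cancel hp.ne', natH0,
    ENNReal.ofReal_add zero_le_one (tsum_nonneg natH0_term_nonneg),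
    ENNReal.ofReal_tsum_of_nonneg natH0_term_nonneg summable_natH0_term]

theorem one_sub_exp_neg_ge_half (h0 : 0 ≤ t) (h1 : t ≤ 1) : t / 2 ≤ 1 - Real.exp (-t) := by
  have h2 := Real.add_one_le_exp t
  have h3 : Real.exp (-t) * Real.exp t = 1 := by rw [← Real.exp_add]; simp
  have h4 := Real.exp_pos (-t)
  nlinarith

/-- The entropy accumulated before time `a`, on a logarithmic time scale, is controlled by the
entropy at time `a`, or by the expected number of hits. -/
theorem lintegral_binEntropy_div_Ioc_le {p a : ℝ} (hp : 0 < p) (ha : 0 < a) :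
    ∫⁻ t in Set.Ioc 0 a, ENNReal.ofReal (Real.binEntropy (Real.exp (-(p * t))) / t)
      ≤ 9 * ENNReal.ofReal (Real.binEntropy (Real.exp (-(p * a))))
        + ENNReal.ofReal (natH0 * (p * a)) := by
  have hpa : 0 < p * a := mul_pos hp ha
  rcases le_total 1 (p * a) with h1 | h1
  -- A cell expected to be hit at least once by time `a`: even the whole integral, `natH0`, is below
  -- the second term.
  · calc _ ≤ ∫⁻ t in Set.Ioi (0 : ℝ), ENNReal.ofReal (Real.binEntropy (Real.exp (-(p * t))) / t) :=
          lintegral_mono_set Set.Ioc_subset_Ioi_self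
      _ = ENNReal.ofReal natH0 := lintegral_binEntropy_div hp
      _ ≤ ENNReal.ofReal (natH0 * (p * a)) :=
          ENNReal.ofReal_le_ofReal (le_mul_of_one_le_right natH0_pos.le h1)
      _ ≤ _ := le_add_self
  · refine le_trans ?_ le_self_add
    have hlog2 : Real.log 2 < 1 := Real.log_two_lt_d9.trans (by norm_num)
    -- For `pt ≤ 1` both `1 - e^{-pt}` and `pt` agree up to a factor `2`, so the entropy is at most
    -- `pt (2 - log(pt))`, which integrates explicitly against `dt/t`.
    have hbound : ∀ t ∈ Set.Ioc 0 a,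
        ENNReal.ofReal (Real.binEntropy (Real.exp (-(p * t))) / t)
          ≤ ENNReal.ofReal (p * (2 - Real.log p) - p * Real.log t) := by
      intro t ht
      have ht0 : 0 < t := ht.1
      have hpt : 0 < p * t := mul_pos hp ht0
      have hpt1 : p * t ≤ 1 := (mul_le_mul_of_nonneg_left ht.2 hp.le).trans h1
      refine ENNReal.ofReal_le_ofReal ?_
      rw [div_le_iff₀ ht0, binEntropy_exp_neg]
      have h2 := one_sub_exp_neg_ge_half hpt.le hpt1
      have h3 : 1 - Real.exp (-(p * t)) ≤ p * t := by
        have := Real.add_one_le_exp (-(p * t))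
        linarith
      have h4 : -Real.log (1 - Real.exp (-(p * t))) ≤ 1 - Real.log p - Real.log t := by
        have := Real.log_le_log (by positivity) h2
        rw [Real.log_div hpt.ne' two_ne_zero, Real.log_mul hp.ne' ht0.ne'] at this
        linarith
      have h5 : 0 ≤ -Real.log (1 - Real.exp (-(p * t))) := by
        have := Real.log_nonpos (x := 1 - Real.exp (-(p * t))) (by linarith)
          (by linarith)
        linarith
      have h6 : Real.exp (-(p * t)) ≤ 1 := Real.exp_le_one_iff.2 (by linarith)
      calc p * t * Real.exp (-(p * t))
            + (1 - Real.exp (-(p * t))) * -Real.log (1 - Real.exp (-(p * t)))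
          ≤ p * t * 1 + (p * t) * (1 - Real.log p - Real.log t) := by
            gcongr
        _ = _ := by ring
    have hint : IntervalIntegrable (fun t => p * (2 - Real.log p) - p * Real.log t) volume 0 a :=
      (intervalIntegrable_const).sub (intervalIntegral.intervalIntegrable_log'.const_mul p)
    have hnn : ∀ t ∈ Set.Ioc 0 a, 0 ≤ p * (2 - Real.log p) - p * Real.log t := by
      intro t ht
      have hpt : 0 < p * t := mul_pos hp ht.1
      have hpt1 : p * t ≤ 1 := (mul_le_mul_of_nonneg_left ht.2 hp.le).trans h1
      have := Real.log_nonpos hpt.le hpt1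
      rw [Real.log_mul hp.ne' ht.1.ne'] at this
      nlinarith
    refine (setLIntegral_mono' measurableSet_Ioc hbound).trans ?_
    rw [← ofReal_integral_eq_lintegral_ofReal
      ((intervalIntegrable_iff_integrableOn_Ioc_of_le ha.le).1 hint)
      ((ae_restrict_mem measurableSet_Ioc).mono hnn), ← intervalIntegral.integral_of_le ha.le,
      intervalIntegral.integral_sub intervalIntegrable_const
        (intervalIntegral.intervalIntegrable_log'.const_mul p),
      intervalIntegral.integral_const, intervalIntegral.integral_const_mul, integral_log]
    have h9 : (9 : ℝ≥0∞) = ENNReal.ofReal 9 := by norm_num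
    rw [h9, ← ENNReal.ofReal_mul (by norm_num)]
    refine ENNReal.ofReal_le_ofReal ?_
    rw [binEntropy_exp_neg]
    have hl : 0 ≤ -Real.log (p * a) := by
      have := Real.log_nonpos hpa.le h1
      linarith
    have h2 := one_sub_exp_neg_ge_half hpa.le h1
    have h3 : 1 - Real.exp (-(p * a)) ≤ p * a := by
      have := Real.add_one_le_exp (-(p * a))
      linarith
    have h4 : -Real.log (p * a) ≤ -Real.log (1 - Real.exp (-(p * a))) := by
      have := Real.log_le_log (lt_of_lt_of_le (by positivity) h2) h3
      linarith
    have h5 : 1 / 3 ≤ Real.exp (-(p * a)) := by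
      have h6 : Real.exp (-1) ≤ Real.exp (-(p * a)) := Real.exp_le_exp.2 (by linarith)
      have h7 : 1 / 3 ≤ Real.exp (-1) := by
        rw [Real.exp_neg, one_div]
        exact inv_anti₀ (Real.exp_pos _) (Real.exp_one_lt_d9.le.trans (by norm_num))
      linarith
    -- The integral computed below is `3pa + pa(-log pa)`; nine times this lower bound for the
    -- entropy at `a` covers it, and the term `3pa` against `pa/3` is what dictates the `9`.
    have h8 : p * a * (1 / 3) + p * a / 2 * -Real.log (p * a)
        ≤ p * a * Real.exp (-(p * a))
          + (1 - Real.exp (-(p * a))) * -Real.log (1 - Real.exp (-(p * a))) := by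
      have h9 : 0 ≤ 1 - Real.exp (-(p * a)) := le_trans (by positivity) h2
      gcongr
    have h10 : 0 ≤ p * a * -Real.log (p * a) := by positivity
    have h11 : Real.log (p * a) = Real.log p + Real.log a := Real.log_mul hp.ne' ha.ne'
    have h12 : (a - 0) • (p * (2 - Real.log p))
        - p * (a * Real.log a - 0 * Real.log 0 - a + 0)
        = 3 * (p * a) + p * a * -Real.log (p * a) := by
      rw [h11, smul_eq_mul]
      ring
    rw [h12]
    linarith

/-- A decreasing weight cannot push the entropy integral of a cell below `H₀` times the weighted
expected number of first hits, up to a boundary term. -/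
theorem lintegral_weighted_binEntropy {p a b : ℝ} (hp : 0 < p) (ha : 0 < a) (hab : a ≤ b)
    {g : ℝ → ℝ≥0∞} (hg : AntitoneOn g (Set.Ici a)) (hgm : Measurable g) (hg1 : ∀ t, g t ≤ 1) :
    ∫⁻ t in Set.Ioc a b, g t * ENNReal.ofReal (natH0 * (p * Real.exp (-(p * t))))
      ≤ (∫⁻ t in Set.Ioc a b, g t * ENNReal.ofReal (Real.binEntropy (Real.exp (-(p * t))) / t))
        + g a * ∫⁻ t in Set.Ioc 0 a,
            ENNReal.ofReal (Real.binEntropy (Real.exp (-(p * t))) / t) := by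
  set A : ℝ → ℝ≥0∞ := fun t => ENNReal.ofReal (Real.binEntropy (Real.exp (-(p * t))) / t) with hA
  set B : ℝ → ℝ≥0∞ := fun t => ENNReal.ofReal (natH0 * (p * Real.exp (-(p * t)))) with hB
  have hbe : Measurable Real.binEntropy := Real.binEntropy_continuous.measurable
  have hAm : Measurable A := by
    refine ENNReal.measurable_ofReal.comp ?_
    exact (hbe.comp (by fun_prop)).div measurable_id
  have hBm : Measurable B := by fun_prop
  set ψ : ℝ → ℝ := fun t => Real.binEntropy (Real.exp (-t)) / (t * Real.exp (-t)) with hψ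
  have hsign : ∀ t, 0 < t → (natH0 ≤ ψ (p * t) →
      natH0 * (p * Real.exp (-(p * t))) ≤ Real.binEntropy (Real.exp (-(p * t))) / t) ∧
      (ψ (p * t) ≤ natH0 →
      Real.binEntropy (Real.exp (-(p * t))) / t ≤ natH0 * (p * Real.exp (-(p * t)))) := by
    intro t ht
    have e : Real.binEntropy (Real.exp (-(p * t))) / t
        = ψ (p * t) * (p * Real.exp (-(p * t))) := by
      have := Real.exp_pos (-(p * t))
      simp only [hψ]
      field_simp
    rw [e]
    have : 0 < p * Real.exp (-(p * t)) := mul_pos hp (Real.exp_pos _)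
    exact ⟨fun h => by gcongr, fun h => by gcongr⟩
  have hanti : ∀ s t, 0 < s → s ≤ t → ψ (p * t) ≤ ψ (p * s) := fun s t hs hst =>
    antitoneOn_entropy_ratio (Set.mem_Ioi.2 (mul_pos hp hs))
      (Set.mem_Ioi.2 (mul_pos hp (hs.trans_le hst))) (mul_le_mul_of_nonneg_left hst hp.le)
  have hb : 0 < b := ha.trans_le hab
  by_cases hbS : natH0 ≤ ψ (p * b)
  -- The densities have not crossed by time `b`: the inequality holds pointwise and no boundary term
  -- is needed.
  · refine le_trans (setLIntegral_mono' measurableSet_Ioc fun t ht => ?_) le_self_add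
    have ht0 : 0 < t := ha.trans ht.1
    exact mul_le_mul_right (ENNReal.ofReal_le_ofReal
      ((hsign t ht0).1 (hbS.trans (hanti t b ht0 ht.2)))) _
  · set S : Set ℝ := {t | 0 < t ∧ natH0 ≤ ψ (p * t)} with hS
    have hSb : ∀ t ∈ S, t ≤ b := by
      intro t ht
      by_contra hlt
      exact hbS (ht.2.trans (hanti b t hb (not_le.1 hlt).le))
    have hSbdd : BddAbove S := ⟨b, hSb⟩
    -- The crossing time, moved up to `a` if it is earlier. When `S` is empty its supremum is `0` by
    -- convention, and `t1 = a`.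
    set t1 := max a (sSup S) with ht1
    have hat1 : a ≤ t1 := le_max_left _ _
    have ht1b : t1 ≤ b := max_le hab (Real.sSup_le hSb hb.le)
    have hlow : ∀ t, a < t → t < t1 → B t ≤ A t := by
      intro t hat htt
      have ht0 : 0 < t := ha.trans hat
      have htS : t < sSup S := by
        rcases lt_max_iff.1 htt with h | h
        · exact absurd h (not_lt.2 hat.le)
        · exact h
      have hne : S.Nonempty := by
        by_contra hemp
        rw [Set.not_nonempty_iff_eq_empty.1 hemp, Real.sSup_empty] at htS
        exact absurd htS (not_lt.2 ht0.le)
      obtain ⟨s, hs, hts⟩ := exists_lt_of_lt_csSup hne htS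
      exact ENNReal.ofReal_le_ofReal ((hsign t ht0).1 (hs.2.trans (hanti t s ht0 hts.le)))
    have hhigh : ∀ t, t1 < t → A t ≤ B t := by
      intro t htt
      have ht0 : 0 < t := ha.trans_le (hat1.trans htt.le)
      have htS : t ∉ S := fun h => absurd (le_csSup hSbdd h)
        (not_le.2 ((le_max_right _ _).trans_lt htt))
      have : ψ (p * t) ≤ natH0 := by
        by_contra hc
        exact htS ⟨ht0, (not_le.1 hc).le⟩
      exact ENNReal.ofReal_le_ofReal ((hsign t ht0).2 this)
    have hAtot : (∫⁻ t in Set.Ioi 0, A t) = ENNReal.ofReal natH0 := lintegral_binEntropy_div hp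
    have hBtot : (∫⁻ t in Set.Ioi 0, B t) = ENNReal.ofReal natH0 := by
      have : ∀ t, B t = ENNReal.ofReal (natH0 * p) * ENNReal.ofReal (Real.exp (-(p * t))) := by
        intro t
        rw [← ENNReal.ofReal_mul (mul_nonneg natH0_pos.le hp.le), mul_assoc]
      simp_rw [this]
      rw [lintegral_const_mul _ (by fun_prop), lintegral_exp_neg_mul hp,
        ← ENNReal.ofReal_mul (mul_nonneg natH0_pos.le hp.le)]
      congr 1
      field_simp
    have hfin : ∀ {f : ℝ → ℝ≥0∞} {s : Set ℝ}, (∫⁻ t in Set.Ioi 0, f t) = ENNReal.ofReal natH0 →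
        s ⊆ Set.Ioi 0 → ∫⁻ t in s, f t ≠ ∞ := by
      intro f s hf hs
      refine ne_top_of_le_ne_top ENNReal.ofReal_ne_top ((lintegral_mono_set hs).trans hf.le)
    have hsplit : ∀ f : ℝ → ℝ≥0∞, (∫⁻ t in Set.Ioi 0, f t)
        = (∫⁻ t in Set.Ioc 0 a, f t) + (∫⁻ t in Set.Ioc a b, f t) + (∫⁻ t in Set.Ioi b, f t) := by
      intro f
      rw [← Set.Ioc_union_Ioi_eq_Ioi hb.le, lintegral_union measurableSet_Ioi
        (Set.Ioc_disjoint_Ioi le_rfl), ← Set.Ioc_union_Ioc_eq_Ioc ha.le hab,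
        lintegral_union measurableSet_Ioc (Set.Ioc_disjoint_Ioc_of_le le_rfl)]
    -- Both densities have total mass `natH0`, and beyond `b ≥ t1` the density `B` dominates, so on
    -- `(0, b]` the mass of `A` is at least that of `B`.
    have hBA : (∫⁻ t in Set.Ioc a b, B t)
        ≤ (∫⁻ t in Set.Ioc a b, A t) + (∫⁻ t in Set.Ioc 0 a, A t) := by
      have hbfin : (∫⁻ t in Set.Ioi b, B t) ≠ ∞ := hfin hBtot (Set.Ioi_subset_Ioi hb.le)
      rw [← ENNReal.add_le_add_iff_right hbfin]
      calc (∫⁻ t in Set.Ioc a b, B t) + (∫⁻ t in Set.Ioi b, B t)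
          ≤ (∫⁻ t in Set.Ioc 0 a, B t) + (∫⁻ t in Set.Ioc a b, B t) + (∫⁻ t in Set.Ioi b, B t) := by
            gcongr
            exact le_add_self
        _ = (∫⁻ t in Set.Ioc 0 a, A t) + (∫⁻ t in Set.Ioc a b, A t) + (∫⁻ t in Set.Ioi b, A t) := by
            rw [← hsplit, ← hsplit, hAtot, hBtot]
        _ ≤ (∫⁻ t in Set.Ioc a b, A t) + (∫⁻ t in Set.Ioc 0 a, A t) + (∫⁻ t in Set.Ioi b, B t) := by
            rw [add_comm (∫⁻ t in Set.Ioc 0 a, A t) (∫⁻ t in Set.Ioc a b, A t)]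
            gcongr 1
            exact setLIntegral_mono' measurableSet_Ioi fun t ht => hhigh t (ht1b.trans_lt ht)
    have hγ1 : g t1 ≠ ∞ := ne_top_of_le_ne_top ENNReal.one_ne_top (hg1 t1)
    -- This is `(g t - g t1)(A t - B t) ≥ 0` without subtraction: both factors change sign, from
    -- nonnegative to nonpositive, at `t1`.
    have hpt : ∀ t ∈ Set.Ioc a b, g t * B t + g t1 * A t ≤ g t * A t + g t1 * B t := by
      intro t ht
      rcases lt_trichotomy t t1 with h | h | h
      · have h1 := hlow t ht.1 h
        have h2 : g t1 ≤ g t := hg (Set.mem_Ici.2 ht.1.le) (Set.mem_Ici.2 hat1) h.le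
        obtain ⟨d, hd⟩ := exists_add_of_le h1
        obtain ⟨e, he⟩ := exists_add_of_le h2
        rw [hd, he]
        calc _ ≤ (g t1 + e) * B t + g t1 * (B t + d) + e * d := le_self_add
          _ = _ := by ring
      · rw [h, add_comm]
      · have h1 := hhigh t h
        have h2 : g t ≤ g t1 := hg (Set.mem_Ici.2 hat1) (Set.mem_Ici.2 ht.1.le) h.le
        obtain ⟨d, hd⟩ := exists_add_of_le h1
        obtain ⟨e, he⟩ := exists_add_of_le h2
        rw [hd, he]
        calc _ ≤ g t * (A t + d) + (g t + e) * A t + e * d := le_self_add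
          _ = _ := by ring
    have hI := setLIntegral_mono' (μ := volume) measurableSet_Ioc hpt
    rw [lintegral_add_left (f := fun t => g t * B t) (hgm.mul hBm),
      lintegral_add_left (f := fun t => g t * A t) (hgm.mul hAm),
      lintegral_const_mul _ hAm, lintegral_const_mul _ hBm] at hI
    have hAfin : g t1 * (∫⁻ t in Set.Ioc a b, A t) ≠ ∞ := ENNReal.mul_ne_top hγ1
      (hfin hAtot (fun t ht => ha.trans ht.1))
    rw [← ENNReal.add_le_add_iff_right hAfin]
    calc _ ≤ (∫⁻ t in Set.Ioc a b, g t * A t) + g t1 * (∫⁻ t in Set.Ioc a b, B t) := hI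
      _ ≤ (∫⁻ t in Set.Ioc a b, g t * A t)
          + g t1 * ((∫⁻ t in Set.Ioc a b, A t) + ∫⁻ t in Set.Ioc 0 a, A t) := by gcongr
      _ = (∫⁻ t in Set.Ioc a b, g t * A t) + g t1 * (∫⁻ t in Set.Ioc 0 a, A t)
          + g t1 * (∫⁻ t in Set.Ioc a b, A t) := by ring
      _ ≤ _ := by
          gcongr 2
          exact mul_le_mul_left (hg (Set.mem_Ici.2 le_rfl) (Set.mem_Ici.2 hat1) hat1) _

end PoissonBit

/-! ### Random darts -/

/-- The list of the first `k` darts. -/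
def darts {C Ω : Type*} (D : ℕ → Ω → C) (k : ℕ) (ω : Ω) : List C := (List.range k).map fun i => D i ω

/-- One step of the Markov chain of dart lists, acting on functions. -/
noncomputable def dartStep {C : Type*} (p : PMF C) (f : List C → ℝ≥0∞) (l : List C) : ℝ≥0∞ :=
  ∑' c, p c * f (l ++ [c])

section DartLists

variable {C Ω : Type*}

theorem darts_zero (D : ℕ → Ω → C) (ω : Ω) : darts D 0 ω = [] := rfl

theorem darts_succ (D : ℕ → Ω → C) (k : ℕ) (ω : Ω) :
    darts D (k + 1) ω = darts D k ω ++ [D k ω] := by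
  simp [darts, List.range_succ]

theorem length_darts (D : ℕ → Ω → C) (k : ℕ) (ω : Ω) : (darts D k ω).length = k := by
  simp [darts]

theorem DartboardSketch.state_eq (X : DartboardSketch C) (D : ℕ → Ω → C) (k : ℕ) (ω : Ω) :
    X.state D k ω = X.run (darts D k ω) := rfl

theorem sum_area_toReal (p : PMF C) : HasSum (fun c => (p c).toReal) 1 := by
  have h := p.tsum_coe
  have hs : Summable fun c => (p c).toReal := ENNReal.summable_toReal (by rw [h]; simp)
  have := ENNReal.tsum_toReal_eq (f := fun c => p c) (fun c => p.apply_ne_top c)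
  rw [h] at this
  rw [ENNReal.toReal_one] at this
  rw [this]
  exact hs.hasSum

theorem summable_area_mul (p : PMF C) {h : C → ℝ} {B : ℝ} (hB : ∀ c, |h c| ≤ B) :
    Summable fun c => (p c).toReal * h c := by
  refine Summable.of_norm_bounded ((sum_area_toReal p).summable.mul_right B) fun c => ?_
  rw [norm_mul, Real.norm_eq_abs, Real.norm_eq_abs, abs_of_nonneg ENNReal.toReal_nonneg]
  exact mul_le_mul_of_nonneg_left (hB c) ENNReal.toReal_nonneg

theorem abs_tsum_area_mul_le (p : PMF C) {h : C → ℝ} {B : ℝ} (hB : ∀ c, |h c| ≤ B) :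
    |∑' c, (p c).toReal * h c| ≤ B := by
  have h1 := (sum_area_toReal p).mul_right B
  rw [one_mul] at h1
  have := tsum_of_norm_bounded (f := fun c => (p c).toReal * h c) h1 fun c => by
    rw [norm_mul, Real.norm_eq_abs, Real.norm_eq_abs, abs_of_nonneg ENNReal.toReal_nonneg]
    exact mul_le_mul_of_nonneg_left (hB c) ENNReal.toReal_nonneg
  simpa using this

/-- A function of the darts that depends only on which cells other than `c` have been hit. -/
def IgnoresCell (c : C) (f : List C → ℝ≥0∞) : Prop :=
  ∀ l l', (∀ d, d ≠ c → (d ∈ l ↔ d ∈ l')) → f l = f l'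

open Classical in
/-- The part of `dartStep` in which the dart misses `c`, as a linear operator. -/
noncomputable def missStep (p : PMF C) (c : C) : Module.End ℝ≥0∞ (List C → ℝ≥0∞) where
  toFun f l := ∑' d, if d = c then 0 else p d * f (l ++ [d])
  map_add' f g := by
    funext l
    simp only [Pi.add_apply, mul_add]
    rw [← ENNReal.tsum_add]
    refine tsum_congr fun d => ?_
    split_ifs <;> simp
  map_smul' r f := by
    funext l
    simp only [Pi.smul_apply, smul_eq_mul, RingHom.id_apply]
    rw [← ENNReal.tsum_mul_left]
    refine tsum_congr fun d => ?_
    split_ifs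
    · simp
    · ring

/-- A dart in `c` leaves such an `f` unchanged, so one step is the scalar `p c` plus the missing
step. Scalars commute with every operator, which makes the binomial theorem available for the
iterates. -/
theorem dartStep_eq_of_ignoresCell (p : PMF C) {c : C} {f : List C → ℝ≥0∞}
    (hf : IgnoresCell c f) :
    dartStep p f = (algebraMap ℝ≥0∞ (Module.End ℝ≥0∞ (List C → ℝ≥0∞)) (p c) + missStep p c) f := by
  classical
  funext l
  have h1 : f (l ++ [c]) = f l := hf _ _ fun d hd => by simp [hd]
  have h2 : ∀ d, p d * f (l ++ [d])
      = (if d = c then p c * f l else 0) + if d = c then 0 else p d * f (l ++ [d]) := by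
    intro d
    split_ifs with h
    · rw [h, h1, add_zero]
    · rw [zero_add]
  simp only [dartStep, LinearMap.add_apply, Pi.add_apply, Module.algebraMap_end_apply,
    Pi.smul_apply, smul_eq_mul]
  rw [tsum_congr h2, ENNReal.tsum_add, tsum_ite_eq]
  rfl

theorem IgnoresCell.dartStep (p : PMF C) {c : C} {f : List C → ℝ≥0∞} (hf : IgnoresCell c f) :
    IgnoresCell c (dartStep p f) := by
  intro l l' h
  refine tsum_congr fun d => ?_
  rw [hf (l ++ [d]) (l' ++ [d]) fun e he => by simp [h e he]]

theorem dartStep_iterate_of_ignoresCell (p : PMF C) {c : C} {f : List C → ℝ≥0∞}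
    (hf : IgnoresCell c f) (n : ℕ) :
    (dartStep p)^[n] f
      = ((algebraMap ℝ≥0∞ (Module.End ℝ≥0∞ (List C → ℝ≥0∞)) (p c) + missStep p c) ^ n) f := by
  induction n generalizing f with
  | zero => simp
  | succ n ih =>
    rw [Function.iterate_succ_apply, ih (hf.dartStep p), dartStep_eq_of_ignoresCell p hf, pow_succ]
    rfl

open Classical in
-- On the event that `c` is never hit only the missing part of each step survives.
theorem dartStep_iterate_notMem (p : PMF C) (c : C) (f : List C → ℝ≥0∞) (n : ℕ) :
    (dartStep p)^[n] (fun l => if c ∈ l then 0 else f l)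
      = fun l => if c ∈ l then 0 else ((missStep p c) ^ n) f l := by
  induction n generalizing f with
  | zero => simp
  | succ n ih =>
    have h1 : dartStep p (fun l => if c ∈ l then 0 else f l)
        = fun l => if c ∈ l then 0 else missStep p c f l := by
      funext l
      by_cases hc : c ∈ l
      · simp [dartStep, hc]
      · simp only [dartStep, hc, if_false]
        refine tsum_congr fun d => ?_
        by_cases hd : d = c
        · simp [hd]
        · have : ¬ c = d := fun h => hd h.symm
          simp [hc, hd, this]
    rw [Function.iterate_succ_apply, h1, ih, pow_succ]
    rfl

end DartLists

section Darts

variable {C Ω : Type*} [MeasurableSpace C] [MeasurableSingletonClass C] [Countable C]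
  [MeasurableSpace Ω] {μ : Measure Ω} {X : DartboardSketch C} {D : ℕ → Ω → C}

theorem isDiscreteRV_of_measurable {f : Ω → C} (hf : Measurable f) : IsDiscreteRV f where
  countable := Set.to_countable _
  measurable s := hf (measurableSet_singleton s)

theorem isDiscreteRV_darts (hD : ∀ k, Measurable (D k)) (n : ℕ) : IsDiscreteRV (darts D n) := by
  induction n with
  | zero =>
    refine ⟨Set.to_countable _, fun s => ?_⟩
    have : darts D 0 = fun _ => [] := rfl
    rw [this]
    exact measurable_const (MeasurableSpace.measurableSet_top (s := ({s} : Set (List C))))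
  | succ n ih =>
    have := (ih.prodMk (isDiscreteRV_of_measurable (hD n))).comp fun q => q.1 ++ [q.2]
    simpa only [← darts_succ] using this

theorem DartboardSketch.IsDartSequence.measure_darts_inter (hD : X.IsDartSequence μ D) (n : ℕ)
    (l : List C) (c : C) :
    μ ((fun ω => (darts D n ω, D n ω)) ⁻¹' {(l, c)}) = μ (darts D n ⁻¹' {l}) * X.area c := by
  have hind := hD.indep.indepFun_finset (Finset.range n) {n} (by simp) hD.measurable
  have h1 : darts D n ⁻¹' {l} = (fun ω (i : Finset.range n) => D i ω) ⁻¹'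
      {x | l.length = n ∧ ∀ i : Finset.range n, l[i.1]? = some (x i)} := by
    ext ω
    simp only [Set.mem_preimage, Set.mem_singleton_iff, Set.mem_ofPred_eq]
    constructor
    · rintro rfl
      refine ⟨length_darts D n ω, fun i => ?_⟩
      have := Finset.mem_range.1 i.2
      simp [darts, this]
    · rintro ⟨hl, h⟩
      refine List.ext_getElem? fun i => ?_
      by_cases hi : i < n
      · rw [h ⟨i, Finset.mem_range.2 hi⟩]
        simp [darts, hi]
      · rw [List.getElem?_eq_none (by rw [length_darts]; omega),
          List.getElem?_eq_none (by omega)]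
  have h2 : D n ⁻¹' {c} = (fun ω (i : ({n} : Finset ℕ)) => D i ω) ⁻¹'
      {x | x ⟨n, by simp⟩ = c} := by
    ext ω
    simp
  have h3 : (fun ω => (darts D n ω, D n ω)) ⁻¹' {(l, c)} = darts D n ⁻¹' {l} ∩ D n ⁻¹' {c} := by
    ext ω
    simp
  have h4 : μ (D n ⁻¹' {c}) = X.area c := by
    rw [← Measure.map_apply (hD.measurable n) (measurableSet_singleton c), hD.law n,
      PMF.toMeasure_apply_singleton _ _ (measurableSet_singleton c)]
  rw [h3, ← h4]
  conv_lhs => rw [h1, h2]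
  conv_rhs => rw [h1, h2]
  exact hind.measure_inter_preimage_eq_mul _ _ (Set.to_countable _).measurableSet
    (Set.to_countable _).measurableSet

theorem DartboardSketch.IsDartSequence.lintegral_next (hD : X.IsDartSequence μ D) (n : ℕ)
    (F : List C → C → ℝ≥0∞) :
    ∫⁻ ω, F (darts D n ω) (D n ω) ∂μ = ∫⁻ ω, ∑' c, X.area c * F (darts D n ω) c ∂μ := by
  have hd := isDiscreteRV_darts hD.measurable n
  have h := (hd.prodMk (isDiscreteRV_of_measurable (hD.measurable n))).lintegral μ
    (fun q => F q.1 q.2)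
  have h' := hd.lintegral μ (fun l => ∑' c, X.area c * F l c)
  simp only at h
  rw [h, h', ENNReal.tsum_prod
    (f := fun l c => F l c * μ ((fun ω => (darts D n ω, D n ω)) ⁻¹' {(l, c)}))]
  refine tsum_congr fun l => ?_
  rw [← ENNReal.tsum_mul_right]
  refine tsum_congr fun c => ?_
  rw [hD.measure_darts_inter]
  ring

theorem DartboardSketch.IsDartSequence.lintegral_darts_succ (hD : X.IsDartSequence μ D) (n : ℕ)
    (f : List C → ℝ≥0∞) :
    ∫⁻ ω, f (darts D (n + 1) ω) ∂μ = ∫⁻ ω, dartStep X.area f (darts D n ω) ∂μ := by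
  simp_rw [darts_succ]
  exact hD.lintegral_next n fun l c => f (l ++ [c])

theorem DartboardSketch.IsDartSequence.lintegral_darts [IsProbabilityMeasure μ]
    (hD : X.IsDartSequence μ D) (n : ℕ) (f : List C → ℝ≥0∞) :
    ∫⁻ ω, f (darts D n ω) ∂μ = (dartStep X.area)^[n] f [] := by
  induction n generalizing f with
  | zero => simp [darts_zero]
  | succ n ih => rw [hD.lintegral_darts_succ, ih, Function.iterate_succ_apply]

theorem DartboardSketch.IsDartSequence.integral_next [IsProbabilityMeasure μ]
    (hD : X.IsDartSequence μ D) (n : ℕ) (F : List C → C → ℝ) {B : ℝ} (hB : ∀ l c, |F l c| ≤ B) :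
    ∫ ω, F (darts D n ω) (D n ω) ∂μ
      = ∫ ω, ∑' c, (X.area c).toReal * F (darts D n ω) c ∂μ := by
  have hd := isDiscreteRV_darts hD.measurable n
  have hp := hd.prodMk (isDiscreteRV_of_measurable (hD.measurable n))
  have hm1 : Measurable fun ω => F (darts D n ω) (D n ω) := hp.measurable_comp fun q => F q.1 q.2
  have hm2 : Measurable fun ω => ∑' c, (X.area c).toReal * F (darts D n ω) c :=
    hd.measurable_comp fun l => ∑' c, (X.area c).toReal * F l c
  have hi1 : Integrable (fun ω => F (darts D n ω) (D n ω)) μ :=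
    Integrable.of_bound hm1.aestronglyMeasurable B (ae_of_all _ fun ω => hB _ _)
  have hi2 : Integrable (fun ω => ∑' c, (X.area c).toReal * F (darts D n ω) c) μ :=
    Integrable.of_bound hm2.aestronglyMeasurable B
      (ae_of_all _ fun ω => abs_tsum_area_mul_le _ (hB _))
  have hnn : ∀ l c, 0 ≤ F l c + B := fun l c => by
    have := neg_abs_le (F l c)
    linarith [hB l c]
  -- Adding `B` makes the integrand nonnegative; as the areas sum to one, the same constant appears
  -- on both sides and cancels.
  have key := hD.lintegral_next n fun l c => ENNReal.ofReal (F l c + B)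
  have hsum : ∀ l, ∑' c, X.area c * ENNReal.ofReal (F l c + B)
      = ENNReal.ofReal ((∑' c, (X.area c).toReal * F l c) + B) := by
    intro l
    have h1 : HasSum (fun c => (X.area c).toReal * (F l c + B))
        ((∑' c, (X.area c).toReal * F l c) + B) := by
      have := (summable_area_mul X.area (hB l)).hasSum.add ((sum_area_toReal X.area).mul_right B)
      simpa only [one_mul, ← mul_add] using this
    rw [← h1.tsum_eq, ENNReal.ofReal_tsum_of_nonneg
      (fun c => mul_nonneg ENNReal.toReal_nonneg (hnn l c)) h1.summable]
    refine tsum_congr fun c => ?_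
    rw [ENNReal.ofReal_mul ENNReal.toReal_nonneg, ENNReal.ofReal_toReal (X.area.apply_ne_top c)]
  simp_rw [hsum] at key
  have hnn2 : ∀ l, 0 ≤ (∑' c, (X.area c).toReal * F l c) + B := fun l => by
    have := neg_abs_le (∑' c, (X.area c).toReal * F l c)
    linarith [abs_tsum_area_mul_le X.area (hB l)]
  have e1 := ofReal_integral_eq_lintegral_ofReal (hi1.add (integrable_const B))
    (ae_of_all _ fun ω => hnn _ _)
  have e2 := ofReal_integral_eq_lintegral_ofReal (hi2.add (integrable_const B))
    (ae_of_all _ fun ω => hnn2 _)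
  simp only [Pi.add_apply] at e1 e2
  rw [← e1, ← e2, ENNReal.ofReal_eq_ofReal_iff (integral_nonneg fun ω => hnn _ _)
    (integral_nonneg fun ω => hnn2 _), integral_add hi1 (integrable_const B),
    integral_add hi2 (integrable_const B)] at key
  linarith

end Darts

/-! ### Poissonization of the number of darts -/

section PoissonExp

variable {C Ω : Type*} [MeasurableSpace Ω] {μ : Measure Ω} {D : ℕ → Ω → C}

/-- The expected value of a function of the darts, when their number has Poisson distribution. -/
noncomputable def poissonExp (μ : Measure Ω) (D : ℕ → Ω → C) (t : NNReal)
    (f : List C → ℝ≥0∞) : ℝ≥0∞ :=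
  ∑' n : ℕ, poissonMeasure t {n} * ∫⁻ ω, f (darts D n ω) ∂μ

/-- The Poisson law with mean `t + s` is the convolution of those with means `t` and `s`: more time
means additional darts. -/
theorem poissonExp_antitone {f : List C → ℝ≥0∞}
    (hf : ∀ l c, f (l ++ [c]) ≤ f l) : Antitone fun t => poissonExp μ D t f := by
  have ha : Antitone fun n => ∫⁻ ω, f (darts D n ω) ∂μ := by
    refine antitone_nat_of_succ_le fun n => lintegral_mono fun ω => ?_
    rw [darts_succ]
    exact hf _ _
  have h1 : ∀ t, poissonExp μ D t f = ∫⁻ n, (fun n => ∫⁻ ω, f (darts D n ω) ∂μ) n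
      ∂(poissonMeasure t) := by
    intro t
    rw [lintegral_countable', poissonExp]
    exact tsum_congr fun n => mul_comm _ _
  intro t t' htt
  obtain ⟨s, rfl⟩ := exists_add_of_le htt
  simp only
  rw [h1, h1, ← poissonMeasure_conv_poissonMeasure, Measure.lintegral_conv (measurable_of_countable _)]
  refine lintegral_mono fun x => ?_
  calc _ ≤ ∫⁻ _, ∫⁻ ω, f (darts D x ω) ∂μ ∂(poissonMeasure s) :=
        lintegral_mono fun y => ha (Nat.le_add_right x y)
    _ = _ := by simp

end PoissonExp

section PoissonizedDarts

variable {C Ω : Type*} [MeasurableSpace C] [MeasurableSingletonClass C] [Countable C]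
  [MeasurableSpace Ω] {μ : Measure Ω} [IsProbabilityMeasure μ] {X : DartboardSketch C}
  {D : ℕ → Ω → C}

theorem isDiscreteRV_darts_prod (hD : ∀ k, Measurable (D k)) :
    IsDiscreteRV (fun q : Ω × ℕ => (q.2, darts D q.2 q.1)) where
  countable := Set.to_countable _
  measurable := by
    rintro ⟨n, l⟩
    have : (fun q : Ω × ℕ => (q.2, darts D q.2 q.1)) ⁻¹' {(n, l)}
        = (darts D n ⁻¹' {l}) ×ˢ {n} := by
      ext ⟨ω, k⟩
      simp only [Set.mem_preimage, Set.mem_singleton_iff, Prod.mk.injEq, Set.mem_prod]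
      constructor
      · rintro ⟨rfl, h⟩
        exact ⟨h, rfl⟩
      · rintro ⟨h, rfl⟩
        exact ⟨rfl, h⟩
    rw [this]
    exact ((isDiscreteRV_darts hD n).measurable l).prod (measurableSet_singleton n)

theorem lintegral_prod_poisson (hD : ∀ k, Measurable (D k)) (t : NNReal) (f : List C → ℝ≥0∞) :
    ∫⁻ q : Ω × ℕ, f (darts D q.2 q.1) ∂(μ.prod (poissonMeasure t)) = poissonExp μ D t f := by
  have hm : Measurable fun q : Ω × ℕ => f (darts D q.2 q.1) :=
    (isDiscreteRV_darts_prod hD).measurable_comp fun r => f r.2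
  rw [lintegral_prod_symm _ hm.aemeasurable, lintegral_countable', poissonExp]
  exact tsum_congr fun n => mul_comm _ _

open Classical in
theorem measure_prod_poisson (hD : ∀ k, Measurable (D k)) (t : NNReal) (P : List C → Prop) :
    μ.prod (poissonMeasure t) {q | P (darts D q.2 q.1)}
      = poissonExp μ D t fun l => if P l then 1 else 0 := by
  have hm : MeasurableSet {q : Ω × ℕ | P (darts D q.2 q.1)} :=
    (isDiscreteRV_darts_prod hD).measurableSet_preimage {r | P r.2}
  rw [← lintegral_prod_poisson hD, ← lintegral_indicator_one hm]
  rfl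

open Classical in
/-- Poissonization makes the event that `c` is missed independent of the darts outside `c`. -/
theorem poissonExp_notMem (hD : X.IsDartSequence μ D) {c : C} {f : List C → ℝ≥0∞}
    (hf : IgnoresCell c f) (t : NNReal) :
    poissonExp μ D t (fun l => if c ∈ l then 0 else f l)
      = ENNReal.ofReal (Real.exp (-((X.area c).toReal * t))) * poissonExp μ D t f := by
  set p := X.area c with hp
  set b : ℕ → ℝ≥0∞ := fun j => ((missStep X.area c) ^ j) f [] with hb
  set w : ℕ → ℝ≥0∞ := fun j => ENNReal.ofReal ((t : ℝ) ^ j / (j.factorial : ℝ)) with hw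
  have hpt : p ≠ ∞ := X.area.apply_ne_top c
  have hpois : ∀ n, poissonMeasure t {n} = ENNReal.ofReal (Real.exp (-t)) * w n := by
    intro n
    rw [poissonMeasure_singleton, hw, ← ENNReal.ofReal_mul (Real.exp_pos _).le, mul_div_assoc]
  have h1 : poissonExp μ D t (fun l => if c ∈ l then 0 else f l)
      = ENNReal.ofReal (Real.exp (-t)) * ∑' n, w n * b n := by
    rw [poissonExp, ← ENNReal.tsum_mul_left]
    refine tsum_congr fun n => ?_
    rw [hD.lintegral_darts n fun l => if c ∈ l then 0 else f l, dartStep_iterate_notMem, hpois]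
    simp [hb, mul_assoc]
  -- The `n`-th power of scalar plus missing step is expanded binomially. Since `w n * choose n i =
  -- w i * w j` for `i + j = n`, the result is a Cauchy product, with factors `e^{pt}` and the
  -- series of `h1`.
  have h2 : poissonExp μ D t f = ENNReal.ofReal (Real.exp (-t)) *
      ∑' n, ∑ q ∈ Finset.HasAntidiagonal.antidiagonal n, (w q.1 * p ^ q.1) * (w q.2 * b q.2) := by
    rw [poissonExp, ← ENNReal.tsum_mul_left]
    refine tsum_congr fun n => ?_
    rw [hD.lintegral_darts n f, dartStep_iterate_of_ignoresCell X.area hf, hpois, mul_assoc,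
      Commute.add_pow' (Algebra.commutes _ _ : Commute (algebraMap ℝ≥0∞ (Module.End ℝ≥0∞ (List C → ℝ≥0∞)) p)
        (missStep X.area c))]
    congr 1
    rw [LinearMap.sum_apply, Finset.sum_apply, Finset.mul_sum]
    refine Finset.sum_congr rfl fun q hq => ?_
    have hqn : q.1 + q.2 = n := Finset.HasAntidiagonal.mem_antidiagonal.1 hq
    have e1 : w n * (n.choose q.1 : ℝ≥0∞) = w q.1 * w q.2 := by
      simp only [hw]
      rw [← ENNReal.ofReal_natCast, ← ENNReal.ofReal_mul (by positivity),
        ← ENNReal.ofReal_mul (by positivity)]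
      congr 1
      have h3 := Nat.choose_mul_factorial_mul_factorial (Nat.le.intro hqn)
      rw [← hqn, Nat.add_sub_cancel_left] at h3
      have h4 : (((q.1 + q.2).choose q.1 : ℝ) * q.1.factorial * q.2.factorial)
          = (q.1 + q.2).factorial := by exact_mod_cast h3
      rw [← hqn, pow_add]
      have h5 : (((q.1 + q.2).choose q.1 : ℕ) : ℝ) ≠ 0 := by
        exact_mod_cast (Nat.choose_pos (Nat.le_add_right _ _)).ne'
      rw [← h4]
      field_simp
    rw [← map_pow, LinearMap.smul_apply, Module.End.mul_apply, Module.algebraMap_end_apply]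
    simp only [Pi.smul_apply, smul_eq_mul, nsmul_eq_mul]
    calc w n * ((n.choose q.1 : ℝ≥0∞) * (p ^ q.1 * ((missStep X.area c) ^ q.2) f []))
        = (w n * (n.choose q.1 : ℝ≥0∞)) * (p ^ q.1 * b q.2) := by rw [hb]; ring
      _ = _ := by rw [e1]; ring
  have h3 : ∑' n, ∑ q ∈ Finset.HasAntidiagonal.antidiagonal n, (w q.1 * p ^ q.1) * (w q.2 * b q.2)
      = (∑' i, w i * p ^ i) * ∑' j, w j * b j := by
    calc _ = ∑' n, ∑' q : Finset.HasAntidiagonal.antidiagonal n, (w q.1.1 * p ^ q.1.1) * (w q.1.2 * b q.1.2) := by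
          refine tsum_congr fun n => ?_
          rw [tsum_fintype, ← Finset.sum_coe_sort]
      _ = ∑' q : ℕ × ℕ, (w q.1 * p ^ q.1) * (w q.2 * b q.2) := by
          rw [← ENNReal.tsum_sigma' (f := fun q : Σ n : ℕ, Finset.HasAntidiagonal.antidiagonal n =>
            (w q.2.1.1 * p ^ q.2.1.1) * (w q.2.1.2 * b q.2.1.2)),
            ← Finset.HasAntidiagonal.sigmaAntidiagonalEquivProd.tsum_eq]
          rfl
      _ = _ := by
          rw [ENNReal.tsum_prod (f := fun i j => (w i * p ^ i) * (w j * b j)),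
            ← ENNReal.tsum_mul_right]
          exact tsum_congr fun i => ENNReal.tsum_mul_left
  have h4 : ∑' i, w i * p ^ i = ENNReal.ofReal (Real.exp (p.toReal * t)) := by
    have hs : HasSum (fun i : ℕ => (p.toReal * t) ^ i / (i.factorial : ℝ))
        (Real.exp (p.toReal * t)) := by
      rw [Real.exp_eq_exp_ℝ]
      exact NormedSpace.expSeries_div_hasSum_exp _
    rw [← hs.tsum_eq, ENNReal.ofReal_tsum_of_nonneg (fun i => by positivity) hs.summable]
    refine tsum_congr fun i => ?_
    simp only [hw]
    rw [← ENNReal.ofReal_toReal hpt, ← ENNReal.ofReal_pow ENNReal.toReal_nonneg,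
      ← ENNReal.ofReal_mul (by positivity), ENNReal.toReal_ofReal ENNReal.toReal_nonneg]
    congr 1
    ring
  rw [h2, h3, h4, h1]
  have h5 : ENNReal.ofReal (Real.exp (-(p.toReal * t))) * ENNReal.ofReal (Real.exp (p.toReal * t))
      = 1 := by
    rw [← ENNReal.ofReal_mul (Real.exp_pos _).le, ← Real.exp_add]
    simp
  calc _ = (ENNReal.ofReal (Real.exp (-(p.toReal * t))) * ENNReal.ofReal (Real.exp (p.toReal * t)))
        * (ENNReal.ofReal (Real.exp (-t)) * ∑' n, w n * b n) := by rw [h5, one_mul]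
    _ = _ := by ring

end PoissonizedDarts

/-! ### The entropy of linearizable sketches -/

section PoissonEntropy

theorem tsum_poisson (t : NNReal) : ∑' n : ℕ, poissonMeasure t {n} = 1 := by
  have h := measure_univ (μ := poissonMeasure t)
  rw [← lintegral_one, lintegral_countable'] at h
  simpa using h

theorem tsum_poisson_mul_nat (t : NNReal) : ∑' n : ℕ, poissonMeasure t {n} * (n : ℝ≥0∞) = t := by
  rw [tsum_eq_zero_add' ENNReal.summable]
  have h : ∀ n : ℕ, poissonMeasure t {n + 1} * ((n + 1 : ℕ) : ℝ≥0∞)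
      = t * poissonMeasure t {n} := by
    intro n
    rw [poissonMeasure_singleton, poissonMeasure_singleton, ← ENNReal.ofReal_natCast,
      ← ENNReal.ofReal_mul (by positivity), ← ENNReal.ofReal_coe_nnreal,
      ← ENNReal.ofReal_mul (by positivity)]
    congr 1
    rw [Nat.factorial_succ]
    push_cast
    field_simp
    ring
  simp_rw [h]
  rw [ENNReal.tsum_mul_left, tsum_poisson]
  simp

/-- Comparison with a reference weight `q`: atoms above `q` cost at most `-log q` per unit mass, and
those below at most `2√q`, because `-a log a ≤ 2√a`. -/
theorem enegMulLog_le_of_weight {a : ℝ≥0∞} (ha : a ≤ 1) {q : ℝ} (hq : 0 < q) :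
    enegMulLog a ≤ a * ENNReal.ofReal (-Real.log q) + ENNReal.ofReal (2 * Real.sqrt q) := by
  have ha' : a ≠ ∞ := ne_top_of_le_ne_top ENNReal.one_ne_top ha
  rcases eq_or_ne a 0 with h0 | h0
  · simp [h0, enegMulLog]
  have hpos : 0 < a.toReal := ENNReal.toReal_pos h0 ha'
  rcases le_total q a.toReal with h | h
  · refine le_trans ?_ le_self_add
    rw [enegMulLog_eq ha, mul_comm]
    gcongr
  · refine le_trans ?_ le_add_self
    refine ENNReal.ofReal_le_ofReal ?_
    have hs : 0 < Real.sqrt a.toReal := Real.sqrt_pos.2 hpos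
    have h1 := Real.log_le_sub_one_of_pos (inv_pos.2 hs)
    rw [Real.log_inv, Real.log_sqrt hpos.le] at h1
    have h2 : Real.sqrt a.toReal ≤ Real.sqrt q := Real.sqrt_le_sqrt h
    have h3 : a.toReal * (Real.sqrt a.toReal)⁻¹ = Real.sqrt a.toReal := by
      nth_rewrite 1 [← Real.mul_self_sqrt hpos.le]
      field_simp
    rw [Real.negMulLog]
    nlinarith [mul_le_mul_of_nonneg_left h1 hpos.le]

/-- A crude sublinear bound suffices. The reference weights `(n + 1)^{-4}` have summable square
roots, and `4 log(n + 1) ≤ δ n + K0` turns the other part into the mean. -/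
theorem exists_poisson_entropy_le {δ : ℝ} (hδ : 0 < δ) : ∃ K : ℝ, 0 ≤ K ∧ ∀ t : NNReal,
    ∑' n : ℕ, enegMulLog (poissonMeasure t {n}) ≤ ENNReal.ofReal (δ * t + K) := by
  have hs : Summable fun n : ℕ => 2 * (1 / ((n : ℝ) + 1) ^ 2) := by
    have := (summable_nat_add_iff (f := fun k : ℕ => 1 / (k : ℝ) ^ 2) 1).2
      (Real.summable_one_div_nat_pow.2 (by norm_num))
    simpa using this.mul_left 2
  have hs0 : 0 ≤ ∑' n : ℕ, 2 * (1 / ((n : ℝ) + 1) ^ 2) := tsum_nonneg fun n => by positivity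
  set K0 := |δ - 4 * Real.log (δ / 4)| with hK0
  have hterm : ∀ (t : NNReal) (n : ℕ), enegMulLog (poissonMeasure t {n})
      ≤ ENNReal.ofReal δ * (poissonMeasure t {n} * n) + ENNReal.ofReal K0 * poissonMeasure t {n}
        + ENNReal.ofReal (2 * (1 / ((n : ℝ) + 1) ^ 2)) := by
    intro t n
    have hn : (0 : ℝ) < n + 1 := by positivity
    refine (enegMulLog_le_of_weight prob_le_one
      (q := 1 / ((n : ℝ) + 1) ^ 4) (by positivity)).trans ?_
    have e1 : Real.sqrt (1 / ((n : ℝ) + 1) ^ 4) = 1 / ((n : ℝ) + 1) ^ 2 := by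
      rw [show 1 / ((n : ℝ) + 1) ^ 4 = (1 / ((n : ℝ) + 1) ^ 2) ^ 2 by rw [div_pow, ← pow_mul]; simp,
        Real.sqrt_sq (by positivity)]
    have e2 : -Real.log (1 / ((n : ℝ) + 1) ^ 4) ≤ δ * n + K0 := by
      rw [one_div, Real.log_inv, neg_neg, Real.log_pow]
      have h1 := Real.log_le_sub_one_of_pos (show 0 < δ / 4 * ((n : ℝ) + 1) by positivity)
      rw [Real.log_mul (by positivity) hn.ne'] at h1
      have h2 := le_abs_self (δ - 4 * Real.log (δ / 4))
      push_cast
      linarith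
    rw [e1]
    gcongr
    calc poissonMeasure t {n} * ENNReal.ofReal (-Real.log (1 / ((n : ℝ) + 1) ^ 4))
        ≤ poissonMeasure t {n} * (ENNReal.ofReal δ * n + ENNReal.ofReal K0) := by
          gcongr
          rw [← ENNReal.ofReal_natCast, ← ENNReal.ofReal_mul hδ.le,
            ← ENNReal.ofReal_add (by positivity) (abs_nonneg _)]
          exact ENNReal.ofReal_le_ofReal e2
      _ = _ := by ring
  refine ⟨K0 + ∑' n : ℕ, 2 * (1 / ((n : ℝ) + 1) ^ 2), by positivity, fun t => ?_⟩
  refine (ENNReal.tsum_le_tsum (hterm t)).trans ?_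
  rw [ENNReal.tsum_add, ENNReal.tsum_add, ENNReal.tsum_mul_left, ENNReal.tsum_mul_left,
    tsum_poisson_mul_nat, tsum_poisson, ← ENNReal.ofReal_tsum_of_nonneg (fun n => by positivity) hs,
    ← ENNReal.ofReal_coe_nnreal, ← ENNReal.ofReal_mul hδ.le, mul_one,
    ← ENNReal.ofReal_add (by positivity) (abs_nonneg _), ← ENNReal.ofReal_add (by positivity) hs0,
    add_assoc]

end PoissonEntropy

/-! ### Free area and change probability of a reachable state -/

section Sketch

namespace DartboardSketch

variable {C : Type*} (X : DartboardSketch C)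

theorem run_append (l : List C) (c : C) : X.run (l ++ [c]) = X.step (X.run l) c := by
  simp [run]

theorem run_subset_append (l : List C) (c : C) : X.run l ⊆ X.run (l ++ [c]) := by
  rw [run_append]
  exact X.occupied_mono l c

theorem mem_run_of_mem {l : List C} {c : C} (h : c ∈ l) : c ∈ X.run l := X.occupied_of_hit l c h

/-- If `c` is free, the hit makes it occupied, so the state must change. Hence `P_k` is the free
area of the state after `k - 1` darts. -/
theorem step_run_ne_iff (l : List C) (c : C) : X.step (X.run l) c ≠ X.run l ↔ c ∉ X.run l := by
  constructor
  · intro h hc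
    exact h (X.step_eq_of_occupied l c hc)
  · intro hc h
    apply hc
    rw [← h, ← run_append]
    exact X.mem_run_of_mem (by simp)

open Classical in
/-- The total area of the free cells. -/
noncomputable def freeArea (l : List C) : ℝ≥0∞ := ∑' c, X.area c * if c ∈ X.run l then 0 else 1

theorem freeArea_le_one (l : List C) : X.freeArea l ≤ 1 := by
  classical
  rw [← X.area.tsum_coe, freeArea]
  refine ENNReal.tsum_le_tsum fun c => ?_
  split_ifs <;> simp

theorem freeArea_ne_top (l : List C) : X.freeArea l ≠ ∞ :=
  ne_top_of_le_ne_top ENNReal.one_ne_top (X.freeArea_le_one l)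

theorem freeArea_append_le (l : List C) (c : C) : X.freeArea (l ++ [c]) ≤ X.freeArea l := by
  classical
  refine ENNReal.tsum_le_tsum fun d => ?_
  gcongr
  by_cases h : d ∈ X.run l
  · simp [h, X.run_subset_append l c h]
  · simp only [h, if_false]
    split_ifs <;> simp

theorem changeProb_run (l : List C) : X.changeProb (X.run l) = (X.freeArea l).toReal := by
  classical
  rw [changeProb, freeArea]
  congr 1
  refine tsum_congr fun c => ?_
  by_cases h : c ∈ X.run l
  · rw [Set.indicator_of_notMem fun hne => (X.step_run_ne_iff l c).1 hne h]
    simp [h]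
  · rw [Set.indicator_of_mem ((X.step_run_ne_iff l c).2 h)]
    simp [h]

end DartboardSketch

end Sketch

/-! ### The probability that the predecessors leave a cell free -/

section FreeProb

variable {C Ω : Type*} [MeasurableSpace Ω] {μ : Measure Ω} {X : DartboardSketch C}
  {D : ℕ → Ω → C} [LinearOrder C] {φ : C → Set C → Prop}

namespace DartboardSketch

open Classical in
/-- The probability that `c` has not been occupied by virtue of its predecessors. -/
noncomputable def freeProb (X : DartboardSketch C) (μ : Measure Ω) (D : ℕ → Ω → C)
    (φ : C → Set C → Prop) (c : C) (t : NNReal) : ℝ≥0∞ :=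
  poissonExp μ D t fun l => if φ c (X.run l ∩ Set.Iio c) then 0 else 1

/-- Occupied sets grow and `φ c` is monotone. This is the decreasing weight needed in
`lintegral_weighted_binEntropy`. -/
theorem freeProb_antitone (hφ : ∀ c, Monotone (φ c)) (c : C) :
    Antitone (freeProb X μ D φ c) := by
  classical
  refine poissonExp_antitone fun l d => ?_
  by_cases h : φ c (X.run l ∩ Set.Iio c)
  · have h' : φ c (X.run (l ++ [d]) ∩ Set.Iio c) :=
      hφ c (Set.inter_subset_inter_left _ (X.run_subset_append l d)) h
    simp [h, h']
  · simp only [h, if_false]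
    split_ifs <;> simp

theorem freeProb_le_one [IsProbabilityMeasure μ] (c : C) (t : NNReal) : freeProb X μ D φ c t ≤ 1 := by
  classical
  calc freeProb X μ D φ c t ≤ ∑' n, poissonMeasure t {n} * 1 := by
        refine ENNReal.tsum_le_tsum fun n => ?_
        gcongr
        calc _ ≤ ∫⁻ _, 1 ∂μ := lintegral_mono fun ω => by
              simp only
              split_ifs <;> simp
          _ = 1 := by simp
    _ = 1 := by simp [tsum_poisson]

/-- Locality of the recursion: cells before `c` do not see darts in `c`. This supplies the
hypothesis `IgnoresCell` of `poissonExp_notMem`. -/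
theorem run_inter_Iio_congr
    (hloc : ∀ (l l' : List C) (c : C), (∀ d ≤ c, d ∈ l ↔ d ∈ l') → (c ∈ X.run l ↔ c ∈ X.run l'))
    {c : C} {l l' : List C} (h : ∀ d, d ≠ c → (d ∈ l ↔ d ∈ l')) :
    X.run l ∩ Set.Iio c = X.run l' ∩ Set.Iio c := by
  ext d
  simp only [Set.mem_inter_iff, Set.mem_Iio]
  refine and_congr_left fun hd => hloc l l' d fun e he => h e (he.trans_lt hd).ne

end DartboardSketch

end FreeProb

section Linearizable

variable {C Ω : Type*} [MeasurableSpace C] [MeasurableSingletonClass C] [Countable C]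
  [MeasurableSpace Ω] {μ : Measure Ω} [IsProbabilityMeasure μ] {X : DartboardSketch C}
  {D : ℕ → Ω → C}

namespace DartboardSketch

/-- The entropy of a Poissonized sketch exceeds the memory by at most the entropy of the number
of darts. -/
theorem natEntropy_poisson_le (hD : ∀ k, Measurable (D k)) (t : NNReal) :
    natEntropy (fun q : Ω × ℕ => X.run (darts D q.2 q.1)) (μ.prod (poissonMeasure t))
      ≤ (∑' n : ℕ, enegMulLog (poissonMeasure t {n})) + ⨆ n, natEntropy (X.state D n) μ := by
  -- Recording the number of darts as well only raises the entropy; the chain rule then gives the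
  -- entropy of the count plus an average of the entropies at fixed counts.
  have hS := (isDiscreteRV_darts_prod hD).comp fun r : ℕ × List C => (r.1, X.run r.2)
  refine (natEntropy_comp_le hS Prod.snd).trans ?_
  have hpre : ∀ n s, μ.prod (poissonMeasure t)
      ((fun q : Ω × ℕ => (q.2, X.run (darts D q.2 q.1))) ⁻¹' {(n, s)})
        = poissonMeasure t {n} * μ (X.state D n ⁻¹' {s}) := by
    intro n s
    have : (fun q : Ω × ℕ => (q.2, X.run (darts D q.2 q.1))) ⁻¹' {(n, s)}
        = (X.state D n ⁻¹' {s}) ×ˢ {n} := by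
      ext ⟨ω, k⟩
      simp only [Set.mem_preimage, Set.mem_singleton_iff, Prod.mk.injEq, Set.mem_prod, state_eq]
      constructor
      · rintro ⟨rfl, h⟩
        exact ⟨h, rfl⟩
      · rintro ⟨h, rfl⟩
        exact ⟨rfl, h⟩
    rw [this, Measure.prod_prod, mul_comm]
  have hSn : ∀ n, IsDiscreteRV (X.state D n) := fun n => (isDiscreteRV_darts hD n).comp X.run
  calc natEntropy (fun q : Ω × ℕ => (q.2, X.run (darts D q.2 q.1))) (μ.prod (poissonMeasure t))
      = ∑' n, ∑' s, enegMulLog (poissonMeasure t {n} * μ (X.state D n ⁻¹' {s})) := by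
        rw [natEntropy, ENNReal.tsum_prod (f := fun n s => enegMulLog (μ.prod (poissonMeasure t)
          ((fun q : Ω × ℕ => (q.2, X.run (darts D q.2 q.1))) ⁻¹' {(n, s)})))]
        simp_rw [hpre]
    _ = ∑' n, (enegMulLog (poissonMeasure t {n})
          + poissonMeasure t {n} * natEntropy (X.state D n) μ) := by
        refine tsum_congr fun n => ?_
        simp_rw [enegMulLog_mul (prob_le_one (μ := poissonMeasure t))
          (prob_le_one (μ := μ) (s := X.state D n ⁻¹' {_}))]
        rw [ENNReal.tsum_add, ENNReal.tsum_mul_right, (hSn n).tsum_measure, one_mul,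
          ENNReal.tsum_mul_left, natEntropy]
    _ ≤ ∑' n, (enegMulLog (poissonMeasure t {n})
          + poissonMeasure t {n} * ⨆ n, natEntropy (X.state D n) μ) := by
        refine ENNReal.tsum_le_tsum fun n => ?_
        gcongr
        exact le_iSup (fun n => natEntropy (X.state D n) μ) n
    _ = _ := by rw [ENNReal.tsum_add, ENNReal.tsum_mul_right, tsum_poisson, one_mul]

section LinearOrder

variable [LinearOrder C] {φ : C → Set C → Prop}

open Classical in
-- A cell is free iff it is unhit and not forced by its predecessors; Poissonization makes the two
-- conditions independent.
theorem poissonExp_notMem_run (hD : X.IsDartSequence μ D)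
    (hrec : ∀ (l : List C) (c : C), c ∈ X.run l ↔ c ∈ l ∨ φ c (X.run l ∩ Set.Iio c))
    (hloc : ∀ (l l' : List C) (c : C), (∀ d ≤ c, d ∈ l ↔ d ∈ l') → (c ∈ X.run l ↔ c ∈ X.run l'))
    (c : C) (t : NNReal) :
    poissonExp μ D t (fun l => if c ∈ X.run l then 0 else 1)
      = ENNReal.ofReal (Real.exp (-((X.area c).toReal * t))) * freeProb X μ D φ c t := by
  rw [freeProb, ← poissonExp_notMem hD]
  · congr 1
    funext l
    rw [hrec l c]
    by_cases h1 : c ∈ l <;> by_cases h2 : φ c (X.run l ∩ Set.Iio c) <;> simp [h1, h2]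
  · intro l l' h
    simp only [run_inter_Iio_congr hloc h]

/-- The chain rule along the linear order: given earlier statuses that do not force `c`, its status
is a Bernoulli variable with parameter `e^{-pt}` for being free. Forced cells are credited nothing.
-/
theorem sum_freeProb_le_natEntropy (hD : X.IsDartSequence μ D)
    (hrec : ∀ (l : List C) (c : C), c ∈ X.run l ↔ c ∈ l ∨ φ c (X.run l ∩ Set.Iio c))
    (hloc : ∀ (l l' : List C) (c : C), (∀ d ≤ c, d ∈ l ↔ d ∈ l') → (c ∈ X.run l ↔ c ∈ X.run l'))
    (t : NNReal) (F : Finset C) :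
    ∑ c ∈ F, ENNReal.ofReal (Real.binEntropy (Real.exp (-((X.area c).toReal * t))))
        * freeProb X μ D φ c t
      ≤ natEntropy (fun q : Ω × ℕ => X.run (darts D q.2 q.1)) (μ.prod (poissonMeasure t)) := by
  classical
  have hdisc := isDiscreteRV_darts_prod (D := D) hD.measurable
  -- The state is restricted to a set `B` containing the initial segments of `F`, so that after
  -- removing the largest cell `a` the induction hypothesis applies to the cells below `a`.
  suffices h : ∀ B : Set C, (∀ c ∈ F, Set.Iic c ⊆ B) →
      ∑ c ∈ F, ENNReal.ofReal (Real.binEntropy (Real.exp (-((X.area c).toReal * t))))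
        * freeProb X μ D φ c t
      ≤ natEntropy (fun q : Ω × ℕ => X.run (darts D q.2 q.1) ∩ B) (μ.prod (poissonMeasure t)) by
    simpa using h Set.univ fun c _ => Set.subset_univ _
  induction F using Finset.induction_on_max with
  | empty => simp
  | insert a F hlt ih =>
    intro B hB
    have haF : a ∉ F := fun h => lt_irrefl a (hlt a h)
    rw [Finset.sum_insert haF, add_comm]
    set S : Ω × ℕ → Set C := fun q => X.run (darts D q.2 q.1) ∩ Set.Iio a with hS
    have hSd : IsDiscreteRV S := hdisc.comp fun r : ℕ × List C => X.run r.2 ∩ Set.Iio a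
    set E : Set (Ω × ℕ) := {q | a ∉ X.run (darts D q.2 q.1)} with hE
    have hEm : MeasurableSet E := hdisc.measurableSet_preimage {r | a ∉ X.run r.2}
    have hθ1 : Real.exp (-((X.area a).toReal * t)) ≤ 1 :=
      Real.exp_le_one_iff.2 (neg_nonpos.2 (by positivity))
    have hcond : ∀ s ∈ {s | ¬ φ a s}, μ.prod (poissonMeasure t) (E ∩ S ⁻¹' {s})
        = ENNReal.ofReal (Real.exp (-((X.area a).toReal * t)))
          * μ.prod (poissonMeasure t) (S ⁻¹' {s}) := by
      intro s hs
      have hs : ¬ φ a s := hs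
      have h1 : E ∩ S ⁻¹' {s}
          = {q | a ∉ darts D q.2 q.1 ∧ X.run (darts D q.2 q.1) ∩ Set.Iio a = s} := by
        ext q
        simp only [hE, hS, Set.mem_inter_iff, Set.mem_ofPred_eq, Set.mem_preimage,
          Set.mem_singleton_iff]
        refine and_congr_left fun hq => ?_
        rw [hrec, hq]
        simp [hs]
      have h2 : S ⁻¹' {s} = {q | X.run (darts D q.2 q.1) ∩ Set.Iio a = s} := rfl
      rw [h1, h2, measure_prod_poisson hD.measurable t fun l => a ∉ l ∧ X.run l ∩ Set.Iio a = s,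
        measure_prod_poisson hD.measurable t fun l => X.run l ∩ Set.Iio a = s,
        ← poissonExp_notMem hD]
      · congr 1
        funext l
        by_cases hl : a ∈ l <;> simp [hl]
      · intro l l' h
        have := run_inter_Iio_congr (X := X) hloc h
        by_cases hl : X.run l' ∩ Set.Iio a = s <;> simp [this, hl]
    have key := natEntropy_add_le_of_condProb (μ := μ.prod (poissonMeasure t)) hSd hEm
      {s | ¬ φ a s} (Real.exp_pos _).le hθ1 hcond
    have hfree : μ.prod (poissonMeasure t) (S ⁻¹' {s | ¬ φ a s}) = freeProb X μ D φ a t := by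
      have h2 : S ⁻¹' {s | ¬ φ a s} = {q | ¬ φ a (X.run (darts D q.2 q.1) ∩ Set.Iio a)} := rfl
      rw [h2, measure_prod_poisson hD.measurable t fun l => ¬ φ a (X.run l ∩ Set.Iio a), freeProb]
      congr 1
      funext l
      by_cases hl : φ a (X.run l ∩ Set.Iio a) <;> simp [hl]
    rw [hfree] at key
    have haB : Set.Iic a ⊆ B := hB a (Finset.mem_insert_self a F)
    have hcomp : natEntropy (fun q => (S q, q ∈ E)) (μ.prod (poissonMeasure t))
        ≤ natEntropy (fun q : Ω × ℕ => X.run (darts D q.2 q.1) ∩ B)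
          (μ.prod (poissonMeasure t)) := by
      have hd : IsDiscreteRV (fun q : Ω × ℕ => X.run (darts D q.2 q.1) ∩ B) :=
        hdisc.comp fun r : ℕ × List C => X.run r.2 ∩ B
      have := natEntropy_comp_le (μ := μ.prod (poissonMeasure t)) hd
        fun s => (s ∩ Set.Iio a, a ∉ s)
      convert this using 3 with q
      refine Prod.ext ?_ ?_
      · simp only [hS]
        rw [Set.inter_assoc, Set.inter_eq_right.2 (Set.Iio_subset_Iic_self.trans haB)]
      · simp [hE, haB (Set.mem_Iic.2 le_rfl)]
    refine le_trans ?_ (key.trans hcomp)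
    gcongr
    exact ih (Set.Iio a) fun c hc => Set.Iic_subset_Iio.2 (hlt c hc)

end LinearOrder

/-- The integrated entropy bound: on a logarithmic time scale, the memory of a linearizable sketch
is at least `H₀` times the expected total area of the free cells, up to boundary terms. -/
theorem IsLinearizable.lintegral_freeArea_le (hX : X.IsLinearizable) (hD : X.IsDartSequence μ D)
    {a b : ℝ} (ha : 0 < a) (hab : a ≤ b) {M : ℝ≥0∞}
    (hM : ∀ t : ℝ, a ≤ t → t ≤ b → (∑' n : ℕ, enegMulLog (poissonMeasure t.toNNReal {n}))
      + (⨆ n, natEntropy (X.state D n) μ) ≤ M) :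
    ENNReal.ofReal natH0 * ∫⁻ t in Set.Ioc a b, poissonExp μ D t.toNNReal X.freeArea
      ≤ M * ENNReal.ofReal (Real.log (b / a)) + (9 * M + ENNReal.ofReal (natH0 * a)) := by
  classical
  obtain ⟨_, φ, hφ, hrec, hloc⟩ := hX
  set g : C → ℝ → ℝ≥0∞ := fun c t => freeProb X μ D φ c t.toNNReal with hg
  have hganti : ∀ c, Antitone (g c) := fun c s t hst =>
    freeProb_antitone hφ c (Real.toNNReal_le_toNNReal hst)
  have hgm : ∀ c, Measurable (g c) := fun c => (hganti c).measurable
  set p : C → ℝ := fun c => (X.area c).toReal with hp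
  have hentropy : ∀ t : ℝ, a ≤ t → t ≤ b → ∀ F : Finset C,
      ∑ c ∈ F, ENNReal.ofReal (Real.binEntropy (Real.exp (-(p c * t)))) * g c t ≤ M := by
    intro t hat htb F
    have h := sum_freeProb_le_natEntropy hD hrec hloc t.toNNReal F
    rw [Real.coe_toNNReal t (ha.le.trans hat)] at h
    exact h.trans ((natEntropy_poisson_le hD.measurable _).trans (hM t hat htb))
  have hfree : ∀ t ∈ Set.Ioc a b, poissonExp μ D t.toNNReal X.freeArea
      = ∑' c, g c t * ENNReal.ofReal (p c * Real.exp (-(p c * t))) := by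
    intro t ht
    have h1 : ∀ n, ∫⁻ ω, X.freeArea (darts D n ω) ∂μ
        = ∑' c, X.area c * ∫⁻ ω, (if c ∈ X.run (darts D n ω) then 0 else 1) ∂μ := by
      intro n
      have hm : ∀ c, Measurable fun ω => if c ∈ X.run (darts D n ω) then (0 : ℝ≥0∞) else 1 :=
        fun c => (isDiscreteRV_darts hD.measurable n).measurable_comp
          fun l => if c ∈ X.run l then (0 : ℝ≥0∞) else 1
      simp only [freeArea]
      rw [lintegral_tsum fun c => ((hm c).const_mul _).aemeasurable]
      exact tsum_congr fun c => lintegral_const_mul _ (hm c)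
    have h2 : poissonExp μ D t.toNNReal X.freeArea
        = ∑' c, X.area c * poissonExp μ D t.toNNReal (fun l => if c ∈ X.run l then 0 else 1) := by
      rw [poissonExp]
      simp_rw [h1, ← ENNReal.tsum_mul_left]
      rw [ENNReal.tsum_comm]
      refine tsum_congr fun c => ?_
      rw [poissonExp, ← ENNReal.tsum_mul_left]
      exact tsum_congr fun n => by ring
    rw [h2]
    refine tsum_congr fun c => ?_
    rw [poissonExp_notMem_run (φ := φ) hD hrec hloc, Real.coe_toNNReal t (ha.trans ht.1).le,
      ENNReal.ofReal_mul ENNReal.toReal_nonneg, ENNReal.ofReal_toReal (X.area.apply_ne_top c)]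
    ring
  rw [setLIntegral_congr_fun measurableSet_Ioc hfree,
    lintegral_tsum (f := fun c t => g c t * ENNReal.ofReal (p c * Real.exp (-(p c * t))))
      fun c => ((hgm c).mul (by fun_prop)).aemeasurable, ← ENNReal.tsum_mul_left,
    ENNReal.tsum_eq_iSup_sum]
  refine iSup_le fun F => ?_
  have hbe : Measurable Real.binEntropy := Real.binEntropy_continuous.measurable
  have hhm : ∀ c, Measurable fun t : ℝ =>
      ENNReal.ofReal (Real.binEntropy (Real.exp (-(p c * t))) / t) := fun c =>
    ENNReal.measurable_ofReal.comp ((hbe.comp (by fun_prop)).div measurable_id)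
  -- Two boundary terms per cell: summed over `F`, the first is at most `9` times the entropy at
  -- time `a`, the second at most `natH0 * a` because the areas sum to one.
  have hcell : ∀ c, ENNReal.ofReal natH0
      * ∫⁻ t in Set.Ioc a b, g c t * ENNReal.ofReal (p c * Real.exp (-(p c * t)))
      ≤ (∫⁻ t in Set.Ioc a b,
          g c t * ENNReal.ofReal (Real.binEntropy (Real.exp (-(p c * t))) / t))
        + (9 * (ENNReal.ofReal (Real.binEntropy (Real.exp (-(p c * a)))) * g c a)
          + ENNReal.ofReal (natH0 * (p c * a))) := by
    intro c
    rcases eq_or_lt_of_le (show 0 ≤ p c from ENNReal.toReal_nonneg) with h0 | h0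
    · simp [← h0]
    have h1 := lintegral_weighted_binEntropy h0 ha hab ((hganti c).antitoneOn _) (hgm c)
      (fun t => freeProb_le_one c _)
    have h2 := lintegral_binEntropy_div_Ioc_le h0 ha
    rw [← lintegral_const_mul (f := fun t => g c t * ENNReal.ofReal (p c * Real.exp (-(p c * t)))) _
      ((hgm c).mul (by fun_prop))]
    calc _ = ∫⁻ t in Set.Ioc a b,
          g c t * ENNReal.ofReal (natH0 * (p c * Real.exp (-(p c * t)))) := by
          refine lintegral_congr fun t => ?_
          rw [ENNReal.ofReal_mul natH0_pos.le]
          ring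
      _ ≤ _ := h1
      _ ≤ _ := by
          gcongr
          refine (mul_le_mul_right h2 _).trans ?_
          rw [mul_add]
          exact add_le_add (le_of_eq (by ring)) (mul_le_of_le_one_left' (freeProb_le_one c _))
  refine (Finset.sum_le_sum fun c _ => hcell c).trans ?_
  rw [Finset.sum_add_distrib, Finset.sum_add_distrib, ← Finset.mul_sum,
    ← lintegral_finsetSum (f := fun c t =>
      g c t * ENNReal.ofReal (Real.binEntropy (Real.exp (-(p c * t))) / t)) F
      fun c _ => (hgm c).mul (hhm c)]
  gcongr
  · have hlog : ∫⁻ t in Set.Ioc a b, ENNReal.ofReal t⁻¹ = ENNReal.ofReal (Real.log (b / a)) := by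
      have hcont : ContinuousOn (fun s : ℝ => s⁻¹) (Set.Icc a b) :=
        continuousOn_inv₀.mono fun s hs => ne_of_gt (ha.trans_le hs.1)
      rw [← ofReal_integral_eq_lintegral_ofReal
        (hcont.integrableOn_Icc.mono_set Set.Ioc_subset_Icc_self),
        ← intervalIntegral.integral_of_le hab, integral_inv_of_pos ha (ha.trans_le hab)]
      filter_upwards [ae_restrict_mem measurableSet_Ioc] with s hs
      exact inv_nonneg.2 (ha.trans hs.1).le
    rw [← hlog, ← lintegral_const_mul _ (by fun_prop)]
    refine setLIntegral_mono' measurableSet_Ioc fun t ht => ?_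
    have ht0 : 0 < t := ha.trans ht.1
    calc ∑ c ∈ F, g c t * ENNReal.ofReal (Real.binEntropy (Real.exp (-(p c * t))) / t)
        = (∑ c ∈ F, ENNReal.ofReal (Real.binEntropy (Real.exp (-(p c * t)))) * g c t)
          * ENNReal.ofReal t⁻¹ := by
          rw [Finset.sum_mul]
          refine Finset.sum_congr rfl fun c _ => ?_
          rw [div_eq_mul_inv, ENNReal.ofReal_mul' (inv_nonneg.2 ht0.le)]
          ring
      _ ≤ _ := by
          gcongr
          exact hentropy t ht.1.le ht.2 F
  · exact hentropy a le_rfl hab F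
  · rw [← ENNReal.ofReal_sum_of_nonneg fun c _ => by
      have := natH0_pos
      have : 0 ≤ p c := ENNReal.toReal_nonneg
      positivity]
    refine ENNReal.ofReal_le_ofReal ?_
    rw [← Finset.mul_sum, ← Finset.sum_mul]
    have h1 : ∑ c ∈ F, p c ≤ 1 :=
      sum_le_hasSum F (fun c _ => ENNReal.toReal_nonneg) (sum_area_toReal X.area)
    have := natH0_pos
    gcongr
    exact mul_le_of_le_one_left ha.le h1

end DartboardSketch

end Linearizable

/-! ### The memory of scale-invariant linearizable schemes -/

/-- Chernoff's bound with exponent `τ = ε / 2`, using `e^τ ≤ 1 + τ + τ²`. -/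
theorem poisson_tail_le {t : NNReal} {ε x : ℝ} (hε : 0 < ε) (hε1 : ε ≤ 1)
    (hx : (1 + ε) * t ≤ x) :
    poissonMeasure t {n : ℕ | x ≤ n} ≤ ENNReal.ofReal (Real.exp (-(ε ^ 2 / 4 * t))) := by
  classical
  set τ := ε / 2 with hτ
  have h1 : poissonMeasure t {n : ℕ | x ≤ n}
      = ∑' n : ℕ, if x ≤ n then poissonMeasure t {n} else 0 := by
    have := (isDiscreteRV_of_measurable (measurable_id (α := ℕ))).measure_preimage
      (poissonMeasure t) {n : ℕ | x ≤ n}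
    simpa using this
  have hs : HasSum (fun n : ℕ => Real.exp (-t - τ * x) * ((t * Real.exp τ) ^ n / (n.factorial : ℝ)))
      (Real.exp (-t - τ * x) * Real.exp (t * Real.exp τ)) := by
    refine HasSum.mul_left _ ?_
    rw [Real.exp_eq_exp_ℝ]
    exact NormedSpace.expSeries_div_hasSum_exp _
  rw [h1]
  calc ∑' n : ℕ, (if x ≤ n then poissonMeasure t {n} else 0)
      ≤ ∑' n : ℕ, ENNReal.ofReal
        (Real.exp (-t - τ * x) * ((t * Real.exp τ) ^ n / (n.factorial : ℝ))) := by
        refine ENNReal.tsum_le_tsum fun n => ?_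
        split_ifs with h
        · rw [poissonMeasure_singleton]
          refine ENNReal.ofReal_le_ofReal ?_
          have h2 : 1 ≤ Real.exp (τ * n - τ * x) := by
            rw [Real.one_le_exp_iff]
            have : 0 ≤ τ * (n - x) := mul_nonneg (by positivity) (by linarith)
            linarith
          have h3 : Real.exp (-t - τ * x) * ((t * Real.exp τ) ^ n / (n.factorial : ℝ))
              = (Real.exp (-t) * t ^ n / (n.factorial : ℝ)) * Real.exp (τ * n - τ * x) := by
            rw [mul_pow, ← Real.exp_nat_mul, sub_eq_add_neg, sub_eq_add_neg, Real.exp_add,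
              Real.exp_add, mul_comm τ (n : ℝ)]
            ring
          rw [h3]
          exact le_mul_of_one_le_right (by positivity) h2
        · exact zero_le
    _ = ENNReal.ofReal (Real.exp (-t - τ * x) * Real.exp (t * Real.exp τ)) := by
        rw [← ENNReal.ofReal_tsum_of_nonneg (fun n => by positivity) hs.summable, hs.tsum_eq]
    _ ≤ _ := by
        refine ENNReal.ofReal_le_ofReal ?_
        rw [← Real.exp_add, Real.exp_le_exp]
        have h4 := abs_le.1 (Real.abs_exp_sub_one_sub_id_le (x := τ) (by
          rw [abs_of_pos (by positivity)]; linarith))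
        have h5 : (t : ℝ) * Real.exp τ ≤ t * (1 + τ + τ ^ 2) :=
          mul_le_mul_of_nonneg_left (by linarith [h4.2]) t.2
        have h6 : τ * ((1 + ε) * t) ≤ τ * x := mul_le_mul_of_nonneg_left hx (by positivity)
        have h7 : (t : ℝ) * (1 + τ + τ ^ 2) = t + τ * ((1 + ε) * t) - ε ^ 2 / 4 * t := by
          rw [hτ]; ring
        linarith

theorem setLIntegral_Ioc_mul {m : ℝ} (hm : 0 < m) (a b : ℝ) (f : ℝ → ℝ≥0∞) :
    ∫⁻ t in Set.Ioc (a * m) (b * m), f t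
      = ENNReal.ofReal m * ∫⁻ s in Set.Ioc a b, f (s * m) := by
  have himg : (fun s => s * m) '' Set.Ioc a b = Set.Ioc (a * m) (b * m) :=
    Set.image_mul_right_Ioc a b hm
  have hd : ∀ x : ℝ, HasDerivAt (fun s : ℝ => s * m) m x := fun x => by
    simpa using (hasDerivAt_id x).mul_const m
  rw [← himg, lintegral_image_eq_lintegral_abs_deriv_mul measurableSet_Ioc
    (fun x _ => (hd x).hasDerivWithinAt)
    (fun x _ y _ h => mul_right_cancel₀ hm.ne' h)]
  rw [← lintegral_const_mul' _ _ ENNReal.ofReal_ne_top]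
  simp [abs_of_pos hm]

/-- Since `P_k` is determined by the first `k - 1` darts, the index `⌊r * m⌋₊ - 1` appears here and
throughout. -/
theorem DartboardSketch.tendsto_freeArea_of_scale {C : ℕ → Type*} {Ω : Type*}
    {X : ∀ m, DartboardSketch (C m)} {D : ∀ m, ℕ → Ω → C m} {r k : ℝ} (hr : 0 < r) {ω : Ω}
    (h : Tendsto (fun m : ℕ => r * (X m).stateChangeProb (D m) ⌊r * m⌋₊ ω) atTop (𝓝 k)) :
    Tendsto (fun m : ℕ => (X m).freeArea (darts (D m) (⌊r * m⌋₊ - 1) ω)) atTop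
      (𝓝 (ENNReal.ofReal (k / r))) := by
  have h1 := ENNReal.tendsto_ofReal (h.div_const r)
  refine h1.congr fun m => ?_
  rw [DartboardSketch.stateChangeProb, DartboardSketch.state_eq, DartboardSketch.changeProb_run, mul_div_cancel_left₀ _ hr.ne',
    ENNReal.ofReal_toReal ((X m).freeArea_ne_top _)]

section Scheme

variable {C : ℕ → Type*} [∀ m, Countable (C m)] [∀ m, MeasurableSpace (C m)]
  [∀ m, MeasurableSingletonClass (C m)] {Ω : Type*} [MeasurableSpace Ω] {μ : Measure Ω}
  [IsProbabilityMeasure μ] {X : ∀ m, DartboardSketch (C m)} {D : ∀ m, ℕ → Ω → C m}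

namespace DartboardSketch

/-- At time `s m` the Poisson number of darts is, with high probability, below the deterministic
number at the slightly larger scale `(1 + 2ε) s`, and the free area decreases with further darts.
Fatou's lemma passes from almost sure limits to expectations. -/
theorem le_liminf_poissonExp_freeArea (hD : ∀ m, (X m).IsDartSequence μ (D m)) {s ε k : ℝ}
    (hs : 0 < s) (hε : 0 < ε) (hε1 : ε ≤ 1)
    (h : ∀ᵐ ω ∂μ, Tendsto (fun m : ℕ => ((1 + 2 * ε) * s)
      * (X m).stateChangeProb (D m) ⌊((1 + 2 * ε) * s) * m⌋₊ ω) atTop (𝓝 k)) :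
    ENNReal.ofReal (k / ((1 + 2 * ε) * s))
      ≤ liminf (fun m : ℕ => poissonExp μ (D m) (s * m).toNNReal (X m).freeArea) atTop := by
  set s' := (1 + 2 * ε) * s with hs'
  have hs'0 : 0 < s' := by positivity
  set v : ℕ → ℝ≥0∞ := fun m => ∫⁻ ω, (X m).freeArea (darts (D m) (⌊s' * m⌋₊ - 1) ω) ∂μ with hv
  set w : ℕ → ℝ≥0∞ := fun m => poissonMeasure (s * m).toNNReal {n | n ≤ ⌊s' * m⌋₊ - 1} with hw
  have h1 : ∀ m, w m * v m ≤ poissonExp μ (D m) (s * m).toNNReal (X m).freeArea := by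
    intro m
    classical
    have e : w m = ∑' n : ℕ, if n ≤ ⌊s' * m⌋₊ - 1 then poissonMeasure (s * m).toNNReal {n}
        else 0 := by
      have := (isDiscreteRV_of_measurable (measurable_id (α := ℕ))).measure_preimage
        (poissonMeasure (s * m).toNNReal) {n : ℕ | n ≤ ⌊s' * m⌋₊ - 1}
      simpa using this
    rw [e, ← ENNReal.tsum_mul_right, poissonExp]
    refine ENNReal.tsum_le_tsum fun n => ?_
    split_ifs with hn
    · gcongr
      have ha : Antitone fun n => ∫⁻ ω, (X m).freeArea (darts (D m) n ω) ∂μ := by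
        refine antitone_nat_of_succ_le fun n => lintegral_mono fun ω => ?_
        rw [darts_succ]
        exact (X m).freeArea_append_le _ _
      exact ha hn
    · simp
  have h2 : ENNReal.ofReal (k / s') ≤ liminf v atTop := by
    have hm : ∀ m : ℕ, Measurable fun ω => (X m).freeArea (darts (D m) (⌊s' * m⌋₊ - 1) ω) :=
      fun m => (isDiscreteRV_darts (hD m).measurable _).measurable_comp (X m).freeArea
    refine le_trans (le_of_eq ?_) (lintegral_liminf_le hm)
    rw [lintegral_congr_ae (g := fun _ => ENNReal.ofReal (k / s'))]
    · simp
    · filter_upwards [h] with ω hω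
      exact (tendsto_freeArea_of_scale hs'0 hω).liminf_eq
  have h3 : Tendsto w atTop (𝓝 1) := by
    have hm : Tendsto (fun m : ℕ => s * (m : ℝ)) atTop atTop :=
      tendsto_natCast_atTop_atTop.const_mul_atTop hs
    have htail : Tendsto (fun m : ℕ => 1 - ENNReal.ofReal (Real.exp (-(ε ^ 2 / 4 * (s * m)))))
        atTop (𝓝 (1 - ENNReal.ofReal 0)) := by
      refine ENNReal.Tendsto.sub tendsto_const_nhds (ENNReal.tendsto_ofReal ?_)
        (Or.inl ENNReal.one_ne_top)
      exact Real.tendsto_exp_neg_atTop_nhds_zero.comp (hm.const_mul_atTop (by positivity))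
    rw [ENNReal.ofReal_zero, tsub_zero] at htail
    refine tendsto_of_tendsto_of_tendsto_of_le_of_le' htail tendsto_const_nhds ?_
      (Eventually.of_forall fun m => prob_le_one)
    -- One of the two `ε` absorbs the rounding in `⌊s' * m⌋₊ - 1`; the other is for the tail bound.
    filter_upwards [hm.eventually_ge_atTop (2 / ε)] with m hbig
    have hsm : 0 ≤ s * (m : ℝ) := by positivity
    have hc : {n : ℕ | n ≤ ⌊s' * m⌋₊ - 1}ᶜ ⊆ {n : ℕ | (1 + ε) * (s * m) ≤ (n : ℝ)} := by
      intro n hn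
      simp only [Set.mem_compl_iff, Set.mem_ofPred_eq, not_le] at hn ⊢
      have hn' : ⌊s' * m⌋₊ ≤ n := by omega
      have h4 := Nat.lt_floor_add_one (s' * m)
      have h5 : (⌊s' * m⌋₊ : ℝ) ≤ n := by exact_mod_cast hn'
      have h6 : 2 ≤ ε * (s * m) := by
        rw [div_le_iff₀ hε] at hbig
        linarith
      have h7 : s' * m = (1 + ε) * (s * m) + ε * (s * m) := by rw [hs']; ring
      linarith
    have h8 := poisson_tail_le (t := (s * m).toNNReal) hε hε1
      (x := (1 + ε) * (s * m)) (by rw [Real.coe_toNNReal _ hsm])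
    rw [Real.coe_toNNReal _ hsm] at h8
    have h9 : poissonMeasure (s * m).toNNReal {n : ℕ | n ≤ ⌊s' * m⌋₊ - 1}ᶜ
        ≤ ENNReal.ofReal (Real.exp (-(ε ^ 2 / 4 * (s * m)))) := (measure_mono hc).trans h8
    rw [tsub_le_iff_right]
    calc 1 = w m + poissonMeasure (s * m).toNNReal {n : ℕ | n ≤ ⌊s' * m⌋₊ - 1}ᶜ :=
          (prob_add_prob_compl (MeasurableSet.of_discrete)).symm
      _ ≤ _ := by gcongr
  calc ENNReal.ofReal (k / s') ≤ liminf w atTop * liminf v atTop := by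
        rw [h3.liminf_eq, one_mul]
        exact h2
    _ ≤ liminf (w * v) atTop := ENNReal.le_liminf_mul
    _ ≤ _ := liminf_le_liminf (Eventually.of_forall h1)

/-- The free area at scale `s` is about `κ / s`, whose integral is logarithmic. The intermediate
constants absorb three losses: `κ₃` the convergence of `κ'`, `κ₂` the Poisson factor `1 + 2ε`, `κ₁`
the lower limit in `m`. -/
theorem exists_eventually_le_lintegral_freeArea (hD : ∀ m, (X m).IsDartSequence μ (D m)) {κ κ₁ : ℝ}
    (hκ : IsScaleInvariant X μ D κ) (h1 : 0 < κ₁) (hlt : κ₁ < κ) :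
    ∃ a : ℝ, 0 < a ∧ ∀ b, a < b → ∀ᶠ m : ℕ in atTop,
      ENNReal.ofReal (κ₁ * Real.log (b / a) * m)
        ≤ ∫⁻ t in Set.Ioc (a * m) (b * m), poissonExp μ (D m) t.toNNReal (X m).freeArea := by
  obtain ⟨κ', hκ', hlim⟩ := hκ
  obtain ⟨κ₂, h12, h2⟩ := exists_between hlt
  obtain ⟨κ₃, h23, h3⟩ := exists_between h2
  have h20 : 0 < κ₂ := h1.trans h12
  obtain ⟨ε, hε, hε1, hε2⟩ : ∃ ε : ℝ, 0 < ε ∧ ε ≤ 1 ∧ κ₂ * (1 + 2 * ε) ≤ κ₃ := by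
    refine ⟨min 1 ((κ₃ - κ₂) / (2 * κ₂)), lt_min one_pos (by
      have : 0 < κ₃ - κ₂ := by linarith
      positivity), min_le_left _ _, ?_⟩
    have h4 := min_le_right (1 : ℝ) ((κ₃ - κ₂) / (2 * κ₂))
    rw [le_div_iff₀ (by positivity)] at h4
    linarith
  obtain ⟨r0, hr0⟩ := (hlim.eventually (lt_mem_nhds h3)).exists_forall_of_atTop
  set a := max r0 1 with ha
  have ha0 : 0 < a := lt_of_lt_of_le one_pos (le_max_right _ _)
  refine ⟨a, ha0, fun b hab => ?_⟩
  have hlog : 0 < Real.log (b / a) := Real.log_pos ((one_lt_div ha0).2 hab)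
  have hpt : ∀ s ∈ Set.Ioc a b, ENNReal.ofReal (κ₂ * s⁻¹)
      ≤ liminf (fun m : ℕ => poissonExp μ (D m) (s * m).toNNReal (X m).freeArea) atTop := by
    intro s hs
    have hs0 : 0 < s := ha0.trans hs.1
    have hs' : s ≤ (1 + 2 * ε) * s := by nlinarith
    refine le_trans (ENNReal.ofReal_le_ofReal ?_)
      (le_liminf_poissonExp_freeArea hD hs0 hε hε1 (hκ' _ (hs0.trans_le hs')))
    have h5 : κ₃ ≤ κ' ((1 + 2 * ε) * s) :=
      (hr0 _ (((le_max_left _ _).trans hs.1.le).trans hs')).le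
    rw [le_div_iff₀ (hs0.trans_le hs')]
    calc κ₂ * s⁻¹ * ((1 + 2 * ε) * s) = κ₂ * (1 + 2 * ε) := by field_simp
      _ ≤ _ := hε2.trans h5
  have hmeas : ∀ m : ℕ, Measurable fun s : ℝ =>
      poissonExp μ (D m) (s * m).toNNReal (X m).freeArea := by
    intro m
    refine Antitone.measurable fun s s' hss => ?_
    exact poissonExp_antitone (X m).freeArea_append_le
      (Real.toNNReal_le_toNNReal (mul_le_mul_of_nonneg_right hss (Nat.cast_nonneg m)))
  have hJ : ENNReal.ofReal (κ₂ * Real.log (b / a)) ≤ liminf (fun m : ℕ => ∫⁻ s in Set.Ioc a b,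
      poissonExp μ (D m) (s * m).toNNReal (X m).freeArea) atTop := by
    refine le_trans (le_of_eq ?_) ((setLIntegral_mono' measurableSet_Ioc hpt).trans
      (lintegral_liminf_le hmeas))
    have hcont : ContinuousOn (fun s : ℝ => κ₂ * s⁻¹) (Set.Icc a b) :=
      continuousOn_const.mul (continuousOn_inv₀.mono fun s hs => ne_of_gt (ha0.trans_le hs.1))
    rw [← ofReal_integral_eq_lintegral_ofReal
      (hcont.integrableOn_Icc.mono_set Set.Ioc_subset_Icc_self),
      ← intervalIntegral.integral_of_le hab.le, intervalIntegral.integral_const_mul,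
      integral_inv_of_pos ha0 (ha0.trans hab)]
    filter_upwards [ae_restrict_mem measurableSet_Ioc] with s hs
    exact mul_nonneg h20.le (inv_nonneg.2 (ha0.trans hs.1).le)
  have hlt' : ENNReal.ofReal (κ₁ * Real.log (b / a)) < ENNReal.ofReal (κ₂ * Real.log (b / a)) :=
    (ENNReal.ofReal_lt_ofReal_iff (by positivity)).2 (mul_lt_mul_of_pos_right h12 hlog)
  filter_upwards [eventually_lt_of_lt_liminf (hlt'.trans_le hJ), eventually_gt_atTop 0] with m hm h0
  have hm0 : (0 : ℝ) < m := by exact_mod_cast h0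
  rw [setLIntegral_Ioc_mul hm0, ENNReal.ofReal_mul (by positivity), mul_comm]
  gcongr

/-- The memory lower bound for linearizable scale-invariant schemes. -/
theorem eventually_le_natEntropy (hD : ∀ m, (X m).IsDartSequence μ (D m))
    (hX : ∀ m, (X m).IsLinearizable) {κ A : ℝ} (hκ : IsScaleInvariant X μ D κ)
    (hA0 : 0 < A) (hA : A < κ * natH0) :
    ∀ᶠ m : ℕ in atTop, ENNReal.ofReal (A * m) ≤ ⨆ n, natEntropy ((X m).state (D m) n) μ := by
  have hH := natH0_pos
  obtain ⟨A₁, hA1, hA1'⟩ := exists_between hA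
  set κ₁ := A₁ / natH0 with hκ1
  have hκ10 : 0 < κ₁ := div_pos (hA0.trans hA1) hH
  have hκ1H : κ₁ * natH0 = A₁ := div_mul_cancel₀ _ hH.ne'
  have hκ1lt : κ₁ < κ := (div_lt_iff₀ hH).2 hA1'
  obtain ⟨a, ha0, hab⟩ := exists_eventually_le_lintegral_freeArea hD hκ hκ10 hκ1lt
  obtain ⟨A₂, hA2, hA2'⟩ := exists_between hA1
  -- The window is so long on the logarithmic scale that the gain `(A₁ - A₂) log(b/a)` outweighs the
  -- boundary terms.
  obtain ⟨b, hb, hlog⟩ : ∃ b, a < b ∧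
      A₂ * (Real.log (b / a) + 9) + natH0 * a < A₁ * Real.log (b / a) := by
    set L := (A₂ * 9 + natH0 * a) / (A₁ - A₂) + 1 with hL
    have hd : 0 < A₁ - A₂ := by linarith
    have hA20 : 0 < A₂ := hA0.trans hA2
    have hL0 : 0 < L := by positivity
    refine ⟨a * Real.exp L, lt_mul_of_one_lt_right ha0 (Real.one_lt_exp_iff.2 hL0), ?_⟩
    rw [mul_div_cancel_left₀ _ ha0.ne', Real.log_exp]
    have : (A₁ - A₂) * L = A₂ * 9 + natH0 * a + (A₁ - A₂) := by
      rw [hL]; field_simp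
    nlinarith
  have hb0 : 0 < b := ha0.trans hb
  have hL0 : 0 < Real.log (b / a) := Real.log_pos ((one_lt_div ha0).2 hb)
  -- Up to time `b m` the entropy of the Poisson count is then at most `(A₂ - A) m`: half from `δ
  -- t`, half from `K` for large `m`.
  set δ := (A₂ - A) / (2 * b) with hδ
  have hδ0 : 0 < δ := div_pos (by linarith) (by positivity)
  obtain ⟨K, hK0, hK⟩ := exists_poisson_entropy_le hδ0
  filter_upwards [hab b hb, eventually_gt_atTop 0,
    tendsto_natCast_atTop_atTop.eventually_ge_atTop (K / ((A₂ - A) / 2))] with m hm h0 hmK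
  have hm0 : (0 : ℝ) < m := by exact_mod_cast h0
  have hKm : K ≤ (A₂ - A) / 2 * m := by
    rw [div_le_iff₀ (by linarith)] at hmK
    linarith
  -- If the memory were below `A m`, the integrated bound would hold with `M = A₂ m`, against the
  -- choice of `b`.
  by_contra hcon
  rw [not_le] at hcon
  have hmain := (hX m).lintegral_freeArea_le (hD m) (a := a * m) (b := b * m) (by positivity)
    (by gcongr) (M := ENNReal.ofReal (A₂ * m)) (by
      intro t hat htb
      refine (add_le_add (hK _) hcon.le).trans ?_
      rw [Real.coe_toNNReal t (le_trans (by positivity) hat),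
        ← ENNReal.ofReal_add (by
          have : 0 ≤ t := le_trans (by positivity) hat
          positivity) (by positivity)]
      refine ENNReal.ofReal_le_ofReal ?_
      have h5 : δ * t ≤ (A₂ - A) / 2 * m := by
        calc δ * t ≤ δ * (b * m) := by gcongr
          _ = _ := by rw [hδ]; field_simp
      linarith)
  have h6 := (mul_le_mul_right hm (ENNReal.ofReal natH0)).trans hmain
  have hdiv : b * m / (a * m) = b / a := mul_div_mul_right _ _ hm0.ne'
  have hA20 : 0 < A₂ := hA0.trans hA2
  rw [hdiv, ← ENNReal.ofReal_mul hH.le, ← ENNReal.ofReal_mul (by positivity),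
    show (9 : ℝ≥0∞) = ENNReal.ofReal 9 by norm_num, ← ENNReal.ofReal_mul (by norm_num),
    ← ENNReal.ofReal_add (by positivity) (by positivity),
    ← ENNReal.ofReal_add (by positivity) (by positivity),
    ENNReal.ofReal_le_ofReal_iff (by positivity)] at h6
  have h7 : natH0 * (κ₁ * Real.log (b / a) * m) = A₁ * Real.log (b / a) * m := by
    rw [← hκ1H]; ring
  rw [h7] at h6
  have h8 := mul_lt_mul_of_pos_right hlog hm0
  nlinarith

end DartboardSketch

end Scheme

/-! ### Martingales driven by the darts -/

/-- The sum of the increments `δ`, which depend on the previous darts and the current one. -/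
def dartMart {C Ω : Type*} (δ : List C → C → ℝ) (D : ℕ → Ω → C) (n : ℕ) (ω : Ω) : ℝ :=
  ∑ i ∈ Finset.range n, δ (darts D i ω) (D i ω)

section Martingale

variable {C Ω : Type*} {δ : List C → C → ℝ} {D : ℕ → Ω → C} {B : ℝ}

theorem dartMart_succ (n : ℕ) (ω : Ω) :
    dartMart δ D (n + 1) ω = dartMart δ D n ω + δ (darts D n ω) (D n ω) :=
  Finset.sum_range_succ _ _

theorem exists_dartMart_eq (hB0 : 0 ≤ B) (hB : ∀ l c, |δ l c| ≤ B) (D : ℕ → Ω → C) (n : ℕ) :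
    ∃ G : List C → ℝ, (∀ l, |G l| ≤ n * B) ∧ ∀ ω, dartMart δ D n ω = G (darts D n ω) := by
  -- Missing entries of short lists count as `0`. They do not occur for `darts D n ω`, but the bound
  -- is required for every list.
  refine ⟨fun l => ∑ i ∈ Finset.range n, (l[i]?).elim 0 (δ (l.take i)), fun l => ?_, fun ω => ?_⟩
  · refine (Finset.abs_sum_le_sum_abs _ _).trans ?_
    refine (Finset.sum_le_card_nsmul _ _ B fun i _ => ?_).trans (by simp)
    cases l[i]? with
    | none => simpa using hB0
    | some c => exact hB _ _
  · refine Finset.sum_congr rfl fun i hi => ?_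
    have hi : i < n := Finset.mem_range.1 hi
    have h1 : (darts D n ω)[i]? = some (D i ω) := by simp [darts, hi]
    have h2 : (darts D n ω).take i = darts D i ω := by
      simp [darts, ← List.map_take, List.take_range, min_eq_left hi.le]
    simp [h1, h2]

theorem abs_dartMart_le (hB0 : 0 ≤ B) (hB : ∀ l c, |δ l c| ≤ B) (n : ℕ) (ω : Ω) :
    |dartMart δ D n ω| ≤ n * B := by
  obtain ⟨G, hG, h⟩ := exists_dartMart_eq hB0 hB D n
  rw [h]
  exact hG _

variable [MeasurableSpace C] [MeasurableSingletonClass C] [Countable C]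
  [MeasurableSpace Ω] {μ : Measure Ω} [IsProbabilityMeasure μ] {X : DartboardSketch C}

theorem measurable_dartMart (hD : ∀ k, Measurable (D k)) (n : ℕ) : Measurable (dartMart δ D n) := by
  refine Finset.measurable_sum _ fun i _ => ?_
  exact ((isDiscreteRV_darts hD i).prodMk
    (isDiscreteRV_of_measurable (hD i))).measurable_comp fun q => δ q.1 q.2

theorem integrable_dartMart_pow (hD : ∀ k, Measurable (D k)) (hB0 : 0 ≤ B)
    (hB : ∀ l c, |δ l c| ≤ B) (n k : ℕ) : Integrable (fun ω => dartMart δ D n ω ^ k) μ := by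
  refine Integrable.of_bound ((measurable_dartMart hD n).pow_const k).aestronglyMeasurable
    ((n * B) ^ k) (ae_of_all _ fun ω => ?_)
  rw [norm_pow, Real.norm_eq_abs]
  exact pow_le_pow_left₀ (abs_nonneg _) (abs_dartMart_le hB0 hB n ω) k

theorem integral_dartMart_pow_mul (hD : X.IsDartSequence μ D) (hB0 : 0 ≤ B)
    (hB : ∀ l c, |δ l c| ≤ B) (hmart : ∀ l, ∑' c, (X.area c).toReal * δ l c = 0) (n k : ℕ) :
    ∫ ω, dartMart δ D n ω ^ k * δ (darts D n ω) (D n ω) ∂μ = 0 := by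
  obtain ⟨G, hG, h⟩ := exists_dartMart_eq hB0 hB D n
  simp_rw [h]
  have hbound : ∀ l c, |G l ^ k * δ l c| ≤ (n * B) ^ k * B := by
    intro l c
    rw [abs_mul, abs_pow]
    have := pow_le_pow_left₀ (abs_nonneg _) (hG l) k
    exact mul_le_mul this (hB l c) (abs_nonneg _) (by positivity)
  rw [hD.integral_next n (fun l c => G l ^ k * δ l c) hbound]
  have : ∀ l, ∑' c, (X.area c).toReal * (G l ^ k * δ l c) = 0 := by
    intro l
    have e : ∀ c, (X.area c).toReal * (G l ^ k * δ l c)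
        = G l ^ k * ((X.area c).toReal * δ l c) := fun c => by ring
    simp_rw [e]
    rw [tsum_mul_left, hmart, mul_zero]
  simp [this]

theorem integrable_increment (hD : X.IsDartSequence μ D) (hB : ∀ l c, |δ l c| ≤ B) (n k : ℕ) :
    Integrable (fun ω => δ (darts D n ω) (D n ω) ^ k) μ := by
  refine Integrable.of_bound ?_ (B ^ k) (ae_of_all _ fun ω => ?_)
  · exact (((isDiscreteRV_darts hD.measurable n).prodMk
      (isDiscreteRV_of_measurable (hD.measurable n))).measurable_comp
        fun q => δ q.1 q.2 ^ k).aestronglyMeasurable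
  · rw [norm_pow, Real.norm_eq_abs]
    exact pow_le_pow_left₀ (abs_nonneg _) (hB _ _) k

theorem integrable_dartMart_pow_mul (hD : X.IsDartSequence μ D) (hB0 : 0 ≤ B)
    (hB : ∀ l c, |δ l c| ≤ B) (n k : ℕ) :
    Integrable (fun ω => dartMart δ D n ω ^ k * δ (darts D n ω) (D n ω)) μ := by
  refine (integrable_dartMart_pow hD.measurable hB0 hB n k).mul_bdd (c := B) ?_
    (ae_of_all _ fun ω => hB _ _)
  simpa using (integrable_increment hD hB n 1).aestronglyMeasurable

theorem integral_dartMart (hD : X.IsDartSequence μ D) (hB0 : 0 ≤ B)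
    (hB : ∀ l c, |δ l c| ≤ B) (hmart : ∀ l, ∑' c, (X.area c).toReal * δ l c = 0) (n : ℕ) :
    ∫ ω, dartMart δ D n ω ∂μ = 0 := by
  induction n with
  | zero => simp [dartMart]
  | succ n ih =>
    have h1 := integrable_dartMart_pow (μ := μ) hD.measurable hB0 hB n 1
    have h2 := integrable_dartMart_pow_mul hD hB0 hB n 0
    have h3 := integral_dartMart_pow_mul hD hB0 hB hmart n 0
    simp only [pow_one] at h1
    simp only [pow_zero, one_mul] at h2 h3
    simp_rw [dartMart_succ]
    rw [integral_add h1 h2, ih, h3, add_zero]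

theorem integral_dartMart_sq (hD : X.IsDartSequence μ D) (hB0 : 0 ≤ B)
    (hB : ∀ l c, |δ l c| ≤ B) (hmart : ∀ l, ∑' c, (X.area c).toReal * δ l c = 0) (n : ℕ) :
    ∫ ω, dartMart δ D n ω ^ 2 ∂μ = ∑ i ∈ Finset.range n,
      ∫ ω, ∑' c, (X.area c).toReal * δ (darts D i ω) c ^ 2 ∂μ := by
  induction n with
  | zero => simp [dartMart]
  | succ n ih =>
    have e : ∀ ω, dartMart δ D (n + 1) ω ^ 2 = dartMart δ D n ω ^ 2
        + 2 * (dartMart δ D n ω ^ 1 * δ (darts D n ω) (D n ω))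
        + δ (darts D n ω) (D n ω) ^ 2 := fun ω => by rw [dartMart_succ]; ring
    have h1 := integrable_dartMart_pow (μ := μ) hD.measurable hB0 hB n 2
    have h2 := (integrable_dartMart_pow_mul hD hB0 hB n 1).const_mul 2
    have h3 := integrable_increment hD hB n 2
    have hsq : ∀ l c, |δ l c ^ 2| ≤ B ^ 2 := fun l c => by
      rw [abs_pow]
      exact pow_le_pow_left₀ (abs_nonneg _) (hB l c) 2
    have h12 : Integrable (fun ω => dartMart δ D n ω ^ 2
        + 2 * (dartMart δ D n ω ^ 1 * δ (darts D n ω) (D n ω))) μ := h1.add h2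
    simp_rw [e]
    rw [integral_add h12 h3, integral_add h1 h2, integral_const_mul,
      integral_dartMart_pow_mul hD hB0 hB hmart, ih, mul_zero, add_zero, Finset.sum_range_succ,
      hD.integral_next n (fun l c => δ l c ^ 2) hsq]

theorem integral_dartMart_sq_le (hD : X.IsDartSequence μ D) (hB0 : 0 ≤ B)
    (hB : ∀ l c, |δ l c| ≤ B) (hmart : ∀ l, ∑' c, (X.area c).toReal * δ l c = 0) (n : ℕ) :
    ∫ ω, dartMart δ D n ω ^ 2 ∂μ ≤ n * B ^ 2 := by
  rw [integral_dartMart_sq hD hB0 hB hmart]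
  refine (Finset.sum_le_card_nsmul _ _ (B ^ 2) fun i _ => ?_).trans (by simp)
  have hsq : ∀ l c, |δ l c ^ 2| ≤ B ^ 2 := fun l c => by
    rw [abs_pow]
    exact pow_le_pow_left₀ (abs_nonneg _) (hB l c) 2
  have hb : ∀ ω, ‖∑' c, (X.area c).toReal * δ (darts D i ω) c ^ 2‖ ≤ B ^ 2 := fun ω =>
    abs_tsum_area_mul_le X.area (hsq _)
  have := norm_integral_le_of_norm_le_const (μ := μ) (ae_of_all _ hb)
  simp only [probReal_univ, mul_one] at this
  exact (le_abs_self _).trans this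

/-- In `(M + d)⁴` the term `4M³d` has mean zero and `4Md³ ≤ 2M²d² + 2d⁴`. With `E M² ≤ nB²` the
increase is at most `(8n + 3)B⁴`, less than `4((n + 1)² - n²)B⁴`. -/
theorem integral_dartMart_four_le (hD : X.IsDartSequence μ D) (hB0 : 0 ≤ B)
    (hB : ∀ l c, |δ l c| ≤ B) (hmart : ∀ l, ∑' c, (X.area c).toReal * δ l c = 0) (n : ℕ) :
    ∫ ω, dartMart δ D n ω ^ 4 ∂μ ≤ 4 * n ^ 2 * B ^ 4 := by
  induction n with
  | zero => simp [dartMart]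
  | succ n ih =>
    have hle : ∀ ω, dartMart δ D (n + 1) ω ^ 4 ≤ dartMart δ D n ω ^ 4
        + 4 * (dartMart δ D n ω ^ 3 * δ (darts D n ω) (D n ω))
        + (8 * B ^ 2 * dartMart δ D n ω ^ 2 + 3 * B ^ 4) := by
      intro ω
      rw [dartMart_succ]
      set M := dartMart δ D n ω
      set d := δ (darts D n ω) (D n ω)
      have hd : d ^ 2 ≤ B ^ 2 := sq_le_sq' (abs_le.1 (hB _ _)).1 (abs_le.1 (hB _ _)).2
      have h1 : M ^ 2 * d ^ 2 ≤ M ^ 2 * B ^ 2 := mul_le_mul_of_nonneg_left hd (sq_nonneg M)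
      have h2 : (d ^ 2) ^ 2 ≤ (B ^ 2) ^ 2 := pow_le_pow_left₀ (sq_nonneg d) hd 2
      have h3 : 2 * (M * d ^ 3) ≤ M ^ 2 * d ^ 2 + (d ^ 2) ^ 2 := by
        nlinarith [sq_nonneg (M * d - d ^ 2)]
      nlinarith
    have h1 := integrable_dartMart_pow (μ := μ) hD.measurable hB0 hB n 4
    have h2 := (integrable_dartMart_pow_mul hD hB0 hB n 3).const_mul 4
    have h3 := (integrable_dartMart_pow (μ := μ) hD.measurable hB0 hB n 2).const_mul (8 * B ^ 2)
    have h4 : Integrable (fun _ : Ω => 3 * B ^ 4) μ := integrable_const _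
    refine (integral_mono (integrable_dartMart_pow (μ := μ) hD.measurable hB0 hB (n + 1) 4)
      ((h1.add h2).add (h3.add h4)) hle).trans ?_
    rw [integral_add' (h1.add h2) (h3.add h4), integral_add' h1 h2, integral_add' h3 h4,
      integral_const_mul, integral_const_mul, integral_dartMart_pow_mul hD hB0 hB hmart]
    have h5 := integral_dartMart_sq_le hD hB0 hB hmart n
    have h6 : 8 * B ^ 2 * ∫ ω, dartMart δ D n ω ^ 2 ∂μ ≤ 8 * B ^ 2 * (n * B ^ 2) := by gcongr
    have h7 : 0 ≤ B ^ 4 := by positivity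
    simp only [integral_const, probReal_univ, smul_eq_mul, one_mul, mul_zero, add_zero]
    push_cast
    nlinarith

/-- A variance lower bound for a random variable that agrees with a shifted martingale on a
likely event. -/
theorem le_evariance_of_eq_dartMart (hD : X.IsDartSequence μ D) (hB0 : 0 < B)
    (hB : ∀ l c, |δ l c| ≤ B) (hmart : ∀ l, ∑' c, (X.area c).toReal * δ l c = 0) {n : ℕ}
    (hn : 0 < n) {Y : Ω → ℝ} {G : Set Ω} (hG : MeasurableSet G) (x : ℝ)
    (hY : ∀ ω ∈ G, Y ω = x + dartMart δ D n ω) (hq : μ.real Gᶜ ≤ 1 / 2) {η : ℝ} (hη : 0 < η) :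
    ENNReal.ofReal ((∫ ω, dartMart δ D n ω ^ 2 ∂μ)
        - 2 * (n * B ^ 2 * (μ.real Gᶜ / η + 4 * η))) ≤ evariance Y μ := by
  set M := dartMart δ D n with hM
  -- The mean of `Y` is not controlled off `G`. The argument works for any centre `b`: the second
  -- moment of `M - b` exceeds that of `M` by `b²`, and this surplus pays for the `b²` lost on the
  -- complement of `G`.
  set b := μ[Y] - x with hb
  have hn0 : (0 : ℝ) < n := by exact_mod_cast hn
  have hM1 : Integrable M μ := by
    simpa using integrable_dartMart_pow (μ := μ) hD.measurable hB0.le hB n 1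
  have hM2 : Integrable (fun ω => M ω ^ 2) μ :=
    integrable_dartMart_pow hD.measurable hB0.le hB n 2
  have hM4 : Integrable (fun ω => M ω ^ 4) μ :=
    integrable_dartMart_pow hD.measurable hB0.le hB n 4
  have hM0 : ∫ ω, M ω ∂μ = 0 := integral_dartMart hD hB0.le hB hmart n
  have hI : Integrable (fun ω => (M ω - b) ^ 2) μ := by
    have e : (fun ω => (M ω - b) ^ 2) = fun ω => M ω ^ 2 - 2 * b * M ω + b ^ 2 := by
      funext ω; ring
    rw [e]
    exact (hM2.sub (hM1.const_mul _)).add (integrable_const _)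
  have htot : ∫ ω, (M ω - b) ^ 2 ∂μ = ∫ ω, M ω ^ 2 ∂μ + b ^ 2 := by
    have e : (fun ω => (M ω - b) ^ 2) = fun ω => M ω ^ 2 - 2 * b * M ω + b ^ 2 := by
      funext ω; ring
    have h12 : Integrable (fun ω => M ω ^ 2 - 2 * b * M ω) μ := hM2.sub (hM1.const_mul _)
    rw [e, integral_add h12 (integrable_const _),
      integral_sub hM2 (hM1.const_mul _), integral_const_mul, hM0]
    simp
  have hsmall : ∫ ω in Gᶜ, M ω ^ 2 ∂μ ≤ n * B ^ 2 * (μ.real Gᶜ / η + 4 * η) := by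
    -- `M² ≤ T + M⁴/T` trades the small probability of the complement of `G` against the fourth
    -- moment, with `η` as the free parameter.
    set T := n * B ^ 2 / η with hT
    have hT0 : 0 < T := by positivity
    have hpt : ∀ ω, M ω ^ 2 ≤ T + T⁻¹ * M ω ^ 4 := by
      intro ω
      have h1 : 0 ≤ T⁻¹ * (M ω ^ 2 - T) ^ 2 := by positivity
      have h2 : T⁻¹ * (M ω ^ 2 - T) ^ 2 = T⁻¹ * M ω ^ 4 - 2 * M ω ^ 2 + T := by
        field_simp
        ring
      nlinarith [sq_nonneg (M ω)]
    have hi : Integrable (fun ω => T + T⁻¹ * M ω ^ 4) μ :=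
      (integrable_const T).add (hM4.const_mul _)
    calc ∫ ω in Gᶜ, M ω ^ 2 ∂μ ≤ ∫ ω in Gᶜ, (T + T⁻¹ * M ω ^ 4) ∂μ :=
          integral_mono hM2.integrableOn hi.integrableOn hpt
      _ = T * μ.real Gᶜ + T⁻¹ * ∫ ω in Gᶜ, M ω ^ 4 ∂μ := by
          rw [integral_add (integrable_const T).integrableOn (hM4.const_mul _).integrableOn,
            integral_const_mul]
          simp [mul_comm]
      _ ≤ T * μ.real Gᶜ + T⁻¹ * (4 * n ^ 2 * B ^ 4) := by
          gcongr
          exact (setIntegral_le_integral hM4 (ae_of_all _ fun ω => by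
            have : M ω ^ 4 = (M ω ^ 2) ^ 2 := by ring
            simp only [Pi.zero_apply]
            rw [this]
            positivity)).trans (integral_dartMart_four_le hD hB0.le hB hmart n)
      _ = _ := by
          rw [hT]
          field_simp
  have hbad : ∫ ω in Gᶜ, (M ω - b) ^ 2 ∂μ ≤ 2 * (∫ ω in Gᶜ, M ω ^ 2 ∂μ) + 2 * b ^ 2 * μ.real Gᶜ := by
    have hi : Integrable (fun ω => 2 * M ω ^ 2 + 2 * b ^ 2) μ :=
      (hM2.const_mul 2).add (integrable_const _)
    calc ∫ ω in Gᶜ, (M ω - b) ^ 2 ∂μ ≤ ∫ ω in Gᶜ, (2 * M ω ^ 2 + 2 * b ^ 2) ∂μ :=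
          integral_mono hI.integrableOn hi.integrableOn
            fun ω => by simp only; nlinarith [sq_nonneg (M ω + b)]
      _ = _ := by
          rw [integral_add (hM2.const_mul 2).integrableOn (integrable_const _).integrableOn,
            integral_const_mul]
          simp [mul_comm]
  have hgood : ∫ ω, M ω ^ 2 ∂μ - 2 * (n * B ^ 2 * (μ.real Gᶜ / η + 4 * η))
      ≤ ∫ ω in G, (M ω - b) ^ 2 ∂μ := by
    have h1 := integral_add_compl hG hI
    have h2 : 2 * b ^ 2 * μ.real Gᶜ ≤ b ^ 2 := by nlinarith [sq_nonneg b]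
    linarith
  calc _ ≤ ENNReal.ofReal (∫ ω in G, (M ω - b) ^ 2 ∂μ) := ENNReal.ofReal_le_ofReal hgood
    _ = ∫⁻ ω in G, ENNReal.ofReal ((M ω - b) ^ 2) ∂μ :=
        ofReal_integral_eq_lintegral_ofReal hI.integrableOn (ae_of_all _ fun ω => sq_nonneg _)
    _ = ∫⁻ ω in G, ENNReal.ofReal ((Y ω - μ[Y]) ^ 2) ∂μ := by
        refine setLIntegral_congr_fun hG fun ω hω => ?_
        rw [hY ω hω, hb]
        congr 2
        ring
    _ ≤ ∫⁻ ω, ENNReal.ofReal ((Y ω - μ[Y]) ^ 2) ∂μ := setLIntegral_le_lintegral _ _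
    _ = evariance Y μ := (evariance_eq_lintegral_ofReal Y μ).symm

end Martingale

/-! ### The stopped martingale estimator and its conditional variance -/

namespace DartboardSketch

section Increment

variable {C Ω : Type*} (X : DartboardSketch C)

open Classical in
/-- The increments of the martingale estimator, recentered and stopped as soon as the probability
of a change of state is below `ε`. -/
noncomputable def estimatorIncr (ε : ℝ) (l : List C) (c : C) : ℝ :=
  if ε ≤ (X.freeArea l).toReal then
    (if c ∈ X.run l then 0 else 1 / (X.freeArea l).toReal) - 1 else 0

open Classical in
/-- The conditional variance of the next increment of the stopped estimator. -/
noncomputable def estimatorVar (ε : ℝ) (l : List C) : ℝ :=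
  if ε ≤ (X.freeArea l).toReal then 1 / (X.freeArea l).toReal - 1 else 0

theorem freeArea_toReal_le_one (l : List C) : (X.freeArea l).toReal ≤ 1 :=
  ENNReal.toReal_mono ENNReal.one_ne_top (X.freeArea_le_one l)

open Classical in
theorem hasSum_freeArea (l : List C) :
    HasSum (fun c => (X.area c).toReal * if c ∈ X.run l then (0 : ℝ) else 1)
      (X.freeArea l).toReal := by
  have h1 : ∀ c, X.area c * (if c ∈ X.run l then (0 : ℝ≥0∞) else 1) ≠ ∞ := fun c => by
    split_ifs
    · simp
    · simpa using X.area.apply_ne_top c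
  have h2 := ENNReal.summable_toReal (f := fun c => X.area c * if c ∈ X.run l then (0 : ℝ≥0∞) else 1)
    (X.freeArea_ne_top l)
  have h3 := h2.hasSum
  rw [← ENNReal.tsum_toReal_eq h1] at h3
  refine h3.congr_fun fun c => ?_
  split_ifs <;> simp

theorem estimatorVar_nonneg {ε : ℝ} (hε : 0 < ε) (l : List C) : 0 ≤ X.estimatorVar ε l := by
  rw [estimatorVar]
  split_ifs with h
  · have h1 := X.freeArea_toReal_le_one l
    have h2 : 1 ≤ 1 / (X.freeArea l).toReal := by rwa [le_div_iff₀ (hε.trans_le h), one_mul]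
    linarith
  · exact le_rfl

theorem abs_estimatorIncr_le {ε : ℝ} (hε : 0 < ε) (hε1 : ε ≤ 1) (l : List C) (c : C) :
    |X.estimatorIncr ε l c| ≤ 1 / ε := by
  have h0 : 1 ≤ 1 / ε := by rwa [le_div_iff₀ hε, one_mul]
  rw [estimatorIncr]
  split_ifs with h hc
  · simpa using h0
  · have h1 := X.freeArea_toReal_le_one l
    have h2 : 1 ≤ 1 / (X.freeArea l).toReal := by rwa [le_div_iff₀ (hε.trans_le h), one_mul]
    have h3 : 1 / (X.freeArea l).toReal ≤ 1 / ε := one_div_le_one_div_of_le hε h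
    rw [abs_of_nonneg (by linarith)]
    linarith
  · simp only [abs_zero]
    linarith

theorem tsum_area_mul_estimatorIncr {ε : ℝ} (hε : 0 < ε) (l : List C) :
    ∑' c, (X.area c).toReal * X.estimatorIncr ε l c = 0 := by
  classical
  by_cases h : ε ≤ (X.freeArea l).toReal
  · have hP := hε.trans_le h
    have h1 := ((X.hasSum_freeArea l).mul_right (1 / (X.freeArea l).toReal)).sub
      (sum_area_toReal X.area)
    rw [mul_one_div_cancel hP.ne', sub_self] at h1
    rw [← h1.tsum_eq]
    refine tsum_congr fun c => ?_
    simp only [estimatorIncr, if_pos h]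
    split_ifs <;> ring
  · simp [estimatorIncr, h]

theorem tsum_area_mul_estimatorIncr_sq {ε : ℝ} (hε : 0 < ε) (l : List C) :
    ∑' c, (X.area c).toReal * X.estimatorIncr ε l c ^ 2 = X.estimatorVar ε l := by
  classical
  by_cases h : ε ≤ (X.freeArea l).toReal
  · have hP := hε.trans_le h
    set P := (X.freeArea l).toReal with hPdef
    have h1 := ((X.hasSum_freeArea l).mul_right (1 / P ^ 2 - 2 / P)).add
      (sum_area_toReal X.area)
    have h2 : P * (1 / P ^ 2 - 2 / P) + 1 = X.estimatorVar ε l := by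
      rw [estimatorVar, if_pos (by rwa [← hPdef]), ← hPdef]
      field_simp
      ring
    rw [← hPdef, h2] at h1
    rw [← h1.tsum_eq]
    refine tsum_congr fun c => ?_
    simp only [estimatorIncr, ← hPdef, if_pos h]
    split_ifs <;> ring
  · simp [estimatorIncr, estimatorVar, h]

theorem freeArea_darts_antitone (D : ℕ → Ω → C) (ω : Ω) :
    Antitone fun n => (X.freeArea (darts D n ω)).toReal := by
  refine antitone_nat_of_succ_le fun n => ?_
  rw [darts_succ]
  exact ENNReal.toReal_mono (X.freeArea_ne_top _) (X.freeArea_append_le _ _)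

theorem martingaleEstimator_eq {ε : ℝ} {D : ℕ → Ω → C} {ω : Ω} (n : ℕ)
    (h : ∀ i < n, ε ≤ (X.freeArea (darts D i ω)).toReal) :
    X.martingaleEstimator D n ω = n + dartMart (X.estimatorIncr ε) D n ω := by
  classical
  induction n with
  | zero => simp [martingaleEstimator, dartMart]
  | succ n ih =>
    have ih' := ih fun i hi => h i (by omega)
    rw [martingaleEstimator] at ih' ⊢
    rw [Finset.sum_Icc_succ_top (by omega), ih', dartMart_succ, estimatorIncr,
      if_pos (h n (by omega)), stateChangeProb]
    simp only [Nat.add_sub_cancel, state_eq, darts_succ, run_append]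
    rw [changeProb_run]
    have h1 := X.step_run_ne_iff (darts D n ω) (D n ω)
    by_cases hc : D n ω ∈ X.run (darts D n ω)
    · rw [if_neg (fun hne => h1.1 hne hc), if_pos hc]
      push_cast
      ring
    · rw [if_pos (h1.2 hc), if_neg hc]
      push_cast
      ring

variable [MeasurableSpace C] [MeasurableSingletonClass C] [Countable C]
  [MeasurableSpace Ω] {μ : Measure Ω} [IsProbabilityMeasure μ] {D : ℕ → Ω → C}

theorem ofReal_integral_estimator_sq (hD : X.IsDartSequence μ D) {ε : ℝ} (hε : 0 < ε)
    (hε1 : ε ≤ 1) (n : ℕ) :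
    ENNReal.ofReal (∫ ω, dartMart (X.estimatorIncr ε) D n ω ^ 2 ∂μ)
      = ∑ i ∈ Finset.range n, ∫⁻ ω, ENNReal.ofReal (X.estimatorVar ε (darts D i ω)) ∂μ := by
  rw [integral_dartMart_sq hD (by positivity) (X.abs_estimatorIncr_le hε hε1)
    (X.tsum_area_mul_estimatorIncr hε)]
  simp_rw [X.tsum_area_mul_estimatorIncr_sq hε]
  rw [ENNReal.ofReal_sum_of_nonneg fun i _ =>
    integral_nonneg fun ω => X.estimatorVar_nonneg hε _]
  refine Finset.sum_congr rfl fun i _ => ofReal_integral_eq_lintegral_ofReal ?_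
    (ae_of_all _ fun ω => X.estimatorVar_nonneg hε _)
  refine Integrable.of_bound ((isDiscreteRV_darts hD.measurable i).measurable_comp
    (X.estimatorVar ε)).aestronglyMeasurable (1 / ε) (ae_of_all _ fun ω => ?_)
  rw [Real.norm_eq_abs, abs_of_nonneg (X.estimatorVar_nonneg hε _), estimatorVar]
  split_ifs with h
  · have := one_div_le_one_div_of_le hε h
    linarith
  · positivity

end Increment

end DartboardSketch

/-- A finite sum as an integral of a step function. -/
theorem sum_range_eq_lintegral_floor (a : ℕ → ℝ≥0∞) (n : ℕ) :
    ∑ i ∈ Finset.range n, a i = ∫⁻ x in Set.Ioc (1 : ℝ) (n + 1), a (⌊x⌋₊ - 1) := by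
  -- Changing the endpoints does not affect the integral, and the floor is constant on each `[n + 1,
  -- n + 2)`.
  rw [restrict_Ico_eq_restrict_Ioc.symm]
  induction n with
  | zero => simp
  | succ n ih =>
    have hd : Set.Ico (1 : ℝ) ((n + 1 : ℕ) + 1)
        = Set.Ico 1 ((n : ℝ) + 1) ∪ Set.Ico ((n : ℝ) + 1) ((n : ℝ) + 1 + 1) := by
      rw [Set.Ico_union_Ico_eq_Ico (by simp) (by simp)]
      push_cast
      rfl
    rw [Finset.sum_range_succ, ih, hd, lintegral_union measurableSet_Ico
      (Set.Ico_disjoint_Ico_same)]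
    congr 1
    rw [setLIntegral_congr_fun (g := fun _ => a n) measurableSet_Ico]
    · simp
    · intro x hx
      have : ⌊x⌋₊ = n + 1 := by
        rw [Nat.floor_eq_iff (le_trans (by positivity) hx.1)]
        push_cast
        exact hx
      simp [this]

/-! ### Lower bounds for the variance and the memory-variance product -/

section Scheme

variable {C : ℕ → Type*} [∀ m, Countable (C m)] [∀ m, MeasurableSpace (C m)]
  [∀ m, MeasurableSingletonClass (C m)] {Ω : Type*} [MeasurableSpace Ω] {μ : Measure Ω}
  [IsProbabilityMeasure μ] {X : ∀ m, DartboardSketch (C m)} {D : ∀ m, ℕ → Ω → C m}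

namespace DartboardSketch

/-- Convergence of the probability of a change of state at the scale `s`. -/
theorem tendsto_measureReal_freeArea_lt (hD : ∀ m, (X m).IsDartSequence μ (D m)) {s k ε : ℝ}
    (hs : 0 < s) (hε : ε < k / s)
    (h : ∀ᵐ ω ∂μ, Tendsto (fun m : ℕ => s * (X m).stateChangeProb (D m) ⌊s * m⌋₊ ω) atTop (𝓝 k)) :
    Tendsto (fun m : ℕ => μ.real
      {ω | ε ≤ ((X m).freeArea (darts (D m) (⌊s * m⌋₊ - 1) ω)).toReal}ᶜ) atTop (𝓝 0) := by
  have hmeas : ∀ m : ℕ, MeasurableSet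
      {ω | ε ≤ ((X m).freeArea (darts (D m) (⌊s * m⌋₊ - 1) ω)).toReal}ᶜ := fun m =>
    (measurableSet_le measurable_const
      ((isDiscreteRV_darts (hD m).measurable _).measurable_comp
        fun l => ((X m).freeArea l).toReal)).compl
  have := tendsto_measure_of_ae_tendsto_indicator_of_isFiniteMeasure (μ := μ) (L := atTop)
    (A := ∅) MeasurableSet.empty hmeas (by
      filter_upwards [h] with ω hω
      have h1 := (hω.div_const s).eventually (lt_mem_nhds hε)
      filter_upwards [h1] with m hm
      rw [stateChangeProb, state_eq, changeProb_run, mul_div_cancel_left₀ _ hs.ne'] at hm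
      simp only [Set.mem_compl_iff, Set.mem_ofPred_eq, not_le, Set.mem_empty_iff_false, iff_false,
        not_lt]
      exact hm.le)
  rw [measure_empty] at this
  simpa [Measure.real, Function.comp_def] using (ENNReal.tendsto_toReal ENNReal.zero_ne_top).comp this

/-- As `ε < k / s`, almost surely the stopping is eventually inactive at this scale; Fatou's lemma
does the rest. -/
theorem le_liminf_lintegral_estimatorVar (hD : ∀ m, (X m).IsDartSequence μ (D m)) {s k ε : ℝ}
    (hs : 0 < s) (hε0 : 0 < ε) (hε : ε < k / s)
    (h : ∀ᵐ ω ∂μ, Tendsto (fun m : ℕ => s * (X m).stateChangeProb (D m) ⌊s * m⌋₊ ω) atTop (𝓝 k)) :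
    ENNReal.ofReal (s / k - 1) ≤ liminf (fun m : ℕ => ∫⁻ ω,
      ENNReal.ofReal ((X m).estimatorVar ε (darts (D m) (⌊s * m⌋₊ - 1) ω)) ∂μ) atTop := by
  have hm : ∀ m : ℕ, Measurable fun ω =>
      ENNReal.ofReal ((X m).estimatorVar ε (darts (D m) (⌊s * m⌋₊ - 1) ω)) :=
    fun m => (isDiscreteRV_darts (hD m).measurable _).measurable_comp
      fun l => ENNReal.ofReal ((X m).estimatorVar ε l)
  refine le_trans (le_of_eq ?_) (lintegral_liminf_le hm)
  rw [lintegral_congr_ae (g := fun _ => ENNReal.ofReal (s / k - 1))]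
  · simp
  filter_upwards [h] with ω hω
  have h1 := hω.div_const s
  have h2 := (((tendsto_const_nhds (x := (1 : ℝ))).div h1 (hε0.trans hε).ne').sub_const 1)
  rw [one_div_div] at h2
  refine Tendsto.liminf_eq ((ENNReal.tendsto_ofReal h2).congr' ?_)
  filter_upwards [h1.eventually (lt_mem_nhds hε)] with m hm
  simp only [Pi.div_apply]
  rw [stateChangeProb, state_eq, changeProb_run, mul_div_cancel_left₀ _ hs.ne'] at hm ⊢
  rw [estimatorVar, if_pos hm.le]

/-- The sum of conditional variances is `m` times an integral over scales whose lower limit is at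
least `∫ (s/κ₂ - 1) ds` over `(s₀, r]`. The threshold `κ₁/(2r)` is half the lower bound `κ₁/r` for
the limiting free area on this range. -/
theorem eventually_le_integral_estimator_sq (hD : ∀ m, (X m).IsDartSequence μ (D m))
    {κ' : ℝ → ℝ} {s₀ r κ₁ κ₂ A : ℝ} (h1 : 0 < κ₁) (h12 : κ₁ ≤ κ₂) (hs0 : 0 < s₀) (hκs : κ₂ ≤ s₀)
    (hs : s₀ ≤ r) (hr : κ₁ / (2 * r) ≤ 1)
    (hκ : ∀ s, s₀ ≤ s → κ₁ ≤ κ' s ∧ κ' s ≤ κ₂)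
    (hlim : ∀ s : ℝ, 0 < s → ∀ᵐ ω ∂μ,
      Tendsto (fun m : ℕ => s * (X m).stateChangeProb (D m) ⌊s * m⌋₊ ω) atTop (𝓝 (κ' s)))
    (hA : 0 ≤ A) (hAlt : A < (r ^ 2 - s₀ ^ 2) / (2 * κ₂) - (r - s₀)) :
    ∀ᶠ m : ℕ in atTop, A * m
      ≤ ∫ ω, dartMart ((X m).estimatorIncr (κ₁ / (2 * r))) (D m) ⌊r * m⌋₊ ω ^ 2 ∂μ := by
  have hr0 : 0 < r := hs0.trans_le hs
  have h20 : 0 < κ₂ := h1.trans_le h12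
  set ε := κ₁ / (2 * r) with hε
  have hε0 : 0 < ε := by positivity
  set a : ℕ → ℕ → ℝ≥0∞ := fun m i =>
    ∫⁻ ω, ENNReal.ofReal ((X m).estimatorVar ε (darts (D m) i ω)) ∂μ with ha
  have hpt : ∀ s ∈ Set.Ioc s₀ r, ENNReal.ofReal (s / κ₂ - 1)
      ≤ liminf (fun m : ℕ => a m (⌊s * m⌋₊ - 1)) atTop := by
    intro s hsr
    have hsp : 0 < s := hs0.trans hsr.1
    obtain ⟨hk1, hk2⟩ := hκ s hsr.1.le
    have hεs : ε < κ' s / s := by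
      rw [hε, div_lt_div_iff₀ (by positivity) hsp]
      have := hsr.2
      nlinarith
    refine le_trans (ENNReal.ofReal_le_ofReal ?_)
      (le_liminf_lintegral_estimatorVar hD hsp hε0 hεs (hlim s hsp))
    gcongr
    exact h1.trans_le hk1
  have hmeas : ∀ m : ℕ, Measurable fun s : ℝ => a m (⌊s * m⌋₊ - 1) := fun m =>
    (measurable_from_top (f := fun n : ℕ => a m (n - 1))).comp
      (Nat.measurable_floor.comp (measurable_id.mul_const _))
  have hJ : ENNReal.ofReal ((r ^ 2 - s₀ ^ 2) / (2 * κ₂) - (r - s₀)) ≤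
      liminf (fun m : ℕ => ∫⁻ s in Set.Ioc s₀ r, a m (⌊s * m⌋₊ - 1)) atTop := by
    refine le_trans (le_of_eq ?_) ((setLIntegral_mono' measurableSet_Ioc hpt).trans
      (lintegral_liminf_le hmeas))
    have hcont : Continuous (fun s : ℝ => s / κ₂ - 1) := by fun_prop
    rw [← ofReal_integral_eq_lintegral_ofReal
      (hcont.integrableOn_Icc.mono_set Set.Ioc_subset_Icc_self),
      ← intervalIntegral.integral_of_le hs, intervalIntegral.integral_sub
        (by apply Continuous.intervalIntegrable; fun_prop) (by simp),
      intervalIntegral.integral_div, integral_id]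
    · congr 1
      simp
      field_simp
    · filter_upwards [ae_restrict_mem measurableSet_Ioc] with s hsr
      have : 1 ≤ s / κ₂ := by
        rw [le_div_iff₀ h20, one_mul]
        exact hκs.trans hsr.1.le
      simp only [Pi.zero_apply]
      linarith
  have hlt' := (ENNReal.ofReal_lt_ofReal_iff_of_nonneg hA).2 hAlt
  filter_upwards [eventually_lt_of_lt_liminf (hlt'.trans_le hJ), eventually_gt_atTop 0,
    tendsto_natCast_atTop_atTop.eventually_ge_atTop (1 / s₀)] with m hm h0 hms
  have hm0 : (0 : ℝ) < m := by exact_mod_cast h0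
  rw [div_le_iff₀ hs0] at hms
  rw [← ENNReal.ofReal_le_ofReal_iff (integral_nonneg fun ω => sq_nonneg _),
    (X m).ofReal_integral_estimator_sq (hD m) hε0 hr, sum_range_eq_lintegral_floor (a m)]
  calc ENNReal.ofReal (A * m) = ENNReal.ofReal m * ENNReal.ofReal A := by
        rw [mul_comm, ENNReal.ofReal_mul hm0.le]
    _ ≤ ENNReal.ofReal m * ∫⁻ s in Set.Ioc s₀ r, a m (⌊s * m⌋₊ - 1) := by gcongr
    _ = ∫⁻ x in Set.Ioc (s₀ * m) (r * m), a m (⌊x⌋₊ - 1) :=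
        (setLIntegral_Ioc_mul hm0 s₀ r fun x => a m (⌊x⌋₊ - 1)).symm
    _ ≤ _ := by
        refine lintegral_mono_set (Set.Ioc_subset_Ioc ?_ (Nat.lt_floor_add_one _).le)
        linarith

theorem eventually_le_evariance (hD : ∀ m, (X m).IsDartSequence μ (D m))
    {κ' : ℝ → ℝ} {s₀ r κ₁ κ₂ A : ℝ} (h1 : 0 < κ₁) (h12 : κ₁ ≤ κ₂) (hs0 : 0 < s₀) (hκs : κ₂ ≤ s₀)
    (hs : s₀ ≤ r) (hκ : ∀ s, s₀ ≤ s → κ₁ ≤ κ' s ∧ κ' s ≤ κ₂)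
    (hlim : ∀ s : ℝ, 0 < s → ∀ᵐ ω ∂μ,
      Tendsto (fun m : ℕ => s * (X m).stateChangeProb (D m) ⌊s * m⌋₊ ω) atTop (𝓝 (κ' s)))
    (hA : 0 ≤ A) (hAlt : A < (r ^ 2 - s₀ ^ 2) / (2 * κ₂) - (r - s₀)) :
    ∀ᶠ m : ℕ in atTop, ENNReal.ofReal (A * m)
      ≤ evariance ((X m).martingaleEstimator (D m) ⌊r * m⌋₊) μ := by
  have hr0 : 0 < r := hs0.trans_le hs
  have h20 : 0 < κ₂ := h1.trans_le h12
  have hr : κ₁ / (2 * r) ≤ 1 := by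
    rw [div_le_one (by positivity)]
    linarith
  obtain ⟨A', hAA', hA'⟩ := exists_between hAlt
  have hE := eventually_le_integral_estimator_sq hD h1 h12 hs0 hκs hs hr hκ hlim
    (hA.trans hAA'.le) hA'
  set ε := κ₁ / (2 * r) with hε
  have hε0 : 0 < ε := by positivity
  have hεr : ε < κ' r / r := by
    rw [hε, div_lt_div_iff₀ (by positivity) hr0]
    have := (hκ r hs).1
    nlinarith
  have hq := tendsto_measureReal_freeArea_lt hD hr0 hεr (hlim r hr0)
  set B := 1 / ε with hB
  have hB0 : 0 < B := by positivity
  set K := 2 * r * B ^ 2 with hK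
  have hK0 : 0 < K := by positivity
  -- Once the exceptional probability is below `4η²`, both error terms are at most `4η`, and the
  -- total loss is at most `(A' - A) m`.
  set η := (A' - A) / (8 * K) with hη
  have hη0 : 0 < η := div_pos (by linarith) (by positivity)
  have hq2 : ∀ᶠ m : ℕ in atTop, μ.real
      {ω | ε ≤ ((X m).freeArea (darts (D m) (⌊r * m⌋₊ - 1) ω)).toReal}ᶜ
        < min (1 / 2) (η * (4 * η)) :=
    hq.eventually (gt_mem_nhds (by positivity))
  filter_upwards [hE, hq2, eventually_gt_atTop 0,
    tendsto_natCast_atTop_atTop.eventually_ge_atTop (1 / r)] with m hm hqm h0 hmr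
  have hm0 : (0 : ℝ) < m := by exact_mod_cast h0
  rw [div_le_iff₀ hr0] at hmr
  have hn : 0 < ⌊r * m⌋₊ := Nat.floor_pos.2 (by linarith)
  have hmain := le_evariance_of_eq_dartMart (hD m) hB0 ((X m).abs_estimatorIncr_le hε0 hr)
    ((X m).tsum_area_mul_estimatorIncr hε0) hn
    (Y := (X m).martingaleEstimator (D m) ⌊r * m⌋₊)
    (G := {ω | ε ≤ ((X m).freeArea (darts (D m) (⌊r * m⌋₊ - 1) ω)).toReal})
    (measurableSet_le measurable_const
      ((isDiscreteRV_darts (hD m).measurable _).measurable_comp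
        fun l => ((X m).freeArea l).toReal)) (⌊r * m⌋₊ : ℝ)
    (fun ω hω => (X m).martingaleEstimator_eq _ fun i hi =>
      le_trans hω ((X m).freeArea_darts_antitone (D m) ω (by omega)))
    (hqm.le.trans (min_le_left _ _)) hη0
  refine le_trans (ENNReal.ofReal_le_ofReal ?_) hmain
  set Q := μ.real {ω | ε ≤ ((X m).freeArea (darts (D m) (⌊r * m⌋₊ - 1) ω)).toReal}ᶜ
  have h3 : Q / η ≤ 4 * η := by
    rw [div_le_iff₀ hη0]
    linarith [hqm.le.trans (min_le_right _ _)]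
  have h4 : (⌊r * m⌋₊ : ℝ) ≤ r * m := Nat.floor_le (by positivity)
  have h5 : 2 * (⌊r * m⌋₊ * B ^ 2 * (Q / η + 4 * η)) ≤ 2 * (r * m * B ^ 2 * (8 * η)) := by
    gcongr
    linarith
  have h6 : 2 * (r * m * B ^ 2 * (8 * η)) = (A' - A) * m := by
    rw [hη]
    have : 2 * (r * m * B ^ 2 * (8 * ((A' - A) / (8 * K)))) = K * ((A' - A) / K) * m := by
      rw [hK]; field_simp
    rw [this, mul_div_cancel₀ _ hK0.ne']
  linarith

/-- The variance lower bound for scale-invariant schemes. -/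
theorem eventually_le_relVariance (hD : ∀ m, (X m).IsDartSequence μ (D m)) {κ A : ℝ}
    (hκ : IsScaleInvariant X μ D κ) (hκ0 : 0 < κ) (hA0 : 0 ≤ A) (hA : A < 1 / (2 * κ)) :
    ∀ᶠ r : ℝ in atTop, ∀ᶠ m : ℕ in atTop,
      ENNReal.ofReal (A / m) ≤ (X m).relVariance μ (D m) ⌊r * m⌋₊ := by
  obtain ⟨κ', hlim, hκ'⟩ := hκ
  obtain ⟨κ₂, h2, hA2⟩ : ∃ κ₂, κ < κ₂ ∧ A * (2 * κ₂) < 1 := by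
    rw [lt_div_iff₀ (by positivity)] at hA
    have ht : Tendsto (fun x : ℝ => A * (2 * x)) (𝓝[>] κ) (𝓝 (A * (2 * κ))) :=
      ((continuous_const.mul (continuous_const.mul continuous_id)).tendsto κ).mono_left
        nhdsWithin_le_nhds
    obtain ⟨x, hx, hx'⟩ := ((ht.eventually (gt_mem_nhds hA)).and self_mem_nhdsWithin).exists
    exact ⟨x, hx', hx⟩
  have h20 : 0 < κ₂ := hκ0.trans h2
  obtain ⟨s, hs⟩ := ((hκ'.eventually (lt_mem_nhds (half_lt_self hκ0))).and
    (hκ'.eventually (gt_mem_nhds h2))).exists_forall_of_atTop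
  set s₀ := max s κ₂ with hs₀
  have hs0 : 0 < s₀ := h20.trans_le (le_max_right _ _)
  -- The coefficient of `r²` on the right is `1/(2κ₂) > A`; the remaining terms are of lower order.
  have hlarge : ∀ᶠ r : ℝ in atTop, A * r ^ 2 < (r ^ 2 - s₀ ^ 2) / (2 * κ₂) - (r - s₀) := by
    set d := 1 / (2 * κ₂) - A with hd
    have hd0 : 0 < d := by
      have : A < 1 / (2 * κ₂) := by rwa [lt_div_iff₀ (by positivity)]
      linarith
    filter_upwards [eventually_gt_atTop ((1 + s₀ ^ 2 / (2 * κ₂)) / d), eventually_ge_atTop 1]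
      with r hr hr1
    rw [div_lt_iff₀ hd0] at hr
    have e : (r ^ 2 - s₀ ^ 2) / (2 * κ₂) = r ^ 2 * (d + A) - s₀ ^ 2 / (2 * κ₂) := by
      rw [hd]; field_simp; ring
    rw [e]
    have h3 : 0 ≤ s₀ ^ 2 / (2 * κ₂) := by positivity
    nlinarith
  filter_upwards [hlarge, eventually_ge_atTop s₀] with r hr hrs
  have hr0 : 0 < r := hs0.trans_le hrs
  filter_upwards [eventually_le_evariance hD (half_pos hκ0) (by linarith) hs0 (le_max_right _ _) hrs
    (fun t ht => ⟨(hs t ((le_max_left _ _).trans ht)).1.le,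
      (hs t ((le_max_left _ _).trans ht)).2.le⟩) hlim (by positivity) hr,
    eventually_gt_atTop 0, tendsto_natCast_atTop_atTop.eventually_ge_atTop (1 / r)] with m hm h0 hmr
  have hm0 : (0 : ℝ) < m := by exact_mod_cast h0
  rw [div_le_iff₀ hr0] at hmr
  have hn : 0 < ⌊r * m⌋₊ := Nat.floor_pos.2 (by linarith)
  rw [relVariance, ENNReal.le_div_iff_mul_le (Or.inl (by simp [hn.ne']))
    (Or.inl (by finiteness))]
  refine le_trans ?_ hm
  rw [← ENNReal.ofReal_natCast, ← ENNReal.ofReal_pow (by positivity),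
    ← ENNReal.ofReal_mul (by positivity)]
  refine ENNReal.ofReal_le_ofReal ?_
  have h4 : (⌊r * m⌋₊ : ℝ) ≤ r * m := Nat.floor_le (by positivity)
  calc A / m * (⌊r * m⌋₊ : ℝ) ^ 2 ≤ A / m * (r * m) ^ 2 := by gcongr
    _ = A * r ^ 2 * m := by field_simp

theorem memory_eq {C Ω : Type*} [MeasurableSpace Ω] (X : DartboardSketch C) (μ : Measure Ω)
    [IsProbabilityMeasure μ] (D : ℕ → Ω → C) :
    X.memory μ D = ENNReal.ofReal (Real.log 2)⁻¹ * ⨆ n, natEntropy (X.state D n) μ := by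
  simp only [memory, entropy_eq_natEntropy, ENNReal.mul_iSup]

/-- The lower bound for the memory-variance product of linearizable, scale-invariant schemes. -/
theorem le_lowerLimitingMVP (hD : ∀ m, (X m).IsDartSequence μ (D m))
    (hX : ∀ m, (X m).IsLinearizable) {κ : ℝ} (hκ : IsScaleInvariant X μ D κ) (hκ0 : 0 < κ) :
    ENNReal.ofReal (fishmongerH0 / 2) ≤ lowerLimitingMVP X μ D := by
  have hH := natH0_pos
  have hlog : 0 < Real.log 2 := Real.log_pos one_lt_two
  -- Each of the two bounds is used with a loss factor `x`. The product of `κ natH0` and `1/(2κ)` no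
  -- longer contains `κ`, and `x` tends to one at the end.
  have key : ∀ x : ℝ, 0 < x → x < 1 → ENNReal.ofReal (x ^ 2 * (fishmongerH0 / 2))
      ≤ lowerLimitingMVP X μ D := by
    intro x hx hx1
    have hA : x * (κ * natH0) < κ * natH0 := mul_lt_of_lt_one_left (by positivity) hx1
    have hB : x * (1 / (2 * κ)) < 1 / (2 * κ) := mul_lt_of_lt_one_left (by positivity) hx1
    refine le_liminf_of_le (by isBoundedDefault) ?_
    filter_upwards [eventually_le_relVariance hD hκ hκ0 (by positivity) hB] with r hr
    refine le_liminf_of_le (by isBoundedDefault) ?_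
    filter_upwards [hr, eventually_le_natEntropy hD hX hκ (by positivity) hA,
      eventually_gt_atTop 0] with m hm1 hm2 h0
    have hm0 : (0 : ℝ) < m := by exact_mod_cast h0
    rw [mvp, memory_eq]
    refine le_trans (le_of_eq ?_) (mul_le_mul' (mul_le_mul_right hm2 _) hm1)
    rw [← ENNReal.ofReal_mul (by positivity), ← ENNReal.ofReal_mul (by positivity),
      fishmongerH0_eq]
    congr 1
    field_simp
  have ht : Tendsto (fun x : ℝ => ENNReal.ofReal (x ^ 2 * (fishmongerH0 / 2))) (𝓝[<] 1)
      (𝓝 (ENNReal.ofReal (1 ^ 2 * (fishmongerH0 / 2)))) :=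
    (ENNReal.tendsto_ofReal (((continuous_pow 2).mul continuous_const).tendsto 1)).mono_left
      nhdsWithin_le_nhds
  rw [one_pow, one_mul] at ht
  refine le_of_tendsto ht ?_
  filter_upwards [self_mem_nhdsWithin,
    nhdsWithin_le_nhds (lt_mem_nhds (zero_lt_one (α := ℝ)))] with x hx1 hx0
  exact key x hx0 hx1

end DartboardSketch

end Scheme

/-! ### Subadditivity of the entropy -/

/-- The pointwise Gibbs inequality `p log(ab/p) ≤ ab - p`, arranged without subtraction. For a joint
law `p` with marginals `a` and `b` the terms `p` and `ab` both sum to one and cancel. -/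
theorem enegMulLog_add_le_cross {p a b : ℝ≥0∞} (ha : p ≤ a) (hb : p ≤ b) (ha1 : a ≤ 1)
    (hb1 : b ≤ 1) : enegMulLog p + p ≤ p * ENNReal.ofReal (-Real.log a.toReal)
      + p * ENNReal.ofReal (-Real.log b.toReal) + a * b := by
  rcases eq_or_ne p 0 with h0 | h0
  · simp [h0, enegMulLog]
  have hat : a ≠ ∞ := ne_top_of_le_ne_top ENNReal.one_ne_top ha1
  have hbt : b ≠ ∞ := ne_top_of_le_ne_top ENNReal.one_ne_top hb1
  have hpt : p ≠ ∞ := ne_top_of_le_ne_top hat ha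
  have hp0 : 0 < p.toReal := ENNReal.toReal_pos h0 hpt
  have hpa : p.toReal ≤ a.toReal := ENNReal.toReal_mono hat ha
  have hpb : p.toReal ≤ b.toReal := ENNReal.toReal_mono hbt hb
  have ha1' : a.toReal ≤ 1 := by simpa using ENNReal.toReal_mono ENNReal.one_ne_top ha1
  have hb1' : b.toReal ≤ 1 := by simpa using ENNReal.toReal_mono ENNReal.one_ne_top hb1
  rw [enegMulLog, ← ENNReal.ofReal_toReal hat, ← ENNReal.ofReal_toReal hbt,
    ← ENNReal.ofReal_toReal hpt]
  simp only [ENNReal.toReal_ofReal ENNReal.toReal_nonneg]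
  set x := p.toReal
  set y := a.toReal
  set z := b.toReal
  have hy : 0 < y := hp0.trans_le hpa
  have hz : 0 < z := hp0.trans_le hpb
  have h1 : 0 ≤ -Real.log y := by linarith [Real.log_nonpos hy.le ha1']
  have h2 : 0 ≤ -Real.log z := by linarith [Real.log_nonpos hz.le hb1']
  rw [← ENNReal.ofReal_add (Real.negMulLog_nonneg hp0.le (hpa.trans ha1')) hp0.le,
    ← ENNReal.ofReal_mul hp0.le, ← ENNReal.ofReal_mul hp0.le, ← ENNReal.ofReal_mul hy.le,
    ← ENNReal.ofReal_add (by positivity) (by positivity),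
    ← ENNReal.ofReal_add (by positivity) (by positivity)]
  refine ENNReal.ofReal_le_ofReal ?_
  have h3 := Real.log_le_sub_one_of_pos (x := y * z / x) (by positivity)
  rw [Real.log_div (by positivity) hp0.ne', Real.log_mul hy.ne' hz.ne'] at h3
  have h4 := mul_le_mul_of_nonneg_left h3 hp0.le
  have h5 : x * (y * z / x - 1) = y * z - x := by field_simp
  rw [h5] at h4
  rw [Real.negMulLog]
  linarith

section Subadditivity

variable {Ω α β : Type*} [MeasurableSpace Ω] {μ : Measure Ω} [IsProbabilityMeasure μ]

/-- Subadditivity of the entropy. -/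
theorem natEntropy_prodMk_le {S : Ω → α} {T : Ω → β} (hS : IsDiscreteRV S) (hT : IsDiscreteRV T) :
    natEntropy (fun ω => (S ω, T ω)) μ ≤ natEntropy S μ + natEntropy T μ := by
  set p : α → β → ℝ≥0∞ := fun x y => μ (S ⁻¹' {x} ∩ T ⁻¹' {y}) with hp
  have hpre : ∀ x y, (fun ω => (S ω, T ω)) ⁻¹' {(x, y)} = S ⁻¹' {x} ∩ T ⁻¹' {y} := fun x y => by
    ext ω
    simp
  have hpx : ∀ x, ∑' y, p x y = μ (S ⁻¹' {x}) := fun x => by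
    simpa using (hT.measure_inter_preimage μ (S ⁻¹' {x}) Set.univ).symm
  have hpy : ∀ y, ∑' x, p x y = μ (T ⁻¹' {y}) := fun y => by
    have := (hS.measure_inter_preimage μ (T ⁻¹' {y}) Set.univ).symm
    simp only [Set.mem_univ, if_true, Set.preimage_univ, Set.inter_univ] at this
    rw [← this]
    exact tsum_congr fun x => by rw [hp, Set.inter_comm]
  have htot : ∑' x, ∑' y, p x y = 1 := by
    simp_rw [hpx]
    exact hS.tsum_measure μ
  have hent : natEntropy (fun ω => (S ω, T ω)) μ = ∑' x, ∑' y, enegMulLog (p x y) := by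
    rw [natEntropy, ENNReal.tsum_prod']
    simp_rw [hpre]
    rfl
  have hSx : ∑' x, ∑' y, p x y * ENNReal.ofReal (-Real.log (μ (S ⁻¹' {x})).toReal)
      = natEntropy S μ := by
    refine tsum_congr fun x => ?_
    rw [ENNReal.tsum_mul_right, hpx, enegMulLog_eq prob_le_one, mul_comm]
  have hTy : ∑' x, ∑' y, p x y * ENNReal.ofReal (-Real.log (μ (T ⁻¹' {y})).toReal)
      = natEntropy T μ := by
    rw [ENNReal.tsum_comm]
    refine tsum_congr fun y => ?_
    rw [ENNReal.tsum_mul_right, hpy, enegMulLog_eq prob_le_one, mul_comm]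
  have hprod : ∑' x, ∑' y, μ (S ⁻¹' {x}) * μ (T ⁻¹' {y}) = 1 := by
    simp_rw [ENNReal.tsum_mul_left, hT.tsum_measure μ, mul_one]
    exact hS.tsum_measure μ
  have h := ENNReal.tsum_le_tsum fun x => ENNReal.tsum_le_tsum fun y =>
    enegMulLog_add_le_cross (p := p x y) (measure_mono Set.inter_subset_left)
      (measure_mono Set.inter_subset_right) (prob_le_one (s := S ⁻¹' {x}))
      (prob_le_one (s := T ⁻¹' {y}))
  simp_rw [ENNReal.tsum_add] at h
  rw [htot, hSx, hTy, hprod, ← hent] at h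
  exact (ENNReal.add_le_add_iff_right ENNReal.one_ne_top).1 h

theorem natEntropy_mem {E : Set Ω} (hE : MeasurableSet E) :
    natEntropy (fun ω => ω ∈ E) μ = ENNReal.ofReal (Real.binEntropy (μ.real E)) := by
  have h1 : (fun ω => ω ∈ E) ⁻¹' {True} = E := by ext ω; simp
  have h2 : (fun ω => ω ∈ E) ⁻¹' {False} = Eᶜ := by ext ω; simp
  have h3 : μ.real E ≤ 1 := measureReal_le_one
  rw [natEntropy, tsum_fintype, Fintype.univ_Prop, Finset.sum_pair (by simp), h1, h2, enegMulLog,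
    enegMulLog, ← ENNReal.ofReal_add (Real.negMulLog_nonneg ENNReal.toReal_nonneg h3)
      (Real.negMulLog_nonneg ENNReal.toReal_nonneg measureReal_le_one),
    Real.binEntropy_eq_negMulLog_add_negMulLog_one_sub, ← probReal_compl_eq_one_sub hE]
  rfl

theorem IsDiscreteRV.natEntropy_inter_Iio_le {T : Ω → Set ℕ} (hT : IsDiscreteRV T) (k : ℕ) :
    natEntropy (fun ω => T ω ∩ Set.Iio k) μ
      ≤ ∑ i ∈ Finset.range k, ENNReal.ofReal (Real.binEntropy (μ.real {ω | i ∈ T ω})) := by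
  induction k with
  | zero =>
    have : ∀ ω, T ω ∩ Set.Iio 0 = ∅ := fun ω => by ext; simp
    simp_rw [this, Finset.range_zero, Finset.sum_empty, natEntropy]
    refine le_of_eq (ENNReal.tsum_eq_zero.2 fun s => ?_)
    by_cases hs : s = ∅
    · have h : (fun _ : Ω => (∅ : Set ℕ)) ⁻¹' {s} = Set.univ := by ext; simp [hs]
      rw [h]
      simp [enegMulLog]
    · have h : (fun _ : Ω => (∅ : Set ℕ)) ⁻¹' {s} = ∅ := by
        ext
        simp [Ne.symm hs]
      rw [h]
      simp [enegMulLog]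
  | succ k ih =>
    have h1 := (hT.comp fun A => A ∩ Set.Iio k).prodMk (hT.comp fun A => k ∈ A)
    have e : ∀ ω, T ω ∩ Set.Iio (k + 1) = (fun q : Set ℕ × Prop => q.1 ∪ {j | j = k ∧ q.2})
        (T ω ∩ Set.Iio k, k ∈ T ω) := by
      intro ω
      ext j
      simp only [Set.mem_inter_iff, Set.mem_Iio, Set.mem_union, Set.mem_ofPred_eq]
      rcases lt_trichotomy j k with h | h | h
      · simp [h, h.ne, h.trans (Nat.lt_succ_self k)]
      · subst h
        simp
      · simp [h.not_gt, h.ne']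
        omega
    simp_rw [e]
    refine (natEntropy_comp_le h1 fun q : Set ℕ × Prop => q.1 ∪ {j | j = k ∧ q.2}).trans ?_
    refine (natEntropy_prodMk_le (hT.comp fun A => A ∩ Set.Iio k) (hT.comp fun A => k ∈ A)).trans ?_
    rw [Finset.sum_range_succ]
    refine add_le_add ih (le_of_eq ?_)
    exact natEntropy_mem (hT.measurableSet_preimage {A | k ∈ A})

/-- The entropy of a finite random set of natural numbers is at most the sum of the entropies of its
indicators. -/
theorem IsDiscreteRV.natEntropy_set_le {T : Ω → Set ℕ} (hT : IsDiscreteRV T)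
    (hfin : ∀ ω, (T ω).Finite) :
    natEntropy T μ ≤ ∑' i, ENNReal.ofReal (Real.binEntropy (μ.real {ω | i ∈ T ω})) := by
  -- A finite set equals its truncation at all large `k`, so every atom's probability converges;
  -- Fatou's lemma for the counting measure then gives lower semicontinuity of the entropy.
  have hlim : ∀ s : Set ℕ, Tendsto
      (fun k : ℕ => enegMulLog (μ ((fun ω => T ω ∩ Set.Iio k) ⁻¹' {s}))) atTop
      (𝓝 (enegMulLog (μ (T ⁻¹' {s})))) := by
    intro s
    have h1 := tendsto_measure_of_ae_tendsto_indicator_of_isFiniteMeasure (μ := μ) (L := atTop)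
      (hT.measurable s) (fun k : ℕ => (hT.comp fun A => A ∩ Set.Iio k).measurable s)
      (ae_of_all _ fun ω => by
        obtain ⟨b, hb⟩ := (hfin ω).bddAbove
        filter_upwards [eventually_gt_atTop b] with k hk
        have : T ω ∩ Set.Iio k = T ω :=
          Set.inter_eq_left.2 fun j hj => lt_of_le_of_lt (hb hj) hk
        simp [this])
    have h2 := ((ENNReal.tendsto_toReal (measure_ne_top μ _)).comp h1)
    exact ENNReal.tendsto_ofReal ((Real.continuous_negMulLog.tendsto _).comp h2)
  let _ : MeasurableSpace (Set ℕ) := ⊤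
  have hf := lintegral_liminf_le (μ := Measure.count) (u := atTop) (f := fun (k : ℕ) (s : Set ℕ) =>
    enegMulLog (μ ((fun ω => T ω ∩ Set.Iio k) ⁻¹' {s}))) fun k => measurable_from_top
  rw [lintegral_count] at hf
  simp_rw [lintegral_count, fun s => (hlim s).liminf_eq] at hf
  refine hf.trans ?_
  refine liminf_le_of_le (by isBoundedDefault) fun b hb => ?_
  obtain ⟨k, hk⟩ := hb.exists
  exact hk.trans ((hT.natEntropy_inter_Iio_le k).trans (ENNReal.sum_le_tsum _))

end Subadditivity

/-! ### A Riemann sum for the entropy integral -/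

section Riemann

/-- Riemann sum for the integral of a unimodal function on a logarithmic scale. -/
theorem tsum_binEntropy_exp_neg_le {x : ℕ → ℝ} (hx : ∀ i, 0 < x i) (hlim : Tendsto x atTop (𝓝 0))
    {N : ℝ} (hN : 0 < N) (hratio : ∀ i, x (i + 1) * Real.exp (1 / N) ≤ x i) :
    ∑' i, ENNReal.ofReal (Real.binEntropy (Real.exp (-x i)))
      ≤ ENNReal.ofReal (N * natH0 + 2 * Real.log 2) := by
  set g : ℝ → ℝ := fun t => Real.binEntropy (Real.exp (-t)) with hg
  have hlog2 : 0 < Real.log 2 := Real.log_pos one_lt_two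
  have hanti : Antitone x := antitone_nat_of_succ_le fun i => by
    refine le_trans ?_ (hratio i)
    exact le_mul_of_one_le_right (hx _).le (Real.one_le_exp (by positivity))
  set b : ℕ → ℝ≥0∞ := fun i =>
    ENNReal.ofReal N * ∫⁻ t in Set.Ioc (x (i + 1)) (x i), ENNReal.ofReal (g t / t) with hb
  have hbsum : ∑' i, b i ≤ ENNReal.ofReal (N * natH0) := by
    have hdisj : Pairwise (Function.onFun Disjoint fun i => Set.Ioc (x (i + 1)) (x i)) :=
      hanti.pairwise_disjoint_on_Ioc_succ
    rw [hb, ENNReal.tsum_mul_left, ENNReal.ofReal_mul hN.le,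
      ← lintegral_iUnion (fun i => measurableSet_Ioc) hdisj]
    gcongr
    have h1 := lintegral_binEntropy_div one_pos
    simp only [one_mul] at h1
    rw [← h1]
    exact lintegral_mono_set (Set.iUnion_subset fun i t ht => (hx _).trans ht.1)
  -- The ratio hypothesis gives each interval logarithmic length at least `1/N`, which the factor
  -- `N` in `b` compensates.
  have hstep : ∀ i y, (∀ t ∈ Set.Ioc (x (i + 1)) (x i), y ≤ g t) → 0 ≤ y →
      ENNReal.ofReal y ≤ b i := by
    intro i y hy hy0
    have h1 : 1 / N ≤ Real.log (x i / x (i + 1)) := by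
      rw [Real.le_log_iff_exp_le (div_pos (hx _) (hx _)), le_div_iff₀ (hx _), mul_comm]
      exact hratio i
    have hle : x (i + 1) ≤ x i := hanti (Nat.le_succ i)
    calc ENNReal.ofReal y ≤ ENNReal.ofReal (N * (y * Real.log (x i / x (i + 1)))) := by
          refine ENNReal.ofReal_le_ofReal ?_
          calc y = N * (y * (1 / N)) := by field_simp
            _ ≤ _ := by gcongr
      _ = ENNReal.ofReal N * ∫⁻ t in Set.Ioc (x (i + 1)) (x i), ENNReal.ofReal (y * t⁻¹) := by
          rw [ENNReal.ofReal_mul hN.le]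
          congr 1
          have hcont : ContinuousOn (fun s : ℝ => y * s⁻¹) (Set.Icc (x (i + 1)) (x i)) :=
            continuousOn_const.mul
              (continuousOn_inv₀.mono fun s hs => ne_of_gt ((hx _).trans_le hs.1))
          rw [← ofReal_integral_eq_lintegral_ofReal
            (hcont.integrableOn_Icc.mono_set Set.Ioc_subset_Icc_self),
            ← intervalIntegral.integral_of_le hle, intervalIntegral.integral_const_mul,
            integral_inv_of_pos (hx _) (hx _)]
          filter_upwards [ae_restrict_mem measurableSet_Ioc] with s hs
          exact mul_nonneg hy0 (inv_nonneg.2 ((hx _).trans hs.1).le)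
      _ ≤ b i := by
          rw [hb]
          refine mul_le_mul_right (setLIntegral_mono' measurableSet_Ioc fun t ht => ?_) _
          refine ENNReal.ofReal_le_ofReal ?_
          rw [div_eq_mul_inv]
          exact mul_le_mul_of_nonneg_right (hy t ht) (inv_nonneg.2 ((hx _).trans ht.1).le)
  have hhalf : Real.exp (-Real.log 2) = 2⁻¹ := by rw [Real.exp_neg, Real.exp_log two_pos]
  -- The entropy `g` peaks at `log 2`, where `e^{-t} = 1/2`. On either side the smaller endpoint
  -- value on an interval is charged to that interval.
  have hlow : ∀ i, x i ≤ Real.log 2 → ENNReal.ofReal (g (x (i + 1))) ≤ b i := by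
    intro i hi
    refine hstep i _ (fun t ht => ?_) (binEntropy_exp_neg_nonneg (hx _).le)
    have h1 : 2⁻¹ ≤ Real.exp (-t) := by
      rw [← hhalf]
      exact Real.exp_le_exp.2 (by linarith [ht.2])
    have h2 : Real.exp (-t) ≤ Real.exp (-x (i + 1)) := Real.exp_le_exp.2 (by linarith [ht.1])
    have h3 : Real.exp (-x (i + 1)) ≤ 1 := Real.exp_le_one_iff.2 (by linarith [hx (i + 1)])
    exact Real.binEntropy_strictAntiOn.antitoneOn ⟨h1, h2.trans h3⟩ ⟨h1.trans h2, h3⟩ h2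
  have hhigh : ∀ i, Real.log 2 ≤ x (i + 1) → ENNReal.ofReal (g (x i)) ≤ b i := by
    intro i hi
    refine hstep i _ (fun t ht => ?_) (binEntropy_exp_neg_nonneg (hx _).le)
    have h1 : Real.exp (-t) ≤ 2⁻¹ := by
      rw [← hhalf]
      exact Real.exp_le_exp.2 (by linarith [ht.1])
    have h2 : Real.exp (-x i) ≤ Real.exp (-t) := Real.exp_le_exp.2 (by linarith [ht.2])
    exact Real.binEntropy_strictMonoOn.monotoneOn ⟨(Real.exp_pos _).le, h2.trans h1⟩
      ⟨(Real.exp_pos _).le, h1⟩ h2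
  have hmax : ∀ i, ENNReal.ofReal (g (x i)) ≤ ENNReal.ofReal (Real.log 2) := fun i =>
    ENNReal.ofReal_le_ofReal Real.binEntropy_le_log_two
  have hex : ∃ k, x k ≤ Real.log 2 := ((hlim.eventually (gt_mem_nhds hlog2)).mono
    fun k hk => hk.le).exists
  have key : ∀ k, x k ≤ Real.log 2 → ∑' i, ENNReal.ofReal (g (x (i + k)))
      ≤ ENNReal.ofReal (Real.log 2) + ∑' i, b (i + k) := by
    intro k hk
    rw [tsum_eq_zero_add' ENNReal.summable, zero_add]
    refine add_le_add (hmax k) (ENNReal.tsum_le_tsum fun i => ?_)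
    rw [show i + 1 + k = i + k + 1 by ring]
    exact hlow _ ((hanti (Nat.le_add_left k i)).trans hk)
  -- Only the two points around the peak are left without an interval of their own; each costs at
  -- most `log 2`. If `x 0` is already below the peak, one such point suffices.
  have hfinal : ∑' i, ENNReal.ofReal (g (x i))
      ≤ 2 * ENNReal.ofReal (Real.log 2) + ∑' i, b i := by
    classical
    rcases h : Nat.find hex with _ | k
    · have h0 : x 0 ≤ Real.log 2 := by
        have := Nat.find_spec hex
        rwa [h] at this
      refine (key 0 h0).trans ?_
      simp only [add_zero]
      gcongr
      rw [two_mul]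
      exact le_self_add
    · have h0 : x (k + 1) ≤ Real.log 2 := by
        have := Nat.find_spec hex
        rwa [h] at this
      have h1 : ∀ j ≤ k, Real.log 2 ≤ x j := fun j hj =>
        (not_le.1 (Nat.find_min hex (by omega))).le
      rw [← Summable.sum_add_tsum_nat_add' (f := fun i => ENNReal.ofReal (g (x i))) (k := k + 1)
        ENNReal.summable, ← Summable.sum_add_tsum_nat_add' (f := b) (k := k) ENNReal.summable,
        Finset.sum_range_succ]
      have h2 : ∑ i ∈ Finset.range k, ENNReal.ofReal (g (x i)) ≤ ∑ i ∈ Finset.range k, b i :=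
        Finset.sum_le_sum fun i hi => hhigh i (h1 _ (Finset.mem_range.1 hi))
      have h3 : ∑' i, b (i + (k + 1)) ≤ ∑' i, b (i + k) := by
        rw [tsum_eq_zero_add' (f := fun i => b (i + k)) ENNReal.summable]
        refine le_trans (le_of_eq (tsum_congr fun i => ?_)) le_add_self
        congr 1
        ring
      calc _ ≤ (∑ i ∈ Finset.range k, b i + ENNReal.ofReal (Real.log 2))
            + (ENNReal.ofReal (Real.log 2) + ∑' i, b (i + k)) := by
            exact add_le_add (add_le_add h2 (hmax k))
              ((key (k + 1) h0).trans (add_le_add le_rfl h3))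
        _ = _ := by ring
  refine hfinal.trans ?_
  rw [add_comm (N * natH0), ENNReal.ofReal_add (by positivity) (by have := natH0_pos; positivity),
    ENNReal.ofReal_mul two_pos.le, ENNReal.ofReal_ofNat]
  gcongr

end Riemann

/-! ### Sketches whose occupied cells are exactly those that have been hit, or were so initially -/

section HitSketch

variable {C Ω : Type*} {X : DartboardSketch C}

open Classical in
/-- The expected free area after `k` more darts, given that the darts `l` have been thrown. -/
noncomputable def meanFreeArea (X : DartboardSketch C) (k : ℕ) (l : List C) : ℝ :=
  ∑' d, (X.area d).toReal * if d ∈ X.run l then 0 else (1 - (X.area d).toReal) ^ k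

open Classical in
/-- The increments of the martingale of expected free areas after `n` darts. -/
noncomputable def meanFreeAreaIncr (X : DartboardSketch C) (n : ℕ) (l : List C) (c : C) : ℝ :=
  (∑' d, (X.area d).toReal * if d ∈ X.run l then 0 else
      (X.area d).toReal * (1 - (X.area d).toReal) ^ (n - (l.length + 1)))
    - if c ∈ X.run l then 0 else (X.area c).toReal * (1 - (X.area c).toReal) ^ (n - (l.length + 1))

theorem area_toReal_le_one (p : PMF C) (c : C) : (p c).toReal ≤ 1 := by
  simpa using ENNReal.toReal_mono ENNReal.one_ne_top (p.coe_le_one c)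

theorem meanFreeArea_zero (l : List C) : meanFreeArea X 0 l = (X.freeArea l).toReal := by
  classical
  rw [← (X.hasSum_freeArea l).tsum_eq, meanFreeArea]
  simp

/-- For a free cell `d` of area `p`, a dart elsewhere changes the survival probability from
`(1-p)^{k+1}` to `(1-p)^k`, a gain of `p(1-p)^k`; a dart in `d` removes it. -/
theorem meanFreeArea_append (hX : ∀ l c, c ∈ X.run l ↔ c ∈ l ∨ c ∈ X.init) {n : ℕ} {l : List C}
    (hl : l.length < n) (c : C) :
    meanFreeArea X (n - (l.length + 1)) (l ++ [c])
      = meanFreeArea X (n - l.length) l + meanFreeAreaIncr X n l c := by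
  classical
  obtain ⟨k, hk⟩ : ∃ k, n - (l.length + 1) = k := ⟨_, rfl⟩
  have hk' : n - l.length = k + 1 := by omega
  rw [meanFreeAreaIncr, hk, hk', meanFreeArea, meanFreeArea]
  have hp0 : ∀ d, 0 ≤ (X.area d).toReal := fun d => ENNReal.toReal_nonneg
  have hp1 : ∀ d, 0 ≤ 1 - (X.area d).toReal := fun d => by
    linarith [area_toReal_le_one X.area d]
  have hpow : ∀ d j, (1 - (X.area d).toReal) ^ j ≤ 1 := fun d j =>
    pow_le_one₀ (hp1 d) (by linarith [hp0 d])
  have s1 := (summable_area_mul X.area (B := 1)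
    (h := fun d => if d ∈ X.run l then 0 else (1 - (X.area d).toReal) ^ (k + 1)) (by
      intro d
      split_ifs
      · simp
      · rw [abs_of_nonneg (pow_nonneg (hp1 d) _)]
        exact hpow _ _)).hasSum
  have s2 := (summable_area_mul X.area (B := 1)
    (h := fun d => if d ∈ X.run l then 0 else (X.area d).toReal * (1 - (X.area d).toReal) ^ k) (by
      intro d
      split_ifs
      · simp
      · rw [abs_of_nonneg (mul_nonneg (hp0 d) (pow_nonneg (hp1 d) _))]
        exact mul_le_one₀ (area_toReal_le_one _ _) (pow_nonneg (hp1 d) _) (hpow _ _))).hasSum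
  have s3 := hasSum_ite_eq c (if c ∈ X.run l then 0 else
    (X.area c).toReal * (1 - (X.area c).toReal) ^ k)
  rw [add_sub, ← ((s1.add s2).sub s3).tsum_eq]
  refine tsum_congr fun d => ?_
  have hmem : d ∈ X.run (l ++ [c]) ↔ d ∈ X.run l ∨ d = c := by
    rw [hX, hX, List.mem_append, List.mem_singleton]
    tauto
  by_cases hd : d = c
  · subst hd
    rw [if_pos (hmem.2 (Or.inr rfl)), if_pos rfl]
    split_ifs <;> ring
  · simp only [hmem, hd, or_false, if_false]
    split_ifs <;> ring

/-- The increment is the mean minus the value at `c` of one function with values in `[0, B]`. -/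
theorem abs_meanFreeAreaIncr_le {B : ℝ} (hinit : ∀ l, X.init ⊆ X.run l) (hB0 : 0 ≤ B)
    (hB : ∀ c ∉ X.init, (X.area c).toReal ≤ B) (n : ℕ) (l : List C) (c : C) :
    |meanFreeAreaIncr X n l c| ≤ B := by
  classical
  rw [meanFreeAreaIncr]
  set k := n - (l.length + 1)
  have hp0 : ∀ d, 0 ≤ (X.area d).toReal := fun d => ENNReal.toReal_nonneg
  have hp1 : ∀ d, 0 ≤ 1 - (X.area d).toReal := fun d => by
    linarith [area_toReal_le_one X.area d]
  have hpow : ∀ d j, (1 - (X.area d).toReal) ^ j ≤ 1 := fun d j =>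
    pow_le_one₀ (hp1 d) (by linarith [hp0 d])
  have h1 : ∀ d, 0 ≤ (if d ∈ X.run l then 0 else (X.area d).toReal * (1 - (X.area d).toReal) ^ k) := by
    intro d
    split_ifs
    · exact le_rfl
    · exact mul_nonneg (hp0 d) (pow_nonneg (hp1 d) _)
  have h2 : ∀ d, (if d ∈ X.run l then 0 else (X.area d).toReal * (1 - (X.area d).toReal) ^ k)
      ≤ B := by
    intro d
    split_ifs with hd
    · exact hB0
    · exact (mul_le_of_le_one_right (hp0 d) (hpow d k)).trans (hB d fun h => hd (hinit l h))
  have h3 : 0 ≤ ∑' d, (X.area d).toReal *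
      if d ∈ X.run l then 0 else (X.area d).toReal * (1 - (X.area d).toReal) ^ k :=
    tsum_nonneg fun d => mul_nonneg (hp0 d) (h1 d)
  have h4 := abs_tsum_area_mul_le X.area fun d => (abs_of_nonneg (h1 d)).le.trans (h2 d)
  rw [abs_le]
  constructor
  · linarith [h2 c]
  · linarith [h1 c, le_abs_self (∑' d, (X.area d).toReal *
      if d ∈ X.run l then 0 else (X.area d).toReal * (1 - (X.area d).toReal) ^ k)]

theorem tsum_area_mul_meanFreeAreaIncr (n : ℕ) (l : List C) :
    ∑' c, (X.area c).toReal * meanFreeAreaIncr X n l c = 0 := by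
  classical
  have hp0 : ∀ d, 0 ≤ (X.area d).toReal := fun d => ENNReal.toReal_nonneg
  have hp1 : ∀ d, 0 ≤ 1 - (X.area d).toReal := fun d => by
    linarith [area_toReal_le_one X.area d]
  set k := n - (l.length + 1) with hk
  have s2 := (summable_area_mul X.area (B := 1)
    (h := fun d => if d ∈ X.run l then 0 else (X.area d).toReal * (1 - (X.area d).toReal) ^ k) (by
      intro d
      split_ifs
      · simp
      · rw [abs_of_nonneg (mul_nonneg (hp0 d) (pow_nonneg (hp1 d) _))]
        exact mul_le_one₀ (area_toReal_le_one _ _) (pow_nonneg (hp1 d) _)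
          (pow_le_one₀ (hp1 d) (by linarith [hp0 d])))).hasSum
  have h := ((sum_area_toReal X.area).mul_right (∑' d, (X.area d).toReal *
      if d ∈ X.run l then 0 else (X.area d).toReal * (1 - (X.area d).toReal) ^ k)).sub s2
  rw [one_mul, sub_self] at h
  rw [← h.tsum_eq]
  refine tsum_congr fun c => ?_
  rw [meanFreeAreaIncr, mul_sub]

variable [MeasurableSpace C] [MeasurableSingletonClass C] [MeasurableSpace Ω] {μ : Measure Ω}
  [IsProbabilityMeasure μ] {D : ℕ → Ω → C}

theorem DartboardSketch.IsDartSequence.measureReal_notMem_darts (hD : X.IsDartSequence μ D) (n : ℕ)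
    (c : C) : μ.real {ω | c ∉ darts D n ω} = (1 - (X.area c).toReal) ^ n := by
  have h1 : {ω | c ∉ darts D n ω} = ⋂ i ∈ Finset.range n, D i ⁻¹' {c}ᶜ := by
    ext ω
    simp [darts]
  have h2 : ∀ i, μ.real (D i ⁻¹' {c}ᶜ) = 1 - (X.area c).toReal := by
    intro i
    rw [Set.preimage_compl, probReal_compl_eq_one_sub (hD.measurable i (measurableSet_singleton c)),
      Measure.real, ← Measure.map_apply (hD.measurable i) (measurableSet_singleton c), hD.law i,
      PMF.toMeasure_apply_singleton _ _ (measurableSet_singleton c)]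
  rw [h1, Measure.real, hD.indep.measure_inter_preimage_eq_mul _
    (fun i _ => (measurableSet_singleton c).compl), ENNReal.toReal_prod]
  calc ∏ i ∈ Finset.range n, (μ (D i ⁻¹' {c}ᶜ)).toReal
      = ∏ _i ∈ Finset.range n, (1 - (X.area c).toReal) := Finset.prod_congr rfl fun i _ => h2 i
    _ = _ := by simp

variable [Countable C]

/-- The free area is concentrated around its mean. -/
theorem integral_freeArea_sub_mean_four_le (hD : X.IsDartSequence μ D)
    (hX : ∀ l c, c ∈ X.run l ↔ c ∈ l ∨ c ∈ X.init) {B : ℝ} (hB0 : 0 ≤ B)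
    (hB : ∀ c ∉ X.init, (X.area c).toReal ≤ B) (n : ℕ) :
    Integrable (fun ω => ((X.freeArea (darts D n ω)).toReal - meanFreeArea X n []) ^ 4) μ ∧
    ∫ ω, ((X.freeArea (darts D n ω)).toReal - meanFreeArea X n []) ^ 4 ∂μ ≤ 4 * n ^ 2 * B ^ 4 := by
  have hinit : ∀ l, X.init ⊆ X.run l := fun l c hc => (hX l c).2 (Or.inr hc)
  -- Doob's martingale of the final free area: it starts at the mean and at `i = n` equals the free
  -- area itself.
  have hmart : ∀ i ≤ n, ∀ ω, meanFreeArea X (n - i) (darts D i ω)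
      = meanFreeArea X n [] + dartMart (meanFreeAreaIncr X n) D i ω := by
    intro i
    induction i with
    | zero => simp [dartMart, darts_zero]
    | succ i ih =>
      intro hi ω
      have hlen := length_darts D i ω
      have h1 := meanFreeArea_append hX (n := n) (l := darts D i ω) (by omega) (D i ω)
      rw [hlen] at h1
      rw [darts_succ, h1, ih (by omega), dartMart_succ]
      ring
  have e : ∀ ω, ((X.freeArea (darts D n ω)).toReal - meanFreeArea X n [])
      = dartMart (meanFreeAreaIncr X n) D n ω := by
    intro ω
    have := hmart n le_rfl ω
    rw [Nat.sub_self, meanFreeArea_zero] at this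
    linarith
  simp_rw [e]
  exact ⟨integrable_dartMart_pow hD.measurable hB0 (abs_meanFreeAreaIncr_le hinit hB0 hB n) n 4,
    integral_dartMart_four_le hD hB0 (abs_meanFreeAreaIncr_le hinit hB0 hB n)
      (tsum_area_mul_meanFreeAreaIncr n) n⟩

end HitSketch

/-! ### The mean free area for areas in geometric progression -/

section GeometricMean

theorem pow_succ_sub_pow_succ_bounds {u v : ℝ} (hv : 0 ≤ v) (huv : v ≤ u) (n : ℕ) :
    (n + 1) * (u - v) * v ^ n ≤ u ^ (n + 1) - v ^ (n + 1) ∧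
      u ^ (n + 1) - v ^ (n + 1) ≤ (n + 1) * (u - v) * u ^ n := by
  induction n with
  | zero => simp
  | succ n ih =>
    have hd : 0 ≤ u - v := by linarith
    have hvn : 0 ≤ v ^ n := pow_nonneg hv n
    have hle : v ^ (n + 1) ≤ u ^ (n + 1) := pow_le_pow_left₀ hv huv _
    have e1 : u ^ (n + 1 + 1) - v ^ (n + 1 + 1)
        = u * (u ^ (n + 1) - v ^ (n + 1)) + (u - v) * v ^ (n + 1) := by ring
    push_cast
    rw [e1]
    constructor
    · have h1 : v * ((n + 1) * (u - v) * v ^ n) ≤ u * (u ^ (n + 1) - v ^ (n + 1)) :=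
        mul_le_mul huv ih.1 (by positivity) (hv.trans huv)
      calc _ = v * ((n + 1) * (u - v) * v ^ n) + (u - v) * v ^ (n + 1) := by ring
        _ ≤ _ := by linarith
    · have h1 := mul_le_mul_of_nonneg_left ih.2 (hv.trans huv)
      have h2 := mul_le_mul_of_nonneg_left hle hd
      calc _ ≤ u * ((n + 1) * (u - v) * u ^ n) + (u - v) * u ^ (n + 1) := by linarith
        _ = _ := by ring

/-- Bounds for the sum of `p (1 - p) ^ n` over a geometric progression. -/
theorem tsum_geometric_mul_pow_bounds {a ρ : ℝ} (ha : 0 < a) (ha1 : a ≤ 1) (hρ : 0 < ρ)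
    (hρ1 : ρ < 1) (n : ℕ) :
    (n + 1) * (1 - ρ) * ∑' i : ℕ, a * ρ ^ i * (1 - a * ρ ^ i) ^ n ≤ 1 - (1 - a) ^ (n + 1) ∧
    ρ * (1 - (1 - a) ^ (n + 1)) ≤
      (n + 1) * (1 - ρ) * ∑' i : ℕ, a * ρ ^ i * (1 - a * ρ ^ i) ^ n := by
  set p : ℕ → ℝ := fun i => a * ρ ^ i with hp
  have hp0 : ∀ i, 0 < p i := fun i => by positivity
  have hp1 : ∀ i, p i ≤ 1 := fun i => mul_le_one₀ ha1 (by positivity) (pow_le_one₀ hρ.le hρ1.le)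
  have hps : ∀ i, p (i + 1) = ρ * p i := fun i => by simp only [hp]; ring
  have hpa : ∀ i, p (i + 1) ≤ p i := fun i => by
    rw [hps]
    exact mul_le_of_le_one_left (hp0 i).le hρ1.le
  have hsummable : Summable fun i => p i * (1 - p i) ^ n := by
    refine Summable.of_nonneg_of_le (fun i => mul_nonneg (hp0 i).le
      (pow_nonneg (by linarith [hp1 i]) _)) (fun i => ?_)
      ((summable_geometric_of_lt_one hρ.le hρ1).mul_left a)
    exact mul_le_of_le_one_right (hp0 i).le
      (pow_le_one₀ (by linarith [hp1 i]) (by linarith [hp0 i]))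
  -- The differences of `(1 - p)^{n+1}` along the progression telescope. By the mean value bounds
  -- each is close to `(n+1)(1-ρ) p_i (1-p_i)^n`; the shift of index on one side costs a factor `ρ`.
  have htele : HasSum (fun i => (1 - p (i + 1)) ^ (n + 1) - (1 - p i) ^ (n + 1))
      (1 - (1 - a) ^ (n + 1)) := by
    rw [hasSum_iff_tendsto_nat_of_nonneg]
    · simp_rw [Finset.sum_range_sub fun i => (1 - p i) ^ (n + 1)]
      have h1 : Tendsto p atTop (𝓝 (a * 0)) :=
        (tendsto_pow_atTop_nhds_zero_of_lt_one hρ.le hρ1).const_mul a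
      have h2 := (((tendsto_const_nhds (x := (1 : ℝ))).sub h1).pow (n + 1)).sub_const
        ((1 - p 0) ^ (n + 1))
      simpa [hp] using h2
    · intro i
      rw [sub_nonneg]
      exact pow_le_pow_left₀ (by linarith [hp1 i]) (by linarith [hpa i]) _
  have hb := fun i => pow_succ_sub_pow_succ_bounds (u := 1 - p (i + 1)) (v := 1 - p i)
    (by linarith [hp1 i]) (by linarith [hpa i]) n
  have hd : ∀ i, 1 - p (i + 1) - (1 - p i) = (1 - ρ) * p i := fun i => by
    rw [hps]; ring
  constructor
  · have h1 := hsummable.hasSum.mul_left ((n + 1) * (1 - ρ))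
    refine hasSum_le (fun i => ?_) h1 htele
    refine le_trans (le_of_eq ?_) (hb i).1
    rw [hd]
    ring
  · have h2 := ((summable_nat_add_iff 1).2 hsummable).hasSum.mul_left ((n + 1) * (1 - ρ))
    have h3 := hasSum_le (fun i => ?_) (htele.mul_left ρ) h2
    · refine h3.trans ?_
      have h4 : 0 ≤ 1 - ρ := by linarith
      refine mul_le_mul_of_nonneg_left ?_ (by positivity)
      rw [hsummable.tsum_eq_zero_add]
      linarith [mul_nonneg (hp0 0).le (pow_nonneg (by linarith [hp1 0] : 0 ≤ 1 - p 0) n)]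
    · refine (mul_le_mul_of_nonneg_left (hb i).2 hρ.le).trans (le_of_eq ?_)
      rw [hd, hps]
      ring

/-- The limit of the mean free area of a geometric sketch. -/
theorem tendsto_tsum_geometric_mul_pow {q r : ℝ} (hq : 0 < q) (hq1 : q < 1) (hr : 0 < r) :
    Tendsto (fun m : ℕ => ∑' i : ℕ, q / m * Real.exp (-(1 / (m : ℝ))) ^ i
      * (1 - q / m * Real.exp (-(1 / (m : ℝ))) ^ i) ^ (⌊r * m⌋₊ - 1)) atTop
      (𝓝 ((1 - Real.exp (-(q * r))) / r)) := by
  have hinv : Tendsto (fun m : ℕ => 1 / (m : ℝ)) atTop (𝓝 0) := tendsto_one_div_atTop_nhds_zero_nat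
  have hρ : Tendsto (fun m : ℕ => Real.exp (-(1 / (m : ℝ)))) atTop (𝓝 1) := by
    have := (Real.continuous_exp.tendsto _).comp hinv.neg
    simpa [Function.comp_def] using this
  have hk : Tendsto (fun m : ℕ => (⌊r * m⌋₊ : ℝ) / m) atTop (𝓝 r) :=
    (tendsto_nat_floor_mul_div_atTop hr.le).comp tendsto_natCast_atTop_atTop
  have hqm : Tendsto (fun m : ℕ => q / (m : ℝ)) atTop (𝓝 0) := by
    have := hinv.const_mul q
    simpa [div_eq_mul_inv] using this
  -- Sandwich from `e^{-y/(1-y)} ≤ 1 - y ≤ e^{-y}` with `y = q/m`.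
  have hpow : Tendsto (fun m : ℕ => (1 - q / (m : ℝ)) ^ ⌊r * m⌋₊) atTop
      (𝓝 (Real.exp (-(q * r)))) := by
    have hup : Tendsto (fun m : ℕ => Real.exp (-(q * ((⌊r * m⌋₊ : ℝ) / m)))) atTop
        (𝓝 (Real.exp (-(q * r)))) := (Real.continuous_exp.tendsto _).comp (hk.const_mul q).neg
    have hlow : Tendsto (fun m : ℕ => Real.exp (-(q * ((⌊r * m⌋₊ : ℝ) / m) / (1 - q / m)))) atTop
        (𝓝 (Real.exp (-(q * r / (1 - 0))))) :=
      (Real.continuous_exp.tendsto _).comp ((hk.const_mul q).div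
        ((tendsto_const_nhds (x := (1 : ℝ))).sub hqm) (by norm_num)).neg
    rw [sub_zero, div_one] at hlow
    refine tendsto_of_tendsto_of_tendsto_of_le_of_le' hlow hup ?_ ?_
    · filter_upwards [eventually_gt_atTop 0] with m hm
      have hm0 : (1 : ℝ) ≤ m := by exact_mod_cast hm
      have h1 : q / m < 1 := by rw [div_lt_one (by linarith)]; linarith
      have h2 : 0 < 1 - q / m := by linarith
      have h3 : Real.exp (-(q / m / (1 - q / m))) ≤ 1 - q / m := by
        rw [Real.exp_neg, inv_le_comm₀ (Real.exp_pos _) h2]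
        refine le_trans (le_of_eq ?_) (Real.add_one_le_exp _)
        rw [div_add_one h2.ne', inv_eq_one_div]
        congr 1
        ring
      refine le_trans (le_of_eq ?_) (pow_le_pow_left₀ (Real.exp_pos _).le h3 _)
      rw [← Real.exp_nat_mul]
      congr 1
      ring
    · filter_upwards [eventually_gt_atTop 0] with m hm
      have hm0 : (1 : ℝ) ≤ m := by exact_mod_cast hm
      have h1 : q / m < 1 := by rw [div_lt_one (by linarith)]; linarith
      refine (pow_le_pow_left₀ (by linarith) (Real.one_sub_le_exp_neg _) _).trans (le_of_eq ?_)
      rw [← Real.exp_nat_mul]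
      congr 1
      ring
  have hF : Tendsto (fun m : ℕ => (1 - (1 - q / (m : ℝ)) ^ ⌊r * m⌋₊) / ((⌊r * m⌋₊ : ℝ) / m)) atTop
      (𝓝 ((1 - Real.exp (-(q * r))) / r)) := (tendsto_const_nhds.sub hpow).div hk hr.ne'
  have hlow := hρ.mul hF
  have hup := hF.div hρ one_ne_zero
  rw [one_mul] at hlow
  rw [div_one] at hup
  have hev : ∀ᶠ m : ℕ in atTop, 0 < m ∧ 0 < ⌊r * m⌋₊ := by
    filter_upwards [eventually_gt_atTop 0,
      tendsto_natCast_atTop_atTop.eventually_ge_atTop (1 / r)] with m h0 hmr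
    rw [div_le_iff₀ hr] at hmr
    exact ⟨h0, Nat.floor_pos.2 (by linarith)⟩
  have hbounds : ∀ m : ℕ, 0 < m → 0 < ⌊r * m⌋₊ →
      let ρ := Real.exp (-(1 / (m : ℝ)))
      let k : ℝ := ⌊r * m⌋₊
      let S := ∑' i : ℕ, q / m * ρ ^ i * (1 - q / m * ρ ^ i) ^ (⌊r * m⌋₊ - 1)
      let F := 1 - (1 - q / (m : ℝ)) ^ ⌊r * m⌋₊
      ρ * (F / (k / m)) ≤ S ∧ S ≤ F / (k / m) / ρ := by
    intro m hm hk ρ k S F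
    have hm0 : (1 : ℝ) ≤ m := by exact_mod_cast hm
    have hm0' : (0 : ℝ) < m := by linarith
    have hk0 : 0 < k := Nat.cast_pos.2 hk
    have h1 : q / m < 1 := by rw [div_lt_one (by linarith)]; linarith
    have hρ1 : ρ < 1 := Real.exp_lt_one_iff.2 (by have : 0 < 1 / (m : ℝ) := by positivity
                                                  linarith)
    have hρ0 : 0 < ρ := Real.exp_pos _
    have hk1 : ((⌊r * m⌋₊ - 1 : ℕ) : ℝ) + 1 = k := by
      rw [Nat.cast_sub hk]; simp [k]
    obtain ⟨b1, b2⟩ := tsum_geometric_mul_pow_bounds (a := q / m) (by positivity) h1.le hρ0 hρ1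
      (⌊r * m⌋₊ - 1)
    rw [Nat.sub_add_cancel hk, hk1] at b1 b2
    change k * (1 - ρ) * S ≤ F at b1
    change ρ * F ≤ k * (1 - ρ) * S at b2
    have hS : 0 ≤ S := tsum_nonneg fun i => by
      have : q / m * ρ ^ i ≤ 1 := mul_le_one₀ h1.le (by positivity) (pow_le_one₀ hρ0.le hρ1.le)
      exact mul_nonneg (by positivity) (pow_nonneg (by linarith) _)
    -- Together with `hm2`, `m(1 - ρ)` lies between `ρ` and `1`, so it may be replaced by one in the
    -- limit.
    have hm1 : 1 - ρ ≤ 1 / m := by linarith [Real.one_sub_le_exp_neg (1 / (m : ℝ))]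
    have hm2 : ρ * (1 / m) ≤ 1 - ρ := by
      have h3 := Real.add_one_le_exp (1 / (m : ℝ))
      have h4 : ρ * Real.exp (1 / (m : ℝ)) = 1 := by
        rw [← Real.exp_add]; simp
      nlinarith
    constructor
    · have h5 : k * (1 - ρ) * S ≤ k * (1 / m) * S := by gcongr
      rw [← mul_div_assoc, div_le_iff₀ (by positivity)]
      calc ρ * F ≤ k * (1 / m) * S := b2.trans h5
        _ = _ := by ring
    · have h5 : k * (ρ * (1 / m)) * S ≤ k * (1 - ρ) * S := by gcongr
      rw [le_div_iff₀ hρ0, le_div_iff₀ (by positivity)]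
      calc S * ρ * (k / m) = k * (ρ * (1 / m)) * S := by ring
        _ ≤ F := h5.trans b1
  refine tendsto_of_tendsto_of_tendsto_of_le_of_le' hlow hup ?_ ?_
  · filter_upwards [hev] with m hm
    exact (hbounds m hm.1 hm.2).1
  · filter_upwards [hev] with m hm
    exact (hbounds m hm.1 hm.2).2

end GeometricMean

/-! ### The cells of the Fishmonger sketch -/

/-- The height of the tallest nontrivial cell of an unscaled column. -/
noncomputable def fishmongerRate : ℝ := 1 - Real.exp (-1)

theorem fishmongerRate_pos : 0 < fishmongerRate := by
  have : Real.exp (-1) < 1 := Real.exp_lt_one_iff.2 (by norm_num)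
  rw [fishmongerRate]
  linarith

theorem fishmongerRate_lt_one : fishmongerRate < 1 := by
  have := Real.exp_pos (-1)
  rw [fishmongerRate]
  linarith

theorem fishmonger_columns_pos (m : ℕ) : 0 < max m 1 := lt_max_of_lt_right one_pos

/-- The cells that are not always occupied, in the order of decreasing areas. -/
def fishmongerCell (m i : ℕ) : Fin (max m 1) × ℕ :=
  (⟨i % max m 1, Nat.mod_lt _ (fishmonger_columns_pos m)⟩, i / max m 1 + 1)

/-- The area of `fishmongerCell m i`. -/
noncomputable def fishmongerProb (m i : ℕ) : ℝ :=
  fishmongerRate / (max m 1 : ℕ) * Real.exp (-(1 / ((max m 1 : ℕ) : ℝ))) ^ i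

section Cells

variable (m : ℕ)

theorem fishmongerCell_injective : Function.Injective (fishmongerCell m) := by
  intro i j h
  simp only [fishmongerCell, Prod.mk.injEq, Fin.mk.injEq, Nat.add_right_cancel_iff] at h
  rw [← Nat.div_add_mod i (max m 1), ← Nat.div_add_mod j (max m 1), h.1, h.2]

theorem exists_fishmongerCell_eq {c : Fin (max m 1) × ℕ} (hc : c.2 ≠ 0) :
    ∃ i, fishmongerCell m i = c := by
  obtain ⟨i, j⟩ := c
  obtain ⟨j, rfl⟩ := Nat.exists_eq_succ_of_ne_zero hc
  refine ⟨i + max m 1 * j, ?_⟩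
  simp only [fishmongerCell, Prod.mk.injEq, Nat.succ_eq_add_one, Nat.add_right_cancel_iff]
  constructor
  · ext
    simp [Nat.add_mul_mod_self_left, Nat.mod_eq_of_lt i.2]
  · rw [Nat.add_mul_div_left _ _ (fishmonger_columns_pos m), Nat.div_eq_of_lt i.2, zero_add]

theorem tsum_fishmongerCell {E : Type*} [AddCommMonoid E] [TopologicalSpace E]
    (f : Fin (max m 1) × ℕ → E) (hf : ∀ c, c.2 = 0 → f c = 0) :
    ∑' i, f (fishmongerCell m i) = ∑' c, f c := by
  refine (fishmongerCell_injective m).tsum_eq fun c hc => ?_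
  obtain ⟨i, hi⟩ := exists_fishmongerCell_eq m (c := c) fun h0 => hc (hf c h0)
  exact ⟨i, hi⟩

/-- Smoothing interleaves the columns: both the passage to the next column and the return to column
`0` one row lower multiply the area by `e^{-1/N}`, where `N` is the number of columns. -/
theorem area_fishmongerCell (i : ℕ) :
    ((fishmonger m).area (fishmongerCell m i)).toReal = fishmongerProb m i := by
  have hN : (0 : ℝ) < (max m 1 : ℕ) := by exact_mod_cast fishmonger_columns_pos m
  have h1 : (fishmonger m).area (fishmongerCell m i) = ENNReal.ofReal
    (fishmongerHeight (max m 1) (fishmongerCell m i).1 (fishmongerCell m i).2 / (max m 1 : ℕ)) := rfl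
  rw [h1, ENNReal.toReal_ofReal (div_nonneg (fishmongerHeight_nonneg _ _ _) hN.le)]
  simp only [fishmongerCell, fishmongerHeight, fishmongerProb, fishmongerRate]
  have h2 : (i : ℝ) = (max m 1 : ℕ) * ((i / max m 1 : ℕ) : ℝ) + ((i % max m 1 : ℕ) : ℝ) := by
    exact_mod_cast (Nat.div_add_mod i (max m 1)).symm
  rw [← Real.exp_nat_mul]
  set N : ℝ := ((max m 1 : ℕ) : ℝ)
  set a : ℝ := ((i / max m 1 : ℕ) : ℝ)
  set b : ℝ := ((i % max m 1 : ℕ) : ℝ)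
  have e1 : (i : ℝ) * -(1 / N) = -a + -(b / N) := by
    rw [h2]
    field_simp
    ring
  rw [e1, neg_add, Real.exp_add, Real.exp_add]
  field_simp

theorem mem_run_fishmonger (l : List (Fin (max m 1) × ℕ)) (c : Fin (max m 1) × ℕ) :
    c ∈ (fishmonger m).run l ↔ c ∈ l ∨ c ∈ (fishmonger m).init :=
  mem_foldl_insert l _ c

theorem mem_init_fishmonger (c : Fin (max m 1) × ℕ) : c ∈ (fishmonger m).init ↔ c.2 = 0 := Iff.rfl

theorem fishmongerCell_notMem_init (i : ℕ) : fishmongerCell m i ∉ (fishmonger m).init :=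
  Nat.succ_ne_zero _

theorem fishmongerProb_pos (i : ℕ) : 0 < fishmongerProb m i := by
  have := fishmongerRate_pos
  have hN : (0 : ℝ) < (max m 1 : ℕ) := by exact_mod_cast fishmonger_columns_pos m
  rw [fishmongerProb]
  positivity

theorem fishmongerProb_le (i : ℕ) : fishmongerProb m i ≤ fishmongerRate / (max m 1 : ℕ) := by
  have := fishmongerRate_pos
  rw [fishmongerProb]
  refine mul_le_of_le_one_right (by positivity) (pow_le_one₀ (Real.exp_pos _).le ?_)
  exact Real.exp_le_one_iff.2 (neg_nonpos.2 (by positivity))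

theorem fishmongerProb_lt_one (i : ℕ) : fishmongerProb m i < 1 := by
  have hN : (1 : ℝ) ≤ (max m 1 : ℕ) := by exact_mod_cast fishmonger_columns_pos m
  refine (fishmongerProb_le m i).trans_lt ?_
  rw [div_lt_one (by linarith)]
  linarith [fishmongerRate_lt_one]

theorem area_fishmonger_le {c : Fin (max m 1) × ℕ} (hc : c ∉ (fishmonger m).init) :
    ((fishmonger m).area c).toReal ≤ 1 / (max m 1 : ℕ) := by
  obtain ⟨i, rfl⟩ := exists_fishmongerCell_eq m hc
  rw [area_fishmongerCell]
  refine (fishmongerProb_le m i).trans ?_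
  gcongr
  exact fishmongerRate_lt_one.le

theorem meanFreeArea_fishmonger (n : ℕ) : meanFreeArea (fishmonger m) n []
    = ∑' i, fishmongerProb m i * (1 - fishmongerProb m i) ^ n := by
  classical
  rw [meanFreeArea, ← tsum_fishmongerCell]
  · refine tsum_congr fun i => ?_
    rw [if_neg, area_fishmongerCell]
    rw [mem_run_fishmonger]
    simpa using fishmongerCell_notMem_init m i
  · intro c hc
    rw [if_pos ((mem_run_fishmonger m _ _).2 (Or.inr hc)), mul_zero]

/-- The free area is bounded below in terms of the number of darts. -/
theorem le_freeArea_fishmonger (l : List (Fin (max m 1) × ℕ)) {r : ℝ}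
    (hl : (l.length : ℝ) ≤ r * (max m 1 : ℕ)) :
    fishmongerRate * Real.exp (-(1 + r)) ≤ ((fishmonger m).freeArea l).toReal := by
  classical
  have hN : (0 : ℝ) < (max m 1 : ℕ) := by exact_mod_cast fishmonger_columns_pos m
  set S := (Finset.range (l.length + max m 1)).filter fun i => fishmongerCell m i ∉ l with hS
  -- Pigeonhole: the darts spoil at most `l.length` of the largest `l.length + N` cells, leaving `N`
  -- unhit cells, each of area at least `fishmongerRate / N * e^{-(1 + r)}`.
  have hcard : max m 1 ≤ S.card := by
    have h1 : ((Finset.range (l.length + max m 1)).filter fun i => fishmongerCell m i ∈ l).card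
        ≤ l.length := by
      refine le_trans ?_ (List.toFinset_card_le l)
      refine Finset.card_le_card_of_injOn (fishmongerCell m) (fun i hi => ?_)
        (fishmongerCell_injective m).injOn
      simpa using (Finset.mem_filter.1 hi).2
    have h2 := Finset.card_filter_add_card_filter_not (s := Finset.range (l.length + max m 1))
      (fun i => fishmongerCell m i ∈ l)
    rw [Finset.card_range] at h2
    rw [← hS] at h2
    omega
  have hsum := sum_le_hasSum (S.map ⟨_, fishmongerCell_injective m⟩) (fun c _ => by
    have : 0 ≤ ((fishmonger m).area c).toReal := ENNReal.toReal_nonneg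
    split_ifs <;> simp) ((fishmonger m).hasSum_freeArea l)
  rw [Finset.sum_map] at hsum
  refine le_trans ?_ hsum
  have hterm : ∀ i ∈ S, fishmongerRate / (max m 1 : ℕ) * Real.exp (-(1 + r)) ≤
      ((fishmonger m).area (fishmongerCell m i)).toReal
        * if fishmongerCell m i ∈ (fishmonger m).run l then (0 : ℝ) else 1 := by
    intro i hi
    obtain ⟨hi1, hi2⟩ := Finset.mem_filter.1 hi
    have hi3 : (i : ℝ) ≤ l.length + (max m 1 : ℕ) := by exact_mod_cast (Finset.mem_range.1 hi1).le
    rw [if_neg (by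
      rw [mem_run_fishmonger, not_or]
      exact ⟨hi2, fishmongerCell_notMem_init m i⟩), mul_one, area_fishmongerCell, fishmongerProb,
      ← Real.exp_nat_mul]
    have := fishmongerRate_pos
    refine mul_le_mul_of_nonneg_left (Real.exp_le_exp.2 ?_) (by positivity)
    rw [mul_neg, neg_le_neg_iff, mul_one_div, div_le_iff₀ hN]
    linarith
  refine le_trans ?_ (Finset.card_nsmul_le_sum S _ _ hterm)
  rw [nsmul_eq_mul]
  have h3 : ((max m 1 : ℕ) : ℝ) ≤ S.card := by exact_mod_cast hcard
  have := fishmongerRate_pos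
  calc fishmongerRate * Real.exp (-(1 + r))
      = (max m 1 : ℕ) * (fishmongerRate / (max m 1 : ℕ) * Real.exp (-(1 + r))) := by field_simp
    _ ≤ _ := by gcongr

/-- No cell is influenced by another, so `φ` is constant and any linear order works. -/
theorem isLinearizable_fishmonger : (fishmonger m).IsLinearizable := by
  let o : LinearOrder (Fin (max m 1) × ℕ) :=
    LinearOrder.lift' (toLex : Fin (max m 1) × ℕ → Fin (max m 1) ×ₗ ℕ) toLex.injective
  refine ⟨o, fun c _ => c.2 = 0, fun c _ _ _ h => h, fun l c => mem_run_fishmonger m l c,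
    fun l l' c h => ?_⟩
  rw [mem_run_fishmonger, mem_run_fishmonger, h c (o.le_refl c)]

end Cells

/-! ### Scale-invariance of Fishmonger -/

section ScaleInvariance

variable {Ω : Type*} [MeasurableSpace Ω] {μ : Measure Ω} [IsProbabilityMeasure μ]
  {D : ∀ m, ℕ → Ω → Fin (max m 1) × ℕ}

/-- The fourth moments of the deviations are of order `m⁻²`, hence summable, so the sum of the
fourth powers is almost surely finite. No assumption on the joint law across different `m` enters.
-/
theorem ae_tendsto_freeArea_sub_mean_fishmonger
    (hD : ∀ m, (fishmonger m).IsDartSequence μ (D m)) {r : ℝ} (hr : 0 < r) :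
    ∀ᵐ ω ∂μ, Tendsto (fun m : ℕ => ((fishmonger m).freeArea
        (darts (D m) (⌊r * m⌋₊ - 1) ω)).toReal - meanFreeArea (fishmonger m) (⌊r * m⌋₊ - 1) [])
      atTop (𝓝 0) := by
  set Z : ℕ → Ω → ℝ := fun m ω => ((fishmonger m).freeArea
    (darts (D m) (⌊r * m⌋₊ - 1) ω)).toReal - meanFreeArea (fishmonger m) (⌊r * m⌋₊ - 1) [] with hZ
  have hmeas : ∀ m, Measurable fun ω => ENNReal.ofReal (Z m ω ^ 4) := fun m =>
    (isDiscreteRV_darts (hD m).measurable _).measurable_comp fun l => ENNReal.ofReal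
      ((((fishmonger m).freeArea l).toReal
        - meanFreeArea (fishmonger m) (⌊r * m⌋₊ - 1) []) ^ 4)
  have hbound : ∀ m : ℕ, ∫⁻ ω, ENNReal.ofReal (Z m ω ^ 4) ∂μ
      ≤ ENNReal.ofReal (16 * r ^ 2 * (1 / ((m : ℝ) + 1) ^ 2)) := by
    intro m
    have hN : (0 : ℝ) < (max m 1 : ℕ) := by exact_mod_cast fishmonger_columns_pos m
    obtain ⟨hi, hle⟩ := integral_freeArea_sub_mean_four_le (hD m) (mem_run_fishmonger m)
      (B := 1 / (max m 1 : ℕ)) (by positivity) (fun c hc => area_fishmonger_le m hc)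
      (⌊r * m⌋₊ - 1)
    have h4 : ∀ ω, 0 ≤ Z m ω ^ 4 := fun ω => by positivity
    rw [← ofReal_integral_eq_lintegral_ofReal hi (ae_of_all _ h4)]
    refine ENNReal.ofReal_le_ofReal (hle.trans ?_)
    have h5 : ((⌊r * m⌋₊ - 1 : ℕ) : ℝ) ≤ r * (max m 1 : ℕ) := by
      calc ((⌊r * m⌋₊ - 1 : ℕ) : ℝ) ≤ (⌊r * m⌋₊ : ℝ) := by exact_mod_cast Nat.sub_le _ _
        _ ≤ r * m := Nat.floor_le (by positivity)
        _ ≤ _ := by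
          gcongr
          exact le_max_left _ _
    have h6 : ((m : ℝ) + 1) / 2 ≤ (max m 1 : ℕ) := by
      have h7 : (m : ℝ) ≤ (max m 1 : ℕ) := by exact_mod_cast le_max_left _ _
      have h8 : (1 : ℝ) ≤ (max m 1 : ℕ) := by exact_mod_cast le_max_right _ _
      linarith
    set N : ℝ := ((max m 1 : ℕ) : ℝ)
    calc 4 * ((⌊r * m⌋₊ - 1 : ℕ) : ℝ) ^ 2 * (1 / N) ^ 4 ≤ 4 * (r * N) ^ 2 * (1 / N) ^ 4 := by
          gcongr
      _ = 4 * r ^ 2 * (1 / N ^ 2) := by field_simp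
      _ ≤ 4 * r ^ 2 * (1 / (((m : ℝ) + 1) / 2) ^ 2) := by gcongr
      _ = _ := by field_simp; ring
  have hsum : ∫⁻ ω, ∑' m, ENNReal.ofReal (Z m ω ^ 4) ∂μ ≠ ∞ := by
    rw [lintegral_tsum fun m => (hmeas m).aemeasurable]
    refine ne_top_of_le_ne_top ?_ (ENNReal.tsum_le_tsum hbound)
    rw [← ENNReal.ofReal_tsum_of_nonneg (fun m => by positivity)]
    · exact ENNReal.ofReal_ne_top
    · refine Summable.mul_left _ ?_
      have := (summable_nat_add_iff (f := fun k : ℕ => 1 / (k : ℝ) ^ 2) 1).2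
        (Real.summable_one_div_nat_pow.2 (by norm_num))
      simpa using this
  filter_upwards [ae_lt_top (Measurable.tsum hmeas) hsum] with ω hω
  have h1 := ENNReal.tendsto_atTop_zero_of_tsum_ne_top hω.ne
  have h2 := (ENNReal.tendsto_toReal ENNReal.zero_ne_top).comp h1
  have h3 : Tendsto (fun m => Z m ω ^ 4) atTop (𝓝 0) := by
    refine h2.congr fun m => ?_
    exact ENNReal.toReal_ofReal (by positivity)
  have h4 := h3.sqrt.sqrt
  rw [Real.sqrt_zero, Real.sqrt_zero] at h4
  rw [tendsto_zero_iff_abs_tendsto_zero]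
  refine h4.congr fun m => ?_
  rw [show Z m ω ^ 4 = (Z m ω ^ 2) ^ 2 by ring, Real.sqrt_sq (sq_nonneg _), Real.sqrt_sq_eq_abs]
  rfl

theorem ae_tendsto_stateChangeProb_fishmonger
    (hD : ∀ m, (fishmonger m).IsDartSequence μ (D m)) {r : ℝ} (hr : 0 < r) :
    ∀ᵐ ω ∂μ, Tendsto (fun m : ℕ => r * (fishmonger m).stateChangeProb (D m) ⌊r * m⌋₊ ω) atTop
      (𝓝 (1 - Real.exp (-(fishmongerRate * r)))) := by
  have hmean : Tendsto (fun m : ℕ => meanFreeArea (fishmonger m) (⌊r * m⌋₊ - 1) []) atTop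
      (𝓝 ((1 - Real.exp (-(fishmongerRate * r))) / r)) := by
    refine (tendsto_tsum_geometric_mul_pow fishmongerRate_pos fishmongerRate_lt_one hr).congr' ?_
    filter_upwards [eventually_ge_atTop 1] with m hm
    rw [meanFreeArea_fishmonger]
    simp only [fishmongerProb, max_eq_left hm]
  filter_upwards [ae_tendsto_freeArea_sub_mean_fishmonger hD hr] with ω hω
  have h := (hω.add hmean).const_mul r
  rw [zero_add, mul_div_cancel₀ _ hr.ne'] at h
  refine h.congr fun m => ?_
  rw [DartboardSketch.stateChangeProb, DartboardSketch.state_eq, DartboardSketch.changeProb_run]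
  ring

theorem isScaleInvariant_fishmonger (hD : ∀ m, (fishmonger m).IsDartSequence μ (D m)) :
    DartboardSketch.IsScaleInvariant fishmonger μ D 1 := by
  refine ⟨_, fun r hr => ae_tendsto_stateChangeProb_fishmonger hD hr, ?_⟩
  have h1 : Tendsto (fun r : ℝ => fishmongerRate * r) atTop atTop :=
    tendsto_id.const_mul_atTop fishmongerRate_pos
  have h2 := (Real.tendsto_exp_neg_atTop_nhds_zero.comp h1).const_sub 1
  rw [sub_zero] at h2
  exact h2

end ScaleInvariance

/-! ### The variance of the martingale estimator of Fishmonger -/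

/-- When the free area never falls below `ε`, the stopping is void and the variance is exactly the
sum of the mean conditional variances. -/
theorem DartboardSketch.evariance_martingaleEstimator {C Ω : Type*} [MeasurableSpace C]
    [MeasurableSingletonClass C] [Countable C] [MeasurableSpace Ω] {μ : Measure Ω}
    [IsProbabilityMeasure μ] (X : DartboardSketch C) {D : ℕ → Ω → C} (hD : X.IsDartSequence μ D)
    {ε : ℝ} (hε : 0 < ε) (hε1 : ε ≤ 1) {n : ℕ}
    (h : ∀ ω, ∀ i < n, ε ≤ (X.freeArea (darts D i ω)).toReal) :
    evariance (X.martingaleEstimator D n) μ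
      = ∑ i ∈ Finset.range n, ∫⁻ ω, ENNReal.ofReal (X.estimatorVar ε (darts D i ω)) ∂μ := by
  have hB0 : 0 ≤ 1 / ε := by positivity
  have hB := X.abs_estimatorIncr_le hε hε1
  have hmart := X.tsum_area_mul_estimatorIncr hε
  have hY : ∀ ω, X.martingaleEstimator D n ω = n + dartMart (X.estimatorIncr ε) D n ω :=
    fun ω => X.martingaleEstimator_eq n (h ω)
  have hM1 : Integrable (dartMart (X.estimatorIncr ε) D n) μ := by
    simpa using integrable_dartMart_pow (μ := μ) hD.measurable hB0 hB n 1
  have hE : ∫ ω, X.martingaleEstimator D n ω ∂μ = n := by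
    simp_rw [hY]
    rw [integral_add (integrable_const _) hM1, integral_dartMart hD hB0 hB hmart]
    simp
  rw [evariance_eq_lintegral_ofReal, hE, ← X.ofReal_integral_estimator_sq hD hε hε1,
    ofReal_integral_eq_lintegral_ofReal (integrable_dartMart_pow hD.measurable hB0 hB n 2)
      (ae_of_all _ fun ω => sq_nonneg _)]
  refine lintegral_congr fun ω => ?_
  rw [hY, add_sub_cancel_left]

/-- The limit of `r * P_{m, r m}` for Fishmonger. -/
noncomputable def fishmongerScale (r : ℝ) : ℝ := 1 - Real.exp (-(fishmongerRate * r))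

theorem fishmongerScale_pos {r : ℝ} (hr : 0 < r) : 0 < fishmongerScale r := by
  have : Real.exp (-(fishmongerRate * r)) < 1 :=
    exp_neg_lt_one (mul_pos fishmongerRate_pos hr)
  rw [fishmongerScale]
  linarith

theorem le_div_fishmongerScale {s : ℝ} (hs : 0 < s) : s ≤ s / fishmongerScale s := by
  rw [le_div_iff₀ (fishmongerScale_pos hs)]
  refine mul_le_of_le_one_right hs.le ?_
  rw [fishmongerScale]
  linarith [Real.exp_pos (-(fishmongerRate * s))]

/-- Equivalent to `(x + 1) e^{-x} ≤ 1` for `x = fishmongerRate * s`. With `le_div_fishmongerScale`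
it keeps the limiting variance within `O(r)` of `r²/2`. -/
theorem div_fishmongerScale_le {s : ℝ} (hs : 0 < s) :
    s / fishmongerScale s ≤ s + 1 / fishmongerRate := by
  have hq := fishmongerRate_pos
  rw [div_le_iff₀ (fishmongerScale_pos hs), fishmongerScale]
  set x := fishmongerRate * s with hx
  have h1 := Real.add_one_le_exp x
  have h2 : Real.exp (-x) * Real.exp x = 1 := by rw [← Real.exp_add]; simp
  have h3 : (x + 1) * Real.exp (-x) ≤ 1 := by
    have := mul_le_mul_of_nonneg_left h1 (Real.exp_pos (-x)).le
    linarith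
  have h4 : s + 1 / fishmongerRate = (x + 1) / fishmongerRate := by
    rw [hx]; field_simp
  have h5 : s = x / fishmongerRate := by rw [hx]; field_simp
  rw [h4, div_mul_eq_mul_div, h5]
  gcongr
  linarith

/-- The limit of the variance of the martingale estimator, divided by `m`. -/
noncomputable def fishmongerVar (r : ℝ) : ℝ≥0∞ :=
  ∫⁻ s in Set.Ioc 0 r, ENNReal.ofReal (s / fishmongerScale s - 1)

theorem fishmongerVar_le {r : ℝ} (hr : 0 < r) :
    fishmongerVar r ≤ ENNReal.ofReal (r ^ 2 / 2 + r / fishmongerRate) := by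
  have hq := fishmongerRate_pos
  have hcont : Continuous (fun s : ℝ => s + 1 / fishmongerRate) := by fun_prop
  calc fishmongerVar r ≤ ∫⁻ s in Set.Ioc 0 r, ENNReal.ofReal (s + 1 / fishmongerRate) :=
        setLIntegral_mono' measurableSet_Ioc fun s hs =>
          ENNReal.ofReal_le_ofReal (by linarith [div_fishmongerScale_le hs.1])
    _ = _ := by
        rw [← ofReal_integral_eq_lintegral_ofReal
          (hcont.integrableOn_Icc.mono_set Set.Ioc_subset_Icc_self),
          ← intervalIntegral.integral_of_le hr.le, intervalIntegral.integral_add (by simp) (by simp),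
          integral_id]
        · congr 1
          simp
          field_simp
        · filter_upwards [ae_restrict_mem measurableSet_Ioc] with s hs
          have := hs.1
          simp only [Pi.zero_apply]
          positivity

theorem le_fishmongerVar {r : ℝ} (hr : 1 ≤ r) :
    ENNReal.ofReal ((r - 1) ^ 2 / 2) ≤ fishmongerVar r := by
  have hcont : Continuous (fun s : ℝ => s - 1) := by fun_prop
  calc ENNReal.ofReal ((r - 1) ^ 2 / 2) = ∫⁻ s in Set.Ioc 1 r, ENNReal.ofReal (s - 1) := by
        rw [← ofReal_integral_eq_lintegral_ofReal
          (hcont.integrableOn_Icc.mono_set Set.Ioc_subset_Icc_self),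
          ← intervalIntegral.integral_of_le hr, intervalIntegral.integral_sub (by simp) (by simp),
          integral_id]
        · congr 1
          simp
          ring
        · filter_upwards [ae_restrict_mem measurableSet_Ioc] with s hs
          have := hs.1
          simp only [Pi.zero_apply]
          linarith
    _ ≤ ∫⁻ s in Set.Ioc 0 r, ENNReal.ofReal (s - 1) :=
        lintegral_mono_set (Set.Ioc_subset_Ioc_left zero_le_one)
    _ ≤ _ := setLIntegral_mono' measurableSet_Ioc fun s hs =>
        ENNReal.ofReal_le_ofReal (by linarith [le_div_fishmongerScale hs.1])

theorem tendsto_fishmongerVar :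
    Tendsto (fun r : ℝ => ENNReal.ofReal (1 / r ^ 2) * fishmongerVar r) atTop
      (𝓝 (ENNReal.ofReal (1 / 2))) := by
  have hinv : Tendsto (fun r : ℝ => r⁻¹) atTop (𝓝 0) := tendsto_inv_atTop_zero
  have hlow : Tendsto (fun r : ℝ => (1 - r⁻¹) ^ 2 / 2) atTop (𝓝 ((1 - 0) ^ 2 / 2)) :=
    ((hinv.const_sub 1).pow 2).div_const 2
  have hup : Tendsto (fun r : ℝ => 1 / 2 + r⁻¹ / fishmongerRate) atTop
      (𝓝 (1 / 2 + 0 / fishmongerRate)) := (hinv.div_const _).const_add _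
  rw [sub_zero, one_pow] at hlow
  rw [zero_div, add_zero] at hup
  refine tendsto_of_tendsto_of_tendsto_of_le_of_le' (ENNReal.tendsto_ofReal hlow)
    (ENNReal.tendsto_ofReal hup) ?_ ?_
  · filter_upwards [eventually_ge_atTop 1] with r hr
    refine le_trans (le_of_eq ?_) (mul_le_mul_right (le_fishmongerVar hr) _)
    rw [← ENNReal.ofReal_mul (by positivity)]
    congr 1
    field_simp
  · filter_upwards [eventually_ge_atTop 1] with r hr
    have hr0 : 0 < r := by linarith
    refine (mul_le_mul_right (fishmongerVar_le hr0) _).trans (le_of_eq ?_)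
    rw [← ENNReal.ofReal_mul (by positivity)]
    congr 1
    field_simp

section Variance

variable {Ω : Type*} {D : ∀ m, ℕ → Ω → Fin (max m 1) × ℕ}

/-- A lower bound for the free area of Fishmonger up to the scale `r`. -/
noncomputable def fishmongerLower (r : ℝ) : ℝ := fishmongerRate * Real.exp (-(1 + r))

theorem fishmongerLower_pos (r : ℝ) : 0 < fishmongerLower r :=
  mul_pos fishmongerRate_pos (Real.exp_pos _)

theorem fishmongerLower_le_one {r : ℝ} (hr : 0 < r) : fishmongerLower r ≤ 1 :=
  mul_le_one₀ fishmongerRate_lt_one.le (Real.exp_pos _).le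
    (Real.exp_le_one_iff.2 (by linarith))

theorem fishmongerLower_le_freeArea {r : ℝ} {m i : ℕ} (hi : (i : ℝ) ≤ r * m) (hr : 0 < r) (ω : Ω) :
    fishmongerLower r ≤ ((fishmonger m).freeArea (darts (D m) i ω)).toReal := by
  refine le_freeArea_fishmonger m _ ?_
  rw [length_darts]
  refine hi.trans ?_
  gcongr
  exact le_max_left _ _

variable [MeasurableSpace Ω] {μ : Measure Ω} [IsProbabilityMeasure μ]

/-- The deterministic lower bound on the free area bounds the conditional variance, so dominated
convergence gives a limit rather than only a lower bound. -/
theorem tendsto_lintegral_estimatorVar_fishmonger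
    (hD : ∀ m, (fishmonger m).IsDartSequence μ (D m)) {s r : ℝ} (hs : 0 < s) (hsr : s ≤ r) :
    Tendsto (fun m : ℕ => ∫⁻ ω, ENNReal.ofReal ((fishmonger m).estimatorVar (fishmongerLower r)
      (darts (D m) (⌊s * m⌋₊ - 1) ω)) ∂μ) atTop
      (𝓝 (ENNReal.ofReal (s / fishmongerScale s - 1))) := by
  have hr : 0 < r := hs.trans_le hsr
  have hle : ∀ (m : ℕ) (ω : Ω), fishmongerLower r
      ≤ ((fishmonger m).freeArea (darts (D m) (⌊s * m⌋₊ - 1) ω)).toReal := fun m ω =>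
    fishmongerLower_le_freeArea (by
      calc ((⌊s * m⌋₊ - 1 : ℕ) : ℝ) ≤ (⌊s * m⌋₊ : ℝ) := by exact_mod_cast Nat.sub_le _ _
        _ ≤ s * m := Nat.floor_le (by positivity)
        _ ≤ r * m := by gcongr) hr ω
  have hconst : ENNReal.ofReal (s / fishmongerScale s - 1)
      = ∫⁻ _ω, ENNReal.ofReal (s / fishmongerScale s - 1) ∂μ := by simp
  rw [hconst]
  refine tendsto_lintegral_of_dominated_convergence
    (fun _ => ENNReal.ofReal (1 / fishmongerLower r))
    (fun m => (isDiscreteRV_darts (hD m).measurable _).measurable_comp fun l =>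
      ENNReal.ofReal ((fishmonger m).estimatorVar (fishmongerLower r) l)) (fun m => ?_) (by simp) ?_
  · refine ae_of_all _ fun ω => ENNReal.ofReal_le_ofReal ?_
    rw [DartboardSketch.estimatorVar, if_pos (hle m ω)]
    linarith [one_div_le_one_div_of_le (fishmongerLower_pos r) (hle m ω)]
  · filter_upwards [ae_tendsto_stateChangeProb_fishmonger hD hs] with ω hω
    have h1 := hω.div_const s
    have h2 := (((tendsto_const_nhds (x := (1 : ℝ))).div h1
      (div_pos (fishmongerScale_pos hs) hs).ne').sub_const 1)
    rw [one_div_div] at h2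
    refine (ENNReal.tendsto_ofReal h2).congr fun m => ?_
    simp only [Pi.div_apply]
    rw [DartboardSketch.stateChangeProb, DartboardSketch.state_eq, DartboardSketch.changeProb_run,
      mul_div_cancel_left₀ _ hs.ne', DartboardSketch.estimatorVar, if_pos (hle m ω)]

theorem evariance_fishmonger (hD : ∀ m, (fishmonger m).IsDartSequence μ (D m)) {r : ℝ} (hr : 0 < r)
    {m : ℕ} (hm : 0 < m) :
    evariance ((fishmonger m).martingaleEstimator (D m) ⌊r * m⌋₊) μ = ENNReal.ofReal m *
      ∫⁻ s in Set.Ioc (1 / (m : ℝ)) ((⌊r * m⌋₊ + 1) / m), ∫⁻ ω, ENNReal.ofReal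
        ((fishmonger m).estimatorVar (fishmongerLower r) (darts (D m) (⌊s * m⌋₊ - 1) ω)) ∂μ := by
  have hm0 : (0 : ℝ) < m := by exact_mod_cast hm
  rw [(fishmonger m).evariance_martingaleEstimator (hD m) (fishmongerLower_pos r)
    (fishmongerLower_le_one hr) fun ω i hi => fishmongerLower_le_freeArea (by
      calc (i : ℝ) ≤ (⌊r * m⌋₊ : ℝ) := by exact_mod_cast hi.le
        _ ≤ r * m := Nat.floor_le (by positivity)) hr ω]
  rw [sum_range_eq_lintegral_floor fun i => ∫⁻ ω, ENNReal.ofReal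
    ((fishmonger m).estimatorVar (fishmongerLower r) (darts (D m) i ω)) ∂μ]
  rw [← setLIntegral_Ioc_mul hm0 _ _ fun x => ∫⁻ ω, ENNReal.ofReal
    ((fishmonger m).estimatorVar (fishmongerLower r) (darts (D m) (⌊x⌋₊ - 1) ω)) ∂μ,
    div_mul_cancel₀ _ hm0.ne', div_mul_cancel₀ _ hm0.ne']

theorem tendsto_lintegral_fishmongerVar (hD : ∀ m, (fishmonger m).IsDartSequence μ (D m)) {r : ℝ}
    (hr : 0 < r) : Tendsto (fun m : ℕ =>
      ∫⁻ s in Set.Ioc (1 / (m : ℝ)) ((⌊r * m⌋₊ + 1) / m), ∫⁻ ω, ENNReal.ofReal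
        ((fishmonger m).estimatorVar (fishmongerLower r) (darts (D m) (⌊s * m⌋₊ - 1) ω)) ∂μ)
      atTop (𝓝 (fishmongerVar r)) := by
  set a : ℕ → ℕ → ℝ≥0∞ := fun m i => ∫⁻ ω, ENNReal.ofReal
    ((fishmonger m).estimatorVar (fishmongerLower r) (darts (D m) i ω)) ∂μ with ha
  have hinv : Tendsto (fun m : ℕ => 1 / (m : ℝ)) atTop (𝓝 0) := tendsto_one_div_atTop_nhds_zero_nat
  have hlt : ∀ m : ℕ, 0 < m → r < (⌊r * m⌋₊ + 1) / (m : ℝ) := fun m hm => by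
    rw [lt_div_iff₀ (by exact_mod_cast hm)]
    exact Nat.lt_floor_add_one _
  have hle : ∀ m : ℕ, 0 < m → (⌊r * m⌋₊ + 1) / (m : ℝ) ≤ r + 1 / m := fun m hm => by
    have hm0 : (0 : ℝ) < m := by exact_mod_cast hm
    have h1 : (⌊r * m⌋₊ : ℝ) ≤ r * m := Nat.floor_le (by positivity)
    rw [div_le_iff₀ hm0, add_mul, one_div_mul_cancel hm0.ne']
    linarith
  have hbound : ∀ m i, a m i ≤ ENNReal.ofReal (1 / fishmongerLower r) := by
    intro m i
    calc a m i ≤ ∫⁻ _ω, ENNReal.ofReal (1 / fishmongerLower r) ∂μ := by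
          refine lintegral_mono fun ω => ENNReal.ofReal_le_ofReal ?_
          have h0 := fishmongerLower_pos r
          rw [DartboardSketch.estimatorVar]
          split_ifs with h
          · linarith [one_div_le_one_div_of_le h0 h]
          · positivity
      _ = _ := by simp
  simp_rw [fishmongerVar, ← lintegral_indicator measurableSet_Ioc]
  refine tendsto_lintegral_filter_of_dominated_convergence
    ((Set.Ioc 0 (r + 1)).indicator fun _ => ENNReal.ofReal (1 / fishmongerLower r)) ?_ ?_ ?_ ?_
  · refine Eventually.of_forall fun m => Measurable.indicator ?_ measurableSet_Ioc
    exact (measurable_from_top (f := fun n : ℕ => a m (n - 1))).comp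
      (Nat.measurable_floor.comp (measurable_id.mul_const _))
  · filter_upwards [eventually_gt_atTop 0] with m hm
    refine ae_of_all _ fun s => ?_
    have hm1 : 1 / (m : ℝ) ≤ 1 := by
      rw [div_le_one (by exact_mod_cast hm)]
      exact_mod_cast hm
    refine (Set.indicator_le_indicator (hbound m _)).trans
      (Set.indicator_le_indicator_of_subset (Set.Ioc_subset_Ioc (by positivity) ?_)
        (fun _ => zero_le) s)
    exact (hle m hm).trans (by linarith)
  · rw [lintegral_indicator measurableSet_Ioc]
    simp
    finiteness
  · have hne : ∀ᵐ s : ℝ, s ≠ r := by simp [ae_iff]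
    filter_upwards [hne] with s hs
    rcases le_or_gt s 0 with h0 | h0
    · have h1 : s ∉ Set.Ioc 0 r := fun h => h.1.not_ge h0
      rw [Set.indicator_of_notMem h1]
      refine tendsto_const_nhds.congr fun m => ?_
      rw [Set.indicator_of_notMem]
      intro h
      have : 0 ≤ 1 / (m : ℝ) := by positivity
      linarith [h.1]
    · rcases lt_or_gt_of_ne hs with h | h
      · rw [Set.indicator_of_mem (show s ∈ Set.Ioc 0 r from ⟨h0, h.le⟩)]
        refine (tendsto_lintegral_estimatorVar_fishmonger hD h0 h.le).congr' ?_
        filter_upwards [hinv.eventually (gt_mem_nhds h0), eventually_gt_atTop 0] with m hm1 hm2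
        rw [Set.indicator_of_mem]
        exact ⟨hm1, (h.trans (hlt m hm2)).le⟩
      · rw [Set.indicator_of_notMem fun hc => hc.2.not_gt h]
        refine tendsto_const_nhds.congr' ?_
        filter_upwards [hinv.eventually (gt_mem_nhds (sub_pos.2 h)), eventually_gt_atTop 0]
          with m hm1 hm2
        rw [Set.indicator_of_notMem]
        intro hc
        linarith [hc.2, hle m hm2]

theorem tendsto_relVariance_fishmonger (hD : ∀ m, (fishmonger m).IsDartSequence μ (D m)) {r : ℝ}
    (hr : 0 < r) : Tendsto (fun m : ℕ =>
      (m : ℝ≥0∞) * (fishmonger m).relVariance μ (D m) ⌊r * m⌋₊) atTop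
      (𝓝 (ENNReal.ofReal (1 / r ^ 2) * fishmongerVar r)) := by
  have hk : Tendsto (fun m : ℕ => (⌊r * m⌋₊ : ℝ) / m) atTop (𝓝 r) :=
    (tendsto_nat_floor_mul_div_atTop hr.le).comp tendsto_natCast_atTop_atTop
  have h1 : Tendsto (fun m : ℕ => ENNReal.ofReal (1 / ((⌊r * m⌋₊ : ℝ) / m) ^ 2)) atTop
      (𝓝 (ENNReal.ofReal (1 / r ^ 2))) :=
    ENNReal.tendsto_ofReal (tendsto_const_nhds.div (hk.pow 2) (by positivity))
  have hfin : fishmongerVar r ≠ ∞ :=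
    ne_top_of_le_ne_top ENNReal.ofReal_ne_top (fishmongerVar_le hr)
  refine (ENNReal.Tendsto.mul h1 (Or.inr hfin) (tendsto_lintegral_fishmongerVar hD hr)
    (Or.inr ENNReal.ofReal_ne_top)).congr' ?_
  filter_upwards [eventually_gt_atTop 0,
    tendsto_natCast_atTop_atTop.eventually_ge_atTop (1 / r)] with m hm hmr
  have hm0 : (0 : ℝ) < m := by exact_mod_cast hm
  rw [div_le_iff₀ hr] at hmr
  have hn : 0 < ⌊r * m⌋₊ := Nat.floor_pos.2 (by linarith)
  have hn0 : (0 : ℝ) < ⌊r * m⌋₊ := by exact_mod_cast hn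
  rw [DartboardSketch.relVariance, evariance_fishmonger hD hr hm, ← ENNReal.ofReal_natCast m,
    ← ENNReal.ofReal_natCast ⌊r * m⌋₊, ← ENNReal.ofReal_pow hn0.le,
    ENNReal.div_eq_inv_mul, ← ENNReal.ofReal_inv_of_pos (by positivity)]
  have e : 1 / ((⌊r * m⌋₊ : ℝ) / m) ^ 2 = m * (m * ((⌊r * m⌋₊ : ℝ) ^ 2)⁻¹) := by field_simp
  rw [e, ENNReal.ofReal_mul hm0.le, ENNReal.ofReal_mul hm0.le]
  ring

end Variance

/-! ### The memory of Fishmonger -/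

section Memory

/-- With `(1 - p)^n = e^{-x}`, Bernoulli's inequality `(1 - p)^ρ ≤ 1 - ρp` shows that `x` decreases
at least by the factor `ρ = e^{-1/N}` per cell. The Riemann-sum bound thus applies directly at a
deterministic number of darts. -/
theorem tsum_binEntropy_fishmonger_le (m : ℕ) {n : ℕ} (hn : 0 < n) :
    ∑' i, ENNReal.ofReal (Real.binEntropy ((1 - fishmongerProb m i) ^ n))
      ≤ ENNReal.ofReal ((max m 1 : ℕ) * natH0 + 2 * Real.log 2) := by
  have hN : (0 : ℝ) < (max m 1 : ℕ) := by exact_mod_cast fishmonger_columns_pos m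
  have hn0 : (0 : ℝ) < n := by exact_mod_cast hn
  have hp0 := fishmongerProb_pos m
  have hp1 := fishmongerProb_lt_one m
  set x : ℕ → ℝ := fun i => n * -Real.log (1 - fishmongerProb m i) with hx
  have hexp : ∀ i, (1 - fishmongerProb m i) ^ n = Real.exp (-x i) := by
    intro i
    have h1 : 0 < 1 - fishmongerProb m i := by linarith [hp1 i]
    simp only [hx]
    rw [mul_neg, neg_neg, Real.exp_nat_mul, Real.exp_log h1]
  simp_rw [hexp]
  refine tsum_binEntropy_exp_neg_le (fun i => ?_) ?_ hN fun i => ?_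
  · refine mul_pos hn0 (neg_pos.2 (Real.log_neg ?_ ?_))
    · linarith [hp1 i]
    · linarith [hp0 i]
  · have hρ : Real.exp (-(1 / ((max m 1 : ℕ) : ℝ))) < 1 := exp_neg_lt_one (by positivity)
    have h1 : Tendsto (fishmongerProb m) atTop (𝓝 (fishmongerRate / (max m 1 : ℕ) * 0)) :=
      (tendsto_pow_atTop_nhds_zero_of_lt_one (Real.exp_pos _).le hρ).const_mul _
    rw [mul_zero] at h1
    have h2 := ((h1.const_sub 1).log (by norm_num)).neg.const_mul (n : ℝ)
    rwa [sub_zero, Real.log_one, neg_zero, mul_zero] at h2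
  · set ρ := Real.exp (-(1 / ((max m 1 : ℕ) : ℝ))) with hρdef
    have hρ : ρ ≤ 1 := (exp_neg_lt_one (by positivity)).le
    have hρ0 : 0 < ρ := Real.exp_pos _
    have hs : fishmongerProb m (i + 1) = ρ * fishmongerProb m i := by
      simp only [fishmongerProb, pow_succ]
      ring
    have h0 : 0 < 1 - fishmongerProb m i := by linarith [hp1 i]
    have hb := rpow_one_add_le_one_add_mul_self (s := -fishmongerProb m i) (p := ρ)
      (by linarith [hp1 i]) hρ0.le hρ
    have hlog : ρ * Real.log (1 - fishmongerProb m i) ≤ Real.log (1 - fishmongerProb m (i + 1)) := by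
      rw [← Real.log_rpow h0, hs]
      refine Real.log_le_log (Real.rpow_pos_of_pos h0 _) ?_
      rw [← sub_eq_add_neg] at hb
      linarith
    have hinv : Real.exp (1 / ((max m 1 : ℕ) : ℝ)) = ρ⁻¹ := by
      rw [hρdef, ← Real.exp_neg, neg_neg]
    rw [hinv, ← div_eq_mul_inv, div_le_iff₀ hρ0]
    simp only [hx]
    nlinarith

variable {Ω : Type*} [MeasurableSpace Ω] {μ : Measure Ω} [IsProbabilityMeasure μ]

theorem natEntropy_fishmonger_le (m : ℕ) {D : ℕ → Ω → Fin (max m 1) × ℕ}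
    (hD : (fishmonger m).IsDartSequence μ D) (n : ℕ) :
    natEntropy ((fishmonger m).state D n) μ
      ≤ ENNReal.ofReal ((max m 1 : ℕ) * natH0 + 2 * Real.log 2) := by
  have hd := isDiscreteRV_darts hD.measurable n
  set T : Ω → Set ℕ := fun ω => {i | fishmongerCell m i ∈ darts D n ω} with hT
  have hTd : IsDiscreteRV T := hd.comp fun l => {i | fishmongerCell m i ∈ l}
  have hstate : (fishmonger m).state D n = fun ω =>
      (fun A : Set ℕ => {c : Fin (max m 1) × ℕ | c.2 = 0 ∨ ∃ i ∈ A, fishmongerCell m i = c})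
        (T ω) := by
    funext ω
    ext c
    rw [DartboardSketch.state_eq, mem_run_fishmonger, mem_init_fishmonger]
    simp only [hT, Set.mem_ofPred_eq]
    constructor
    · rintro (h | h)
      · by_cases hc : c.2 = 0
        · exact Or.inl hc
        · obtain ⟨i, rfl⟩ := exists_fishmongerCell_eq m hc
          exact Or.inr ⟨i, h, rfl⟩
      · exact Or.inl h
    · rintro (h | ⟨i, h, rfl⟩)
      · exact Or.inr h
      · exact Or.inl h
  have hfin : ∀ ω, (T ω).Finite := fun ω =>
    (List.finite_toSet (darts D n ω)).preimage (fishmongerCell_injective m).injOn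
  have hprob : ∀ i, Real.binEntropy (μ.real {ω | i ∈ T ω})
      = Real.binEntropy ((1 - fishmongerProb m i) ^ n) := by
    intro i
    have h1 := hD.measureReal_notMem_darts n (fishmongerCell m i)
    rw [area_fishmongerCell] at h1
    have h2 : μ.real {ω | fishmongerCell m i ∉ darts D n ω} = 1 - μ.real {ω | i ∈ T ω} :=
      probReal_compl_eq_one_sub (hTd.measurableSet_preimage {A | i ∈ A})
    rw [← h1, h2, Real.binEntropy_one_sub]
  rw [hstate]
  refine (natEntropy_comp_le hTd fun A : Set ℕ =>
    {c : Fin (max m 1) × ℕ | c.2 = 0 ∨ ∃ i ∈ A, fishmongerCell m i = c}).trans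
      ((hTd.natEntropy_set_le hfin).trans ?_)
  simp_rw [hprob]
  -- Without darts every `x` would be `0`, which the Riemann-sum bound excludes; the entropies then
  -- vanish.
  rcases Nat.eq_zero_or_pos n with rfl | hn
  · simp
  exact tsum_binEntropy_fishmonger_le m hn

/-- The lower half is the general memory bound with `κ = 1`; the upper half is the Riemann sum,
whose error `2 log 2` disappears after division by `m`. -/
theorem tendsto_natEntropy_fishmonger {D : ∀ m, ℕ → Ω → Fin (max m 1) × ℕ}
    (hD : ∀ m, (fishmonger m).IsDartSequence μ (D m)) :
    Tendsto (fun m : ℕ => (⨆ n, natEntropy ((fishmonger m).state (D m) n) μ) / (m : ℝ≥0∞)) atTop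
      (𝓝 (ENNReal.ofReal natH0)) := by
  have hH := natH0_pos
  have hlow : ∀ A : ℝ, 0 < A → A < natH0 → ∀ᶠ m : ℕ in atTop,
      ENNReal.ofReal A ≤ (⨆ n, natEntropy ((fishmonger m).state (D m) n) μ) / (m : ℝ≥0∞) := by
    intro A hA hA'
    filter_upwards [DartboardSketch.eventually_le_natEntropy hD isLinearizable_fishmonger
      (isScaleInvariant_fishmonger hD) hA (by rwa [one_mul]), eventually_gt_atTop 0] with m hm h0
    rw [ENNReal.le_div_iff_mul_le (Or.inl (by simp [h0.ne'])) (Or.inl (by finiteness))]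
    rwa [ENNReal.ofReal_mul hA.le, ENNReal.ofReal_natCast] at hm
  have hup : ∀ᶠ m : ℕ in atTop, (⨆ n, natEntropy ((fishmonger m).state (D m) n) μ) / (m : ℝ≥0∞)
      ≤ ENNReal.ofReal (natH0 + 2 * Real.log 2 * (1 / m)) := by
    filter_upwards [eventually_ge_atTop 1] with m hm
    have hm0 : (0 : ℝ) < m := by exact_mod_cast hm
    refine ENNReal.div_le_of_le_mul (iSup_le fun n => ?_)
    refine (natEntropy_fishmonger_le m (hD m) n).trans (le_of_eq ?_)
    rw [max_eq_left hm, ← ENNReal.ofReal_natCast, ← ENNReal.ofReal_mul (by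
      have := Real.log_pos one_lt_two
      positivity)]
    congr 1
    field_simp
  have hlim : Tendsto (fun m : ℕ => ENNReal.ofReal (natH0 + 2 * Real.log 2 * (1 / m))) atTop
      (𝓝 (ENNReal.ofReal natH0)) := by
    have h1 := (tendsto_one_div_atTop_nhds_zero_nat (𝕜 := ℝ)).const_mul (2 * Real.log 2)
    have h2 := h1.const_add natH0
    rw [mul_zero, add_zero] at h2
    exact ENNReal.tendsto_ofReal h2
  refine tendsto_order.2 ⟨fun a ha => ?_, fun b hb => ?_⟩
  · have hat : a ≠ ∞ := ha.ne_top
    have h1 : a.toReal < natH0 := (ENNReal.lt_ofReal_iff_toReal_lt hat).1 ha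
    obtain ⟨A, hA1, hA2⟩ := exists_between h1
    have hA0 : 0 < A := ENNReal.toReal_nonneg.trans_lt hA1
    filter_upwards [hlow A hA0 hA2] with m hm
    exact ((ENNReal.lt_ofReal_iff_toReal_lt hat).2 hA1).trans_le hm
  · filter_upwards [hup, hlim.eventually (gt_mem_nhds hb)] with m h1 h2
    exact h1.trans_lt h2

theorem hasLimitingMVP_fishmonger {D : ∀ m, ℕ → Ω → Fin (max m 1) × ℕ}
    (hD : ∀ m, (fishmonger m).IsDartSequence μ (D m)) :
    DartboardSketch.HasLimitingMVP fishmonger μ D (ENNReal.ofReal (fishmongerH0 / 2)) := by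
  have hlog : 0 < Real.log 2 := Real.log_pos one_lt_two
  have hH := natH0_pos
  refine ⟨fun r => ENNReal.ofReal (Real.log 2)⁻¹ * (ENNReal.ofReal natH0 *
    (ENNReal.ofReal (1 / r ^ 2) * fishmongerVar r)), fun r hr => ?_, ?_⟩
  · have hfin : ENNReal.ofReal (1 / r ^ 2) * fishmongerVar r ≠ ∞ :=
      ENNReal.mul_ne_top ENNReal.ofReal_ne_top
        (ne_top_of_le_ne_top ENNReal.ofReal_ne_top (fishmongerVar_le hr))
    have h := ENNReal.Tendsto.const_mul (a := ENNReal.ofReal (Real.log 2)⁻¹)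
      (ENNReal.Tendsto.mul (tendsto_natEntropy_fishmonger hD) (Or.inr hfin)
        (tendsto_relVariance_fishmonger hD hr) (Or.inr ENNReal.ofReal_ne_top))
      (Or.inr ENNReal.ofReal_ne_top)
    refine h.congr' ?_
    filter_upwards [eventually_gt_atTop 0] with m hm
    rw [DartboardSketch.mvp, DartboardSketch.memory_eq, ← mul_assoc (_ / _),
      ENNReal.div_mul_cancel (by simp [hm.ne']) (by finiteness), mul_assoc]
  · have h := ENNReal.Tendsto.const_mul (a := ENNReal.ofReal (Real.log 2)⁻¹)
      (ENNReal.Tendsto.const_mul (a := ENNReal.ofReal natH0) tendsto_fishmongerVar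
        (Or.inr ENNReal.ofReal_ne_top)) (Or.inr ENNReal.ofReal_ne_top)
    rw [← ENNReal.ofReal_mul hH.le, ← ENNReal.ofReal_mul (by positivity)] at h
    rw [fishmongerH0_eq]
    convert h using 3
    ring

end Memory

/-! ### Optimality of Fishmonger -/

theorem mainTheorem3 {Ω : Type*} [MeasurableSpace Ω] (μ : Measure Ω) [IsProbabilityMeasure μ] :
    -- every linearizable, scale-invariant scheme has limiting MVP at least `H₀ / 2`
    (∀ (C : ℕ → Type*) [∀ m, Countable (C m)] [∀ m, MeasurableSpace (C m)]
        [∀ m, MeasurableSingletonClass (C m)]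
        (X : ∀ m, DartboardSketch (C m)) (D : ∀ m, ℕ → Ω → C m) (κ : ℝ),
        (∀ m, (X m).IsDartSequence μ (D m)) →
        (∀ m, (X m).IsLinearizable) →
        DartboardSketch.IsScaleInvariant X μ D κ → 0 < κ →
        ENNReal.ofReal (fishmongerH0 / 2) ≤ DartboardSketch.lowerLimitingMVP X μ D) ∧
    -- Fishmonger is such a scheme, and attains the bound
    (∀ m, (fishmonger m).IsLinearizable) ∧
    (∀ D : ∀ m, ℕ → Ω → Fin (max m 1) × ℕ,
        (∀ m, (fishmonger m).IsDartSequence μ (D m)) →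
        DartboardSketch.IsScaleInvariant fishmonger μ D 1 ∧
        DartboardSketch.HasLimitingMVP fishmonger μ D (ENNReal.ofReal (fishmongerH0 / 2))) := by
  refine ⟨fun C _ _ _ X D κ hD hX hκ hκ0 => ?_, isLinearizable_fishmonger, fun D hD => ?_⟩
  · exact DartboardSketch.le_lowerLimitingMVP hD hX hκ hκ0
  · exact ⟨isScaleInvariant_fishmonger hD, hasLimitingMVP_fishmonger hD⟩
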